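/- **Lemma (sequence of approximations).** For all natural numbers $d$ and $f$ there exist real constants $c>0$, $C>0$ and a natural number $k$, depending only on $d$ and $f$, such that the following holds. Let $n\ge 0$, consider an open chain of $2n+2$ spins of local dimension $d$, with Hilbert space $(\mathbb C^d)^{\otimes(2n+2)}$ and spins labelled $-n,-n+1,\ldots,n+1$, and let $$H=\sum_{i=-n}^{n}H_i,\qquad 0\le H_i\le 1,$$ where $H_i$ acts on the spins $i$ and $i+1$. Let $\epsilon_0$ be the smallest eigenvalue of $H$, let $G$ be the corresponding eigenspace (the ground-state space), and suppose that $\dim G=f$ and that $H$ has an eigenvalue larger than $\epsilon_0$; let $\epsilon>0$ be the energy gap, i.e. the difference between the smallest eigenvalue larger than $\epsilon_0$ and $\epsilon_0$. For a state $\psi$ let $R(\psi)$ be its Schmidt rank across the middle cut (between the spins $\le 0$ and the spins $\ge 1$). Then for every unit vector $\Psi\in G$ there is a sequence $(\Psi_i)_{i\ge 0}$ of unit vectors such that, for every integer $i\ge 0$, (a) $|\langle\Psi_i,\Psi\rangle|\ge 1-2^{-ci}$; (b) $R(\Psi_i)\le 2^{\,C\,x_i\,(\log(2+x_i))^{k}}$,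 where $x_i=\epsilon^{-1}+\epsilon^{-1/4}\,i^{3/4}$; in other words $R(\Psi_i)=2^{\tilde O(\epsilon^{-1}+\epsilon^{-1/4}i^{3/4})}$, where $\tilde O(x)=O(x\,\mathrm{poly}\log x)$. -/

import Mathlib

open scoped ComplexOrder

noncomputable section

/-- The Hilbert space `(ℂ^d)^{⊗ N}` of a chain of `N` spins of local dimension `d`, in the product
basis: a basis vector is a configuration `Fin N → Fin d`. -/
abbrev ChainSpace (N d : ℕ) : Type := EuclideanSpace ℂ (Fin N → Fin d)

/-- The operator `h` on `ℂ^d ⊗ ℂ^d`, acting on the spins `i` and `j` of the chain, tensored with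
the identity on all other spins. -/
def bondOperator {N d : ℕ} (i j : Fin N) (h : Matrix (Fin d × Fin d) (Fin d × Fin d) ℂ) :
    Matrix (Fin N → Fin d) (Fin N → Fin d) ℂ :=
  fun σ τ => if ∀ k, k ≠ i → k ≠ j → σ k = τ k then h (σ i, σ j) (τ i, τ j) else 0

/-- The nearest-neighbour Hamiltonian on an open chain of `m + 1` spins: the sum over the `m` bonds
of the terms `h i`, where `h i` acts on the neighbouring spins `i` and `i + 1`. -/
def chainHamiltonian {m d : ℕ} (h : Fin m → Matrix (Fin d × Fin d) (Fin d × Fin d) ℂ) :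
    Module.End ℂ (ChainSpace (m + 1) d) :=
  Matrix.toEuclideanLin (∑ i : Fin m, bondOperator i.castSucc i.succ (h i))

/-- The real numbers that are eigenvalues (energy levels) of `H`. -/
def energyLevels {N d : ℕ} (H : Module.End ℂ (ChainSpace N d)) : Set ℝ :=
  {E : ℝ | H.HasEigenvalue (E : ℂ)}

/-- The ground-state energy: the smallest energy level. -/
def groundEnergy {N d : ℕ} (H : Module.End ℂ (ChainSpace N d)) : ℝ :=
  sInf (energyLevels H)

/-- The ground-state space: the eigenspace of the ground-state energy. -/
def groundSpace {N d : ℕ} (H : Module.End ℂ (ChainSpace N d)) : Submodule ℂ (ChainSpace N d) :=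
  H.eigenspace (groundEnergy H : ℂ)

/-- `ε` is the energy gap: there are energy levels above the ground-state energy, and the lowest
of them lies exactly `ε` above it. In particular `ε > 0`. -/
def IsEnergyGap {N d : ℕ} (H : Module.End ℂ (ChainSpace N d)) (ε : ℝ) : Prop :=
  IsLeast {E : ℝ | E ∈ energyLevels H ∧ groundEnergy H < E} (groundEnergy H + ε)

/-- The Schmidt rank of `ψ` across the cut between the first `m` spins and the remaining ones:
the rank of the matrix of coefficients of `ψ`, whose rows are the configurations of the first `m`
spins and whose columns are the configurations of the others. -/
def schmidtRank {N d : ℕ} (m : ℕ) (ψ : ChainSpace N d) : ℕ :=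
  Matrix.rank (Matrix.of
    fun (a : {k : Fin N // (k : ℕ) < m} → Fin d) (b : {k : Fin N // ¬ (k : ℕ) < m} → Fin d) =>
      ψ ((Equiv.piEquivPiSubtypeProd (fun k : Fin N => (k : ℕ) < m) (fun _ => Fin d)).symm (a, b)))

/-- The standard upper bound hidden in `Õ(x) = O(x poly(log x))`, with constant `C` and power `k` of
the logarithm; the argument `2 + x` keeps the logarithm positive for small `x`. -/
def softO (C : ℝ) (k : ℕ) (x : ℝ) : ℝ :=
  C * x * Real.log (2 + x) ^ k

end

/-! Take a block of `s` bonds ending at the middle cut, and cut off the spectra of the Hamiltonians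
on its left and right, shifted to ground energy zero, at height `t`. The resulting operator `T` lies
between `0` and `2t + s`, yet its low spectrum is close to that of the shifted `H`. Only one block
term fails to commute with each side, and conjugating it by `exp (A / 12)` leaves its norm at most
`2` (`norm_adCLM_pow_le`, `norm_exp_conj_le`). So low-energy eigenvectors of `T` have exponentially
small components at high side energy (`norm_expWeight_apply_sq_le`). Hence at most `f` eigenvalues
of `T` lie at or below the shifted ground energy `e`, none lies below `e - δ`, and the others are at
least `e + ε / 2` (`exists_eigenbasis_truncated`).

A rescaled Chebyshev polynomial of degree `l` in `T` is at least `1` on the low levels and shrinks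
the others to about `exp (-l √(ε / t))` (`exists_poly_step`). It creates little entanglement: if `l
< s (k + 1)`, every word of length at most `l` contains some block bond at most `k` times. Cutting
at the first such bond leaves at most `(l + 1) ((d² + 1)(l + 1)) ^ k` right factors (`wordSum_mem`),
and moving between that cut and the middle one costs at most `d ^ s` each way
(`isSumOfProducts_aeval`).

No product vector with large overlap is known in advance, so a bootstrap replaces it. Choose product
vectors whose projections onto the low space of `T` nearly maximize a determinant. Their coordinate
functionals are bounded by `2` on short product vectors (`exists_coordinates`), hence by `2 √r` on
vectors of rank `r`. Evaluating them on outputs of the filter bounds the maximum `ω` of their norms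
by `2 √r (1 + η f ω)`, where `η` is the contraction. If `√r η f` is small then `ω ≤ 4 √r`, and
filtered combinations of these product vectors approximate the whole low space
(`exists_approx_of_contraction`).

The balance is `a = (ε i) ^ (1/4) + const · log (2 + ε⁻¹)`, `s ≈ ε⁻¹ a³`, `t = 36 ε⁻¹ a⁴`, `l = 48
s²`, `k = 48 s`. With `T = ε⁻¹ a⁴ ≥ i` the filter gains `exp (-4T)` while `√r` is at most of order
`exp (3T)` (`parameters_admissible`), and `log r` is `s` up to logarithms. If the block does not fit
into the chain, the ground state itself has small enough rank. -/

/-! ### Operators acting on a set of spins. -/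

section Locality

variable {N d : ℕ}

/-- Pointwise product of two vectors, written in the product basis. -/
noncomputable def cmul (u v : ChainSpace N d) : ChainSpace N d := WithLp.toLp 2 (fun σ => u σ * v σ)

@[simp] lemma cmul_apply (u v : ChainSpace N d) (σ : Fin N → Fin d) : cmul u v σ = u σ * v σ := rfl

lemma cmul_comm (u v : ChainSpace N d) : cmul u v = cmul v u := by
  ext σ; simp [mul_comm]

lemma cmul_add_left (u u' v : ChainSpace N d) : cmul (u + u') v = cmul u v + cmul u' v := by
  ext σ; simp [add_mul]

lemma cmul_smul_left (c : ℂ) (u v : ChainSpace N d) : cmul (c • u) v = c • cmul u v := by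
  ext σ; simp [mul_assoc]

lemma cmul_smul_right (c : ℂ) (u v : ChainSpace N d) : cmul u (c • v) = c • cmul u v := by
  ext σ; simp [mul_left_comm]

lemma cmul_sum_right {ι : Type*} (s : Finset ι) (u : ChainSpace N d) (v : ι → ChainSpace N d) :
    cmul u (∑ i ∈ s, v i) = ∑ i ∈ s, cmul u (v i) := by
  ext σ; simp [Finset.mul_sum]

lemma cmul_sum_left {ι : Type*} (s : Finset ι) (u : ι → ChainSpace N d) (v : ChainSpace N d) :
    cmul (∑ i ∈ s, u i) v = ∑ i ∈ s, cmul (u i) v := by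
  ext σ; simp [Finset.sum_mul]

/-- The vectors whose coefficients depend only on the spins in `S`. -/
def dependsOnSubmodule (S : Set (Fin N)) : Submodule ℂ (ChainSpace N d) where
  carrier := {u | DependsOn u.ofLp S}
  add_mem' hu hv σ τ h := by simp [hu h, hv h]
  zero_mem' σ τ h := by simp
  smul_mem' c u hu σ τ h := by simp [hu h]

lemma dependsOnSubmodule_mono {S T : Set (Fin N)} (h : S ⊆ T) :
    dependsOnSubmodule (d := d) S ≤ dependsOnSubmodule T :=
  fun _ hu _ _ hστ => hu fun k hk => hστ k (h hk)

/-- The operators acting on the spins in `S` only. -/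
def localAlg (S : Set (Fin N)) : Subalgebra ℂ (ChainSpace N d →L[ℂ] ChainSpace N d) where
  carrier := {X | (∀ u, ∀ v ∈ dependsOnSubmodule Sᶜ, X (cmul u v) = cmul (X u) v) ∧
    ∀ T, S ⊆ T → ∀ u ∈ dependsOnSubmodule T, X u ∈ dependsOnSubmodule T}
  mul_mem' := by
    rintro X Y ⟨hX, hX'⟩ ⟨hY, hY'⟩
    refine ⟨fun u v hv => ?_, fun T hT u hu => hX' T hT _ (hY' T hT _ hu)⟩
    rw [mul_apply_eq_comp, hY u v hv, hX _ v hv]; rfl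
  add_mem' := by
    rintro X Y ⟨hX, hX'⟩ ⟨hY, hY'⟩
    refine ⟨fun u v hv => ?_, fun T hT u hu => Submodule.add_mem _ (hX' T hT _ hu) (hY' T hT _ hu)⟩
    rw [add_apply, hY u v hv, hX _ v hv, ← cmul_add_left]; rfl
  algebraMap_mem' := by
    intro c
    refine ⟨fun u v _ => ?_, fun T _ u hu => ?_⟩
    · simp [Algebra.algebraMap_eq_smul_one, cmul_smul_left]
    · simpa [Algebra.algebraMap_eq_smul_one] using Submodule.smul_mem _ c hu

lemma localAlg_mono {S T : Set (Fin N)} (h : S ⊆ T) : localAlg (d := d) S ≤ localAlg T :=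
  fun _ hX => ⟨fun u v hv => hX.1 u v (dependsOnSubmodule_mono (Set.compl_subset_compl.2 h) hv),
    fun T' hT' => hX.2 T' (h.trans hT')⟩

open Classical in
/-- The indicator function of the configurations agreeing with `τ` on `S`. -/
noncomputable def agreeOn (S : Set (Fin N)) (τ : Fin N → Fin d) : ChainSpace N d :=
  WithLp.toLp 2 (fun σ => if ∀ k ∈ S, σ k = τ k then 1 else 0)

lemma agreeOn_mem (S : Set (Fin N)) (τ : Fin N → Fin d) : agreeOn S τ ∈ dependsOnSubmodule S := by
  classical
  intro σ σ' h
  have : (∀ k ∈ S, σ k = τ k) ↔ (∀ k ∈ S, σ' k = τ k) :=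
    forall₂_congr fun k hk => by rw [h k hk]
  simp only [agreeOn, this]

/-- The indicator of one configuration factors into its indicators on `S` and on `Sᶜ`, so products
along any cut span the space. -/
lemma eq_sum_cmul_agreeOn (S : Set (Fin N)) (ψ : ChainSpace N d) :
    ψ = ∑ τ, cmul (agreeOn S τ) (ψ τ • agreeOn Sᶜ τ) := by
  classical
  ext σ
  rw [WithLp.ofLp_sum, Finset.sum_apply, Finset.sum_eq_single σ]
  · simp [agreeOn]
  · intro τ _ hτ
    have : ∃ k, σ k ≠ τ k := by
      by_contra! h; exact hτ (funext h).symm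
    obtain ⟨k, hk⟩ := this
    by_cases hkS : k ∈ S
    · have : ¬ ∀ k ∈ S, σ k = τ k := fun h => hk (h k hkS)
      simp [agreeOn, this]
    · have : ¬ ∀ k, k ∉ S → σ k = τ k := fun h => hk (h k hkS)
      simp [agreeOn, this]
  · simp

lemma ext_on_cmul {S : Set (Fin N)} {F : Type*} [AddCommMonoid F] [Module ℂ F]
    {X Y : ChainSpace N d →ₗ[ℂ] F}
    (h : ∀ u ∈ dependsOnSubmodule S, ∀ v ∈ dependsOnSubmodule Sᶜ, X (cmul u v) = Y (cmul u v)) :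
    X = Y := by
  ext1 ψ
  rw [eq_sum_cmul_agreeOn S ψ, map_sum, map_sum]
  exact Finset.sum_congr rfl fun τ _ =>
    h _ (agreeOn_mem _ _) _ (Submodule.smul_mem _ _ (agreeOn_mem _ _))

/-- On a product split along `S`, both orders give the product of `X u` and `Y v`. Here `Y` has to
preserve the functions of `Sᶜ ⊇ T`, which is why the second clause of `localAlg` ranges over
supersets. -/
lemma commute_of_mem_localAlg {S T : Set (Fin N)} (hST : Disjoint S T)
    {X Y : ChainSpace N d →L[ℂ] ChainSpace N d} (hX : X ∈ localAlg S) (hY : Y ∈ localAlg T) :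
    Commute X Y := by
  have hTS : T ⊆ Sᶜ := hST.subset_compl_left
  have : (X * Y : ChainSpace N d →L[ℂ] ChainSpace N d).toLinearMap = (Y * X).toLinearMap := by
    refine ext_on_cmul (S := S) fun u hu v hv => ?_
    have huT : u ∈ dependsOnSubmodule Tᶜ := dependsOnSubmodule_mono hST.subset_compl_right hu
    have hXu : X u ∈ dependsOnSubmodule Tᶜ :=
      dependsOnSubmodule_mono hST.subset_compl_right (hX.2 S subset_rfl u hu)
    have hYv : Y v ∈ dependsOnSubmodule Sᶜ := hY.2 Sᶜ hTS v hv
    change X (Y (cmul u v)) = Y (X (cmul u v))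
    rw [hX.1 u v hv, cmul_comm (X u) v, hY.1 v _ hXu, cmul_comm u v, hY.1 v u huT,
      cmul_comm (Y v) u, hX.1 u _ hYv, cmul_comm]
  exact ContinuousLinearMap.coe_injective this

/-- The operator acting on spin `i` by the matrix `M`. -/
noncomputable def siteOp (i : Fin N) (M : Matrix (Fin d) (Fin d) ℂ) :
    ChainSpace N d →L[ℂ] ChainSpace N d :=
  LinearMap.toContinuousLinearMap
    { toFun := fun ψ => WithLp.toLp 2 fun σ => ∑ c, M (σ i) c * ψ (Function.update σ i c)
      map_add' := fun ψ φ => by ext σ; simp [mul_add, Finset.sum_add_distrib]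
      map_smul' := fun a ψ => by ext σ; simp [Finset.mul_sum, mul_left_comm] }

lemma siteOp_apply (i : Fin N) (M : Matrix (Fin d) (Fin d) ℂ) (ψ : ChainSpace N d)
    (σ : Fin N → Fin d) : siteOp i M ψ σ = ∑ c, M (σ i) c * ψ (Function.update σ i c) := rfl

lemma siteOp_mem_localAlg {S : Set (Fin N)} {i : Fin N} (hi : i ∈ S)
    (M : Matrix (Fin d) (Fin d) ℂ) : siteOp i M ∈ localAlg S := by
  refine ⟨fun u v hv => ?_, fun T hT u hu σ τ hστ => ?_⟩
  · ext σ
    simp only [siteOp_apply, cmul_apply, Finset.sum_mul]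
    refine Finset.sum_congr rfl fun c _ => ?_
    rw [hv (x := Function.update σ i c) (y := σ)
      fun k hk => Function.update_of_ne (fun h => hk (by rwa [h])) _ _]
    ring
  · simp only [siteOp_apply, hστ i (hT hi)]
    refine Finset.sum_congr rfl fun c _ => ?_
    congr 1
    refine hu fun k hk => ?_
    by_cases hki : k = i
    · subst hki; simp
    · simp [hki, hστ k hk]

/-- Expansion in the matrix units of spin `j`: at most `d²` one-spin products, which is all the
entanglement that one use of a bond can create. -/
lemma toEuclideanCLM_bondOperator {i j : Fin N} (hij : i ≠ j)
    (h : Matrix (Fin d × Fin d) (Fin d × Fin d) ℂ) :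
    Matrix.toEuclideanCLM (n := Fin N → Fin d) (𝕜 := ℂ) (bondOperator i j h) =
      ∑ ab : Fin d × Fin d, siteOp i (Matrix.of fun x y => h (x, ab.1) (y, ab.2)) *
        siteOp j (Matrix.single ab.1 ab.2 1) := by
  ext ψ σ
  rw [Matrix.ofLp_toEuclideanCLM, Matrix.mulVec, sum_apply, WithLp.ofLp_sum,
    Finset.sum_apply]
  simp only [mul_apply_eq_comp, siteOp_apply, dotProduct, bondOperator, ite_mul,
    zero_mul, ← Finset.sum_filter, Matrix.of_apply]
  have h1 : ∀ ab : Fin d × Fin d, ∀ c, (∑ e, Matrix.single ab.1 ab.2 (1 : ℂ)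
      (Function.update σ i c j) e * ψ (Function.update (Function.update σ i c) j e)) =
      if ab.1 = σ j then ψ (Function.update (Function.update σ i c) j ab.2) else 0 := by
    intro ab c
    rw [Function.update_of_ne hij.symm, Finset.sum_eq_single ab.2]
    · by_cases h : ab.1 = σ j <;> simp [Matrix.single, h]
    · intro e _ he
      simp [Matrix.single, he.symm]
    · simp
  simp only [h1, mul_ite, mul_zero]
  rw [Fintype.sum_prod_type, Finset.sum_eq_single (σ j)]
  · simp only [if_true]
    rw [← Finset.sum_product']
    symm
    refine Finset.sum_nbij' (fun p => Function.update (Function.update σ i p.2) j p.1)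
      (fun τ => (τ j, τ i)) ?_ ?_ ?_ ?_ ?_
    · intro p _
      simp only [Finset.mem_filter, Finset.mem_univ, true_and]
      intro k hi hj
      simp [hi, hj]
    · simp
    · intro p _
      simp [hij]
    · intro τ hτ
      simp only [Finset.mem_filter, Finset.mem_univ, true_and] at hτ
      ext k
      by_cases hkj : k = j
      · subst hkj; simp
      by_cases hki : k = i
      · subst hki; simp [hkj]
      simp [hki, hkj, hτ k hki hkj]
    · intro p _
      simp [hij]
  · intro a _ ha
    simp [ha]
  · simp

lemma bondOperator_mem_localAlg {S : Set (Fin N)} {i j : Fin N} (hij : i ≠ j) (hi : i ∈ S)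
    (hj : j ∈ S) (h : Matrix (Fin d × Fin d) (Fin d × Fin d) ℂ) :
    Matrix.toEuclideanCLM (n := Fin N → Fin d) (𝕜 := ℂ) (bondOperator i j h) ∈ localAlg S := by
  rw [toEuclideanCLM_bondOperator hij]
  exact Subalgebra.sum_mem _ fun ab _ =>
    Subalgebra.mul_mem _ (siteOp_mem_localAlg hi _) (siteOp_mem_localAlg hj _)

end Locality

/-! ### Schmidt rank as a number of product terms. -/

section SchmidtRank

variable {N d : ℕ}

/-- `ψ` is a sum of at most `r` products of a function of the spins in `S` and a function of the
other spins. -/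
def IsSumOfProducts (S : Set (Fin N)) (r : ℕ) (ψ : ChainSpace N d) : Prop :=
  ∃ (ι : Type) (_ : Fintype ι) (u v : ι → ChainSpace N d), Fintype.card ι ≤ r ∧
    (∀ i, u i ∈ dependsOnSubmodule S) ∧ (∀ i, v i ∈ dependsOnSubmodule Sᶜ) ∧
    ψ = ∑ i, cmul (u i) (v i)

namespace IsSumOfProducts

variable {S T : Set (Fin N)} {r r' : ℕ} {ψ φ : ChainSpace N d}

lemma mono (h : IsSumOfProducts S r ψ) (hr : r ≤ r') : IsSumOfProducts S r' ψ := by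
  obtain ⟨ι, _, u, v, hc, hu, hv, rfl⟩ := h
  exact ⟨ι, _, u, v, hc.trans hr, hu, hv, rfl⟩

lemma zero : IsSumOfProducts S r (0 : ChainSpace N d) :=
  ⟨Empty, inferInstance, fun _ => 0, fun _ => 0, by simp, by simp, by simp, by simp⟩

lemma cmul {u v : ChainSpace N d} (hu : u ∈ dependsOnSubmodule S)
    (hv : v ∈ dependsOnSubmodule Sᶜ) : IsSumOfProducts S 1 (cmul u v) :=
  ⟨Unit, inferInstance, fun _ => u, fun _ => v, by simp, fun _ => hu, fun _ => hv, by simp⟩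

lemma add (hψ : IsSumOfProducts S r ψ) (hφ : IsSumOfProducts S r' φ) :
    IsSumOfProducts S (r + r') (ψ + φ) := by
  obtain ⟨ι, _, u, v, hc, hu, hv, rfl⟩ := hψ
  obtain ⟨κ, _, u', v', hc', hu', hv', rfl⟩ := hφ
  refine ⟨ι ⊕ κ, inferInstance, Sum.elim u u', Sum.elim v v', ?_, ?_, ?_, ?_⟩
  · rw [Fintype.card_sum]; omega
  · rintro (i | i); exacts [hu i, hu' i]
  · rintro (i | i); exacts [hv i, hv' i]
  · simp

lemma sum {κ : Type*} (s : Finset κ) {f : κ → ChainSpace N d} {R : κ → ℕ}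
    (h : ∀ i ∈ s, IsSumOfProducts S (R i) (f i)) :
    IsSumOfProducts S (∑ i ∈ s, R i) (∑ i ∈ s, f i) := by
  classical
  induction s using Finset.induction_on with
  | empty => simpa using zero
  | insert a s ha ih =>
    rw [Finset.sum_insert ha, Finset.sum_insert ha]
    exact (h a (Finset.mem_insert_self _ _)).add
      (ih fun i hi => h i (Finset.mem_insert_of_mem hi))

lemma symm (h : IsSumOfProducts S r ψ) : IsSumOfProducts Sᶜ r ψ := by
  obtain ⟨ι, _, u, v, hc, hu, hv, rfl⟩ := h
  exact ⟨ι, _, v, u, hc, hv, by simpa using hu, Finset.sum_congr rfl fun i _ => cmul_comm _ _⟩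

lemma map_left (h : IsSumOfProducts S r ψ) {X : ChainSpace N d →L[ℂ] ChainSpace N d}
    (hX : X ∈ localAlg S) : IsSumOfProducts S r (X ψ) := by
  obtain ⟨ι, _, u, v, hc, hu, hv, rfl⟩ := h
  refine ⟨ι, _, fun i => X (u i), v, hc, fun i => hX.2 S subset_rfl _ (hu i), hv, ?_⟩
  rw [map_sum]
  exact Finset.sum_congr rfl fun i _ => hX.1 _ _ (hv i)

lemma map_right (h : IsSumOfProducts S r ψ) {X : ChainSpace N d →L[ℂ] ChainSpace N d}
    (hX : X ∈ localAlg Sᶜ) : IsSumOfProducts S r (X ψ) := by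
  simpa using (h.symm.map_left hX).symm

lemma smul (h : IsSumOfProducts S r ψ) (c : ℂ) : IsSumOfProducts S r (c • ψ) := by
  simpa [Algebra.algebraMap_eq_smul_one] using h.map_left ((localAlg S).algebraMap_mem c)

/-- Splitting each term according to the value of spin `k` lets the right factor be evaluated at
that value and so forget the spin. This is the price `d` of moving the cut by one site. -/
lemma insert (h : IsSumOfProducts S r ψ) (k : Fin N) : IsSumOfProducts (insert k S) (r * d) ψ := by
  classical
  obtain ⟨ι, _, u, v, hc, hu, hv, rfl⟩ := h
  refine ⟨ι × Fin d, inferInstance,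
    fun p => _root_.cmul (u p.1) (WithLp.toLp 2 fun σ => if σ k = p.2 then 1 else 0),
    fun p => WithLp.toLp 2 fun σ => v p.1 (Function.update σ k p.2), ?_, ?_, ?_, ?_⟩
  · simpa using Nat.mul_le_mul_right d hc
  · intro p σ τ hστ
    simp only [cmul_apply, hστ k (Set.mem_insert _ _),
      hu p.1 (x := σ) (y := τ) fun i hi => hστ i (Set.mem_insert_of_mem _ hi)]
  · intro p σ τ hστ
    refine hv p.1 fun i hi => ?_
    by_cases hik : i = k
    · subst hik; simp
    · simp only [ne_eq, hik, not_false_eq_true, Function.update_of_ne]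
      exact hστ i (by simp_all)
  · ext σ
    simp only [WithLp.ofLp_sum, Finset.sum_apply, cmul_apply, Fintype.sum_prod_type]
    refine Finset.sum_congr rfl fun i _ => ?_
    rw [Finset.sum_eq_single (σ k)]
    · simp
    · intro b _ hb; simp [hb.symm]
    · simp

lemma of_insert {k : Fin N} (hk : k ∉ S) (h : IsSumOfProducts (Insert.insert k S) r ψ) :
    IsSumOfProducts S (r * d) ψ := by
  have h1 := (h.symm.insert k).symm
  have : (Insert.insert k (Insert.insert k S)ᶜ)ᶜ = S := by
    ext x; by_cases hx : x = k
    · simp [hx, hk]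
    · simp [hx]
  rwa [this] at h1

lemma lt_succ {m : ℕ} (h : IsSumOfProducts {k : Fin N | (k : ℕ) < m} r ψ) (hm : m < N) :
    IsSumOfProducts {k : Fin N | (k : ℕ) < m + 1} (r * d) ψ := by
  have : {k : Fin N | (k : ℕ) < m + 1} = Insert.insert (⟨m, hm⟩ : Fin N) {k : Fin N | (k : ℕ) < m} := by
    ext x; simp [Fin.ext_iff]; omega
  rw [this]; exact h.insert _

lemma lt_of_succ {m : ℕ} (h : IsSumOfProducts {k : Fin N | (k : ℕ) < m + 1} r ψ) (hm : m < N) :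
    IsSumOfProducts {k : Fin N | (k : ℕ) < m} (r * d) ψ := by
  have : {k : Fin N | (k : ℕ) < m + 1} = Insert.insert (⟨m, hm⟩ : Fin N) {k : Fin N | (k : ℕ) < m} := by
    ext x; simp [Fin.ext_iff]; omega
  rw [this] at h
  exact h.of_insert (by simp)

lemma lt_add {m : ℕ} (h : IsSumOfProducts {k : Fin N | (k : ℕ) < m} r ψ) (a : ℕ) (hm : m + a ≤ N) :
    IsSumOfProducts {k : Fin N | (k : ℕ) < m + a} (r * d ^ a) ψ := by
  induction a with
  | zero => simpa using h
  | succ a ih =>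
    have := (ih (by omega)).lt_succ (by omega)
    rwa [mul_assoc, ← pow_succ] at this

lemma lt_of_add {m a : ℕ} (h : IsSumOfProducts {k : Fin N | (k : ℕ) < m + a} r ψ) (hm : m + a ≤ N) :
    IsSumOfProducts {k : Fin N | (k : ℕ) < m} (r * d ^ a) ψ := by
  induction a generalizing r with
  | zero => simpa using h
  | succ a ih =>
    have := ih (h.lt_of_succ (m := m + a) (by omega)) (by omega)
    rwa [mul_assoc, ← pow_succ'] at this

lemma schmidtRank_le {m : ℕ} (h : IsSumOfProducts {k : Fin N | (k : ℕ) < m} r ψ) :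
    schmidtRank m ψ ≤ r := by
  obtain ⟨ι, _, u, v, hc, hu, hv, rfl⟩ := h
  refine le_trans ?_ hc
  by_cases hd : Nonempty (Fin N → Fin d)
  swap
  · unfold schmidtRank
    have : IsEmpty ({k : Fin N // (k : ℕ) < m} → Fin d) ∨
        IsEmpty ({k : Fin N // ¬ (k : ℕ) < m} → Fin d) := by
      by_contra hne
      rw [not_or, not_isEmpty_iff, not_isEmpty_iff] at hne
      obtain ⟨⟨a⟩, ⟨b⟩⟩ := hne
      exact hd ⟨(Equiv.piEquivPiSubtypeProd (fun k : Fin N => (k : ℕ) < m) (fun _ => Fin d)).symm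
        (a, b)⟩
    rcases this with h | h
    · exact (Matrix.rank_le_card_height _).trans (by simp)
    · exact (Matrix.rank_le_card_width _).trans
        (by rw [Fintype.card_eq_zero_iff.2 h]; exact Nat.zero_le _)
  -- `σ₀` supplies dummy values for the spins a factor does not depend on; the coefficient matrix
  -- then factors through the index set of the products.
  obtain ⟨σ₀⟩ := hd
  unfold schmidtRank
  set e := (Equiv.piEquivPiSubtypeProd (fun k : Fin N => (k : ℕ) < m) (fun _ => Fin d)).symm with he
  let A : Matrix ({k : Fin N // (k : ℕ) < m} → Fin d) ι ℂ :=
    Matrix.of fun a i => u i (e (a, fun k => σ₀ k))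
  let B : Matrix ι ({k : Fin N // ¬ (k : ℕ) < m} → Fin d) ℂ :=
    Matrix.of fun i b => v i (e (fun k => σ₀ k, b))
  have hAB : (Matrix.of fun a b => (∑ i, _root_.cmul (u i) (v i) : ChainSpace N d) (e (a, b))) =
      A * B := by
    ext a b
    simp only [Matrix.mul_apply, Matrix.of_apply, WithLp.ofLp_sum, Finset.sum_apply, cmul_apply, A, B]
    refine Finset.sum_congr rfl fun i _ => ?_
    rw [hu i (x := e (a, b)) (y := e (a, fun k => σ₀ k)), hv i (x := e (a, b)) (y := e (fun k => σ₀ k, b))]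
    · intro k hk
      have : ¬ (k : ℕ) < m := hk
      simp [he, Equiv.piEquivPiSubtypeProd, this]
    · intro k hk
      have : (k : ℕ) < m := hk
      simp [he, Equiv.piEquivPiSubtypeProd, this]
  rw [hAB]
  exact (Matrix.rank_mul_le_left A B).trans (Matrix.rank_le_card_width A)

end IsSumOfProducts

/-- Each factor is a function on all configurations, so the tensor product rule acquires the number
of configurations. The bijection on pairs of configurations exchanges their parts outside `S`. -/
lemma inner_cmul_mul (S : Set (Fin N)) {u u' v v' : ChainSpace N d}
    (hu : u ∈ dependsOnSubmodule S) (hu' : u' ∈ dependsOnSubmodule S)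
    (hv : v ∈ dependsOnSubmodule Sᶜ) (hv' : v' ∈ dependsOnSubmodule Sᶜ) :
    inner ℂ (cmul u v) (cmul u' v') * (Fintype.card (Fin N → Fin d) : ℂ) =
      inner ℂ u u' * inner ℂ v v' := by
  classical
  simp only [PiLp.inner_apply, RCLike.inner_apply, cmul_apply, map_mul]
  have hcard : (Fintype.card (Fin N → Fin d) : ℂ) = ∑ _τ : Fin N → Fin d, (1 : ℂ) := by simp
  rw [hcard, Finset.sum_mul_sum, Finset.sum_mul_sum, ← Finset.sum_product', ← Finset.sum_product']
  let sw : (Fin N → Fin d) × (Fin N → Fin d) → (Fin N → Fin d) × (Fin N → Fin d) :=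
    fun p => (fun k => if k ∈ S then p.1 k else p.2 k, fun k => if k ∈ S then p.2 k else p.1 k)
  have hsw : ∀ p, sw (sw p) = p := by
    intro p; ext k <;> by_cases hk : k ∈ S <;> simp [sw, hk]
  refine Finset.sum_nbij' sw sw (by simp) (by simp) (fun p _ => hsw p) (fun p _ => hsw p) ?_
  intro p _
  have h1 : ∀ w ∈ dependsOnSubmodule (d := d) S, w (sw p).1 = w p.1 := fun w hw =>
    hw fun k hk => by simp [sw, hk]
  have h2 : ∀ w ∈ dependsOnSubmodule (d := d) Sᶜ, w (sw p).2 = w p.1 := fun w hw =>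
    hw fun k hk => by have : k ∉ S := hk; simp [sw, this]
  rw [h1 u hu, h1 u' hu', h2 v hv, h2 v' hv']
  ring

lemma inner_cmul_eq_zero {S : Set (Fin N)} {u u' v v' : ChainSpace N d}
    (hu : u ∈ dependsOnSubmodule S) (hu' : u' ∈ dependsOnSubmodule S)
    (hv : v ∈ dependsOnSubmodule Sᶜ) (hv' : v' ∈ dependsOnSubmodule Sᶜ) (h : inner ℂ u u' = 0) :
    inner ℂ (cmul u v) (cmul u' v') = 0 := by
  have := inner_cmul_mul S hu hu' hv hv'
  rw [h, zero_mul, mul_eq_zero] at this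
  rcases this with h | h
  · exact h
  · have : IsEmpty (Fin N → Fin d) := by
      rw [← Fintype.card_eq_zero_iff]; exact_mod_cast h
    simp [PiLp.inner_apply]

lemma norm_sum_sq_of_orthogonal {E : Type*} [NormedAddCommGroup E] [InnerProductSpace ℂ E]
    {ι : Type*} [Fintype ι] {x : ι → E} (h : ∀ i j, i ≠ j → inner ℂ (x i) (x j) = 0) :
    ‖∑ j, x j‖ ^ 2 = ∑ j, ‖x j‖ ^ 2 := by
  have h1 : inner ℂ (∑ j, x j) (∑ j, x j) = ∑ j, inner ℂ (x j) (x j) := by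
    rw [sum_inner]
    refine Finset.sum_congr rfl fun j _ => ?_
    rw [inner_sum, Finset.sum_eq_single j]
    · intro i _ hi; exact h j i hi.symm
    · simp
  have h2 := congrArg Complex.re h1
  rw [Complex.re_sum] at h2
  simp only [← inner_self_eq_norm_sq (𝕜 := ℂ)]
  exact h2

lemma sum_norm_le_sqrt_mul_norm_sum {E : Type*} [NormedAddCommGroup E] [InnerProductSpace ℂ E]
    {n : ℕ} {x : Fin n → E} (h : ∀ i j, i ≠ j → inner ℂ (x i) (x j) = 0) :
    ∑ j, ‖x j‖ ≤ Real.sqrt n * ‖∑ j, x j‖ := by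
  refine Real.le_sqrt_of_sq_le ?_ |>.trans_eq (b := Real.sqrt (n * ‖∑ j, x j‖ ^ 2)) ?_
  · have := sq_sum_le_card_mul_sum_sq (s := Finset.univ) (f := fun j => ‖x j‖)
    rw [norm_sum_sq_of_orthogonal h]
    simpa using this
  · rw [Real.sqrt_mul (by positivity), Real.sqrt_sq (norm_nonneg _)]

/-- A functional that is bounded by `c` on product vectors is bounded by `c √r` on sums of `r`
product vectors. -/
lemma IsSumOfProducts.norm_apply_le {S : Set (Fin N)} {r : ℕ} {ψ : ChainSpace N d}
    (h : IsSumOfProducts S r ψ) {L : ChainSpace N d →L[ℂ] ℂ} {c : ℝ} (hc : 0 ≤ c)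
    (hL : ∀ u ∈ dependsOnSubmodule S, ∀ v ∈ dependsOnSubmodule Sᶜ,
      ‖L (_root_.cmul u v)‖ ≤ c * ‖_root_.cmul u v‖) :
    ‖L ψ‖ ≤ c * Real.sqrt r * ‖ψ‖ := by
  obtain ⟨ι, _, u, v, hcard, hu, hv, rfl⟩ := h
  -- With an orthonormal basis of the left factors the products become mutually orthogonal, so
  -- Cauchy–Schwarz loses only `√r` in the triangle inequality.
  let U : Submodule ℂ (ChainSpace N d) := Submodule.span ℂ (Set.range u)
  have hUS : U ≤ dependsOnSubmodule S := Submodule.span_le.2 (by rintro _ ⟨i, rfl⟩; exact hu i)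
  let e := stdOrthonormalBasis ℂ U
  have hr : Module.finrank ℂ U ≤ r := (finrank_range_le_card u).trans hcard
  let y : Fin (Module.finrank ℂ U) → ChainSpace N d := fun j =>
    ∑ i, (inner ℂ (e j : ChainSpace N d) (u i)) • v i
  have hy : ∀ j, y j ∈ dependsOnSubmodule Sᶜ := fun j =>
    Submodule.sum_mem _ fun i _ => Submodule.smul_mem _ _ (hv i)
  have hexp : ∑ i, _root_.cmul (u i) (v i) = ∑ j, _root_.cmul (e j : ChainSpace N d) (y j) := by
    have hui : ∀ i, u i = ∑ j, inner ℂ (e j : ChainSpace N d) (u i) • (e j : ChainSpace N d) := by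
      intro i
      have := e.sum_repr' (⟨u i, Submodule.subset_span ⟨i, rfl⟩⟩ : U)
      have h2 := congrArg (Subtype.val) this
      simpa using h2.symm
    calc ∑ i, _root_.cmul (u i) (v i)
        = ∑ i, ∑ j, inner ℂ (e j : ChainSpace N d) (u i) • _root_.cmul (e j : ChainSpace N d) (v i) := by
          refine Finset.sum_congr rfl fun i _ => ?_
          conv_lhs => rw [hui i]
          rw [cmul_sum_left]
          simp only [cmul_smul_left]
      _ = _ := by
          rw [Finset.sum_comm]
          refine Finset.sum_congr rfl fun j _ => ?_
          simp only [y, cmul_sum_right, cmul_smul_right]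
  rw [hexp]
  have horth : ∀ i j, i ≠ j → inner ℂ (_root_.cmul (e i : ChainSpace N d) (y i))
      (_root_.cmul (e j : ChainSpace N d) (y j)) = 0 := by
    intro i j hij
    refine inner_cmul_eq_zero (hUS (e i).2) (hUS (e j).2) (hy i) (hy j) ?_
    have := e.orthonormal.2 hij
    simpa using this
  set x : Fin (Module.finrank ℂ U) → ChainSpace N d := fun j => _root_.cmul (e j : ChainSpace N d) (y j)
  have h1 : ‖L (∑ j, x j)‖ ≤ c * ∑ j, ‖x j‖ := by
    rw [map_sum, Finset.mul_sum]
    exact (norm_sum_le _ _).trans (Finset.sum_le_sum fun j _ => hL _ (hUS (e j).2) _ (hy j))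
  have h2 : ∑ j, ‖x j‖ ≤ Real.sqrt r * ‖∑ j, x j‖ := by
    refine (sum_norm_le_sqrt_mul_norm_sum horth).trans ?_
    gcongr
  calc _ ≤ c * ∑ j, ‖x j‖ := h1
    _ ≤ c * (Real.sqrt r * ‖∑ j, x j‖) := by gcongr
    _ = _ := by ring

end SchmidtRank

/-! ### Expansion of powers into words, sorted by a rarely used letter. -/

section WordSum

set_option linter.unusedSectionVars false

variable {A : Type*} [Ring A] [Algebra ℂ A] {s : ℕ}

/-- The sum over all words of length `m` in the letters `a` and `h x`, weighted by a function `g`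
of the number of occurrences of the letters `h x`. -/
def wordSum (a : A) (h : Fin s → A) : ℕ → ((Fin s → ℕ) → ℂ) → A
  | 0, g => algebraMap ℂ A (g 0)
  | m + 1, g => wordSum a h m g * a + ∑ x, wordSum a h m (fun v => g (v + Pi.single x 1)) * h x

variable {a : A} {h : Fin s → A}

lemma wordSum_zero (m : ℕ) : wordSum a h m (fun _ => 0) = 0 := by
  induction m with
  | zero => simp [wordSum]
  | succ m ih => simp [wordSum, ih]

lemma wordSum_add (m : ℕ) (g g' : (Fin s → ℕ) → ℂ) :
    wordSum a h m (fun v => g v + g' v) = wordSum a h m g + wordSum a h m g' := by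
  induction m generalizing g g' with
  | zero => simp [wordSum]
  | succ m ih =>
    simp only [wordSum, ih, add_mul, Finset.sum_add_distrib]
    abel

lemma wordSum_sum {ι : Type*} (m : ℕ) (t : Finset ι) (g : ι → (Fin s → ℕ) → ℂ) :
    wordSum a h m (fun v => ∑ i ∈ t, g i v) = ∑ i ∈ t, wordSum a h m (g i) := by
  classical
  induction t using Finset.induction_on with
  | empty => simp [wordSum_zero]
  | insert i t hi ih => simp only [Finset.sum_insert hi, wordSum_add, ih]

lemma wordSum_one (m : ℕ) : wordSum a h m (fun _ => 1) = (a + ∑ x, h x) ^ m := by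
  induction m with
  | zero => simp [wordSum]
  | succ m ih => simp only [wordSum, ih, pow_succ, mul_add, Finset.mul_sum]

lemma wordSum_eq_zero {m : ℕ} {g : (Fin s → ℕ) → ℂ} (hg : ∀ v, ∑ x, v x ≤ m → g v = 0) :
    wordSum a h m g = 0 := by
  induction m generalizing g with
  | zero => simp [wordSum, hg 0]
  | succ m ih =>
    simp only [wordSum]
    rw [ih fun v hv => hg v (by omega), Finset.sum_eq_zero, zero_mul, zero_add]
    intro x _
    rw [ih, zero_mul]
    intro v hv
    refine hg _ ?_
    simp only [Pi.add_apply, Finset.sum_add_distrib, Finset.sum_pi_single', Finset.mem_univ, if_true]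
    omega

/-- The weight selecting the words in which `j` is the first index whose letter occurs at most `k`
times. -/
def firstSparse (k : ℕ) (j : Fin s) (v : Fin s → ℕ) : ℂ :=
  if (∀ x < j, k < v x) ∧ v j ≤ k then 1 else 0

/-- Pigeonhole: if every `h x` occurred more than `k` times, the word would have at least `s (k +
1)` letters. Sorting by the first sparse index makes the classes disjoint, and membership in a class
does not depend on the letters after that index. -/
lemma pow_eq_sum_wordSum_firstSparse {m k : ℕ} (hm : m < s * (k + 1)) :
    (a + ∑ x, h x) ^ m = ∑ j, wordSum a h m (firstSparse k j) := by
  classical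
  have h1 : ∀ v : Fin s → ℕ, (1 : ℂ) =
      (∑ j, firstSparse k j v) + if ∀ x, k < v x then 1 else 0 := by
    intro v
    by_cases hv : ∀ x, k < v x
    · rw [if_pos hv, Finset.sum_eq_zero, zero_add]
      intro j _
      exact if_neg fun h => absurd h.2 (not_le.2 (hv j))
    · rw [if_neg hv, add_zero]
      push Not at hv
      have hex : ∃ j : Fin s, v j ≤ k ∧ ∀ x < j, k < v x := by
        obtain ⟨j, hj, hmin⟩ := WellFounded.has_min (wellFounded_lt (α := Fin s)) {j | v j ≤ k} hv
        exact ⟨j, hj, fun x hx => by by_contra hc; exact hmin x (not_lt.1 hc) hx⟩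
      obtain ⟨j, hj, hlt⟩ := hex
      rw [Finset.sum_eq_single j]
      · exact (if_pos ⟨hlt, hj⟩).symm
      · intro i _ hij
        refine if_neg fun hi => ?_
        rcases lt_or_gt_of_ne hij with hl | hl
        · exact absurd hi.2 (not_le.2 (hlt i hl))
        · exact absurd hj (not_le.2 (hi.1 j hl))
      · simp
  rw [← wordSum_one]
  rw [show (fun _ : Fin s → ℕ => (1 : ℂ)) = _ from funext h1, wordSum_add, wordSum_sum, wordSum_eq_zero, add_zero]
  intro v hv
  refine if_neg fun hk => ?_
  have : ∑ _x : Fin s, (k + 1) ≤ ∑ x, v x := Finset.sum_le_sum fun x _ => hk x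
  simp at this
  omega

open Classical Pointwise in
/-- Products `B ^ q₀ * o₁ * B ^ q₁ * ⋯ * oₖ * B ^ qₖ` with `oᵢ ∈ O`, with `qₖ ≤ m` and the other
exponents at most `l`. -/
noncomputable def gapWords (B : A) (O : Finset A) (l : ℕ) : ℕ → ℕ → Finset A
  | 0, m => (Finset.range (m + 1)).image (B ^ ·)
  | k + 1, m => gapWords B O l k l * O * (Finset.range (m + 1)).image (B ^ ·)

variable {B : A} {O : Finset A} {l : ℕ}

open Classical Pointwise in
lemma card_gapWords_le (k m : ℕ) (hm : m ≤ l) :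
    (gapWords B O l k m).card ≤ (l + 1) * (O.card * (l + 1)) ^ k := by
  have hP : ∀ m ≤ l, ((Finset.range (m + 1)).image (B ^ ·)).card ≤ l + 1 := fun m hm =>
    Finset.card_image_le.trans (by simpa using hm)
  induction k generalizing m with
  | zero => simpa [gapWords] using hP m hm
  | succ k ih =>
    simp only [gapWords]
    calc _ ≤ (gapWords B O l k l).card * O.card * ((Finset.range (m + 1)).image (B ^ ·)).card :=
          Finset.card_mul_le.trans (Nat.mul_le_mul_right _ Finset.card_mul_le)
      _ ≤ ((l + 1) * (O.card * (l + 1)) ^ k) * O.card * (l + 1) :=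
          Nat.mul_le_mul (Nat.mul_le_mul_right _ (ih l le_rfl)) (hP m hm)
      _ = _ := by ring

open Classical Pointwise in
lemma gapWords_mono (k : ℕ) {m m' : ℕ} (hm : m ≤ m') :
    gapWords B O l k m ⊆ gapWords B O l k m' := by
  have hP : (Finset.range (m + 1)).image (B ^ ·) ⊆ (Finset.range (m' + 1)).image (B ^ ·) :=
    Finset.image_subset_image (by simpa using hm)
  cases k with
  | zero => exact hP
  | succ k => exact Finset.mul_subset_mul_left hP

-- Because `1 ∈ O`, words with fewer than `k` inserted factors are also covered by the pattern with
-- exactly `k`.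
open Classical Pointwise in
lemma one_mem_gapWords (hO : 1 ∈ O) (k m : ℕ) : 1 ∈ gapWords B O l k m := by
  have hP : ∀ m, 1 ∈ (Finset.range (m + 1)).image (B ^ ·) := fun m =>
    Finset.mem_image.2 ⟨0, by simp, pow_zero _⟩
  induction k generalizing m with
  | zero => exact hP m
  | succ k ih =>
    simpa [gapWords] using Finset.mul_mem_mul (Finset.mul_mem_mul (ih l) hO) (hP m)

open Classical Pointwise in
lemma gapWords_subset {R : Subalgebra ℂ A} (hB : B ∈ R) (hO : ∀ o ∈ O, o ∈ R) (k m : ℕ) :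
    ∀ w ∈ gapWords B O l k m, w ∈ R := by
  have hP : ∀ m, ∀ w ∈ (Finset.range (m + 1)).image (B ^ ·), w ∈ R := by
    intro m w hw
    obtain ⟨q, _, rfl⟩ := Finset.mem_image.1 hw
    exact R.pow_mem hB q
  induction k generalizing m with
  | zero => exact hP m
  | succ k ih =>
    intro w hw
    obtain ⟨x, hx, y, hy, rfl⟩ := Finset.mem_mul.1 hw
    obtain ⟨z, hz, o, ho, rfl⟩ := Finset.mem_mul.1 hx
    exact R.mul_mem (R.mul_mem (ih l z hz) (hO o ho)) (hP m y hy)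

open Classical Pointwise in
lemma mul_mem_gapWords_succ {k m : ℕ} {w : A} (hw : w ∈ gapWords B O l k m) :
    w * B ∈ gapWords B O l k (m + 1) := by
  have hP : ∀ w ∈ (Finset.range (m + 1)).image (B ^ ·),
      w * B ∈ (Finset.range (m + 1 + 1)).image (B ^ ·) := by
    intro w hw
    obtain ⟨q, hq, rfl⟩ := Finset.mem_image.1 hw
    exact Finset.mem_image.2 ⟨q + 1, by simp at hq ⊢; omega, pow_succ _ _⟩
  cases k with
  | zero => exact hP w hw
  | succ k =>
    obtain ⟨x, hx, y, hy, rfl⟩ := Finset.mem_mul.1 hw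
    rw [mul_assoc]
    exact Finset.mul_mem_mul hx (hP y hy)

open Classical Pointwise in
lemma mul_mem_gapWords_of_mem {k m : ℕ} (hm : m ≤ l) {w o : A} (hw : w ∈ gapWords B O l k m)
    (ho : o ∈ O) : w * o ∈ gapWords B O l (k + 1) (m + 1) := by
  have : w * o * 1 ∈ gapWords B O l (k + 1) (m + 1) :=
    Finset.mul_mem_mul (Finset.mul_mem_mul (gapWords_mono k hm hw) ho)
      (Finset.mem_image.2 ⟨0, by simp, pow_zero _⟩)
  simpa using this

lemma mul_span_mul_mem {L : Subalgebra ℂ A} {V W : Finset A} {X y : A}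
    (hX : X ∈ Subalgebra.toSubmodule L * Submodule.span ℂ (V : Set A))
    (hy : ∀ l ∈ L, ∀ w ∈ V, l * w * y ∈ Subalgebra.toSubmodule L * Submodule.span ℂ (W : Set A)) :
    X * y ∈ Subalgebra.toSubmodule L * Submodule.span ℂ (W : Set A) := by
  induction hX using Submodule.mul_induction_on' with
  | mem_mul_mem l hl n hn =>
    induction hn using Submodule.span_induction with
    | mem w hw => exact hy l hl w hw
    | zero => simp
    | add p q _ _ hp hq => rw [mul_add, add_mul]; exact Submodule.add_mem _ hp hq
    | smul c p _ hp =>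
      rw [mul_smul_comm, smul_mul_assoc]; exact Submodule.smul_mem _ c hp
  | add p _ q _ hp hq => rw [add_mul]; exact Submodule.add_mem _ hp hq

/-- Left letters commute past all right factors and collect in `L`. The weight ignores the letters
after `j`, so these and `r₀` enter only through their sum `B`: between two occurrences of `h j` the
right side sees just a power of `B`. The number of right factors therefore depends on `k` and `l`,
not on the number of words. -/
lemma wordSum_mem {L R : Subalgebra ℂ A} (hLR : ∀ x ∈ L, ∀ y ∈ R, Commute x y) {a₀ r₀ : A}
    (j : Fin s) (ha₀ : a₀ ∈ L) (hr₀ : r₀ ∈ R) (hlt : ∀ x < j, h x ∈ L) (hgt : ∀ x, j < x → h x ∈ R)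
    (hO : ∀ o ∈ O, o ∈ R) (hO1 : 1 ∈ O)
    (hj : h j ∈ Subalgebra.toSubmodule L * Submodule.span ℂ (O : Set A))
    {k m : ℕ} (hm : m ≤ l) {g : (Fin s → ℕ) → ℂ} (hg : ∀ x, j < x → ∀ v, g (v + Pi.single x 1) = g v)
    (hgk : ∀ v, k < v j → g v = 0) :
    wordSum (a₀ + r₀) h m g ∈ Subalgebra.toSubmodule L *
      Submodule.span ℂ (gapWords (r₀ + ∑ x ∈ Finset.univ.filter (j < ·), h x) O l k m : Set A) := by
  set B := r₀ + ∑ x ∈ Finset.univ.filter (j < ·), h x with hB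
  have hBR : B ∈ R := R.add_mem hr₀ (Subalgebra.sum_mem _ fun x hx => hgt x (by simpa using hx))
  have mem_of : ∀ {k m : ℕ} {l' w : A}, l' ∈ L → w ∈ gapWords B O l k m →
      l' * w ∈ Subalgebra.toSubmodule L * Submodule.span ℂ (gapWords B O l k m : Set A) :=
    fun hl hw => Submodule.mul_mem_mul hl (Submodule.subset_span hw)
  have hLmul : ∀ {k m : ℕ} {X y : A}, y ∈ L →
      X ∈ Subalgebra.toSubmodule L * Submodule.span ℂ (gapWords B O l k m : Set A) →
      X * y ∈ Subalgebra.toSubmodule L * Submodule.span ℂ (gapWords B O l k (m + 1) : Set A) := by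
    intro k m X y hy hX
    refine mul_span_mul_mem hX fun l' hl w hw => ?_
    rw [mul_assoc, ← (hLR y hy w (gapWords_subset hBR hO k m w hw)).eq, ← mul_assoc]
    exact mem_of (L.mul_mem hl hy) (gapWords_mono k (Nat.le_succ m) hw)
  induction m generalizing k g with
  | zero =>
    have := mem_of (L.algebraMap_mem (g 0)) (one_mem_gapWords (B := B) (l := l) hO1 k 0)
    simpa [wordSum] using this
  | succ m ih =>
    have hm' : m ≤ l := (Nat.le_succ m).trans hm
    have hsplit : wordSum (a₀ + r₀) h (m + 1) g = wordSum (a₀ + r₀) h m g * a₀ +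
        wordSum (a₀ + r₀) h m g * B +
        ∑ x ∈ Finset.univ.filter (· < j), wordSum (a₀ + r₀) h m (fun v => g (v + Pi.single x 1)) * h x +
        wordSum (a₀ + r₀) h m (fun v => g (v + Pi.single j 1)) * h j := by
      have huniv : (Finset.univ : Finset (Fin s)) =
          Finset.univ.filter (j < ·) ∪ (Finset.univ.filter (· < j) ∪ {j}) := by
        ext x; simp only [Finset.mem_univ, Finset.mem_union, Finset.mem_filter, true_and,
          Finset.mem_singleton, true_iff]
        rcases lt_trichotomy x j with h | h | h <;> simp [h]
      simp only [wordSum]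
      conv_lhs => rw [huniv]
      rw [Finset.sum_union, Finset.sum_union, Finset.sum_singleton]
      · have : ∑ x ∈ Finset.univ.filter (j < ·), wordSum (a₀ + r₀) h m (fun v => g (v + Pi.single x 1)) * h x
            = wordSum (a₀ + r₀) h m g * ∑ x ∈ Finset.univ.filter (j < ·), h x := by
          rw [Finset.mul_sum]
          refine Finset.sum_congr rfl fun x hx => ?_
          simp only [hg x (by simpa using hx)]
        rw [this, hB]
        noncomm_ring
      · rw [Finset.disjoint_left]; intro x; simp only [Finset.mem_filter, Finset.mem_univ, true_and, Finset.mem_singleton]; exact fun hx => hx.ne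
      · rw [Finset.disjoint_left]; intro x; simp only [Finset.mem_filter, Finset.mem_univ, true_and, Finset.mem_union, Finset.mem_singleton]
        exact fun hx hc => hc.elim (fun h => absurd hx h.asymm) fun h => hx.ne' h
    have hgx : ∀ x y : Fin s, j < y → ∀ v : Fin s → ℕ, g (v + Pi.single y 1 + Pi.single x 1) = g (v + Pi.single x 1) := by
      intro x y hy v
      rw [add_right_comm, hg y hy]
    rw [hsplit]
    refine Submodule.add_mem _ (Submodule.add_mem _ (Submodule.add_mem _ ?_ ?_) ?_) ?_
    · exact hLmul ha₀ (ih hm' hg hgk)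
    · refine mul_span_mul_mem (ih hm' hg hgk) fun l' hl w hw => ?_
      rw [mul_assoc]
      exact mem_of hl (mul_mem_gapWords_succ hw)
    · refine Submodule.sum_mem _ fun x hx => ?_
      have hxj : x < j := by simpa using hx
      refine hLmul (hlt x hxj) (ih hm' (hgx x) fun v hv => hgk _ ?_)
      simpa [hxj.ne'] using hv
    -- Each occurrence of `h j` uses up one of the `k` allowed insertions; with none left the weight
    -- vanishes.
    · cases k with
      | zero =>
        have : (fun v : Fin s → ℕ => g (v + Pi.single j 1)) = fun _ => 0 := by
          funext v; exact hgk _ (by simp)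
        rw [this, wordSum_zero, zero_mul]
        exact Submodule.zero_mem _
      | succ k =>
        have h1 := ih (k := k) (g := fun v : Fin s → ℕ => g (v + Pi.single j 1)) hm' (hgx j)
          (fun v hv => hgk _ (by simpa using hv))
        refine mul_span_mul_mem h1 fun l' hl w hw => ?_
        have hwR := gapWords_subset hBR hO k m w hw
        generalize h j = y at hj
        induction hj using Submodule.mul_induction_on' with
        | mem_mul_mem p hp n hn =>
          induction hn using Submodule.span_induction with
          | mem o ho =>
            have : l' * w * (p * o) = (l' * p) * (w * o) := by
              rw [mul_assoc, ← mul_assoc w, ← (hLR p hp w hwR).eq]; simp only [mul_assoc]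
            rw [this]
            exact mem_of (L.mul_mem hl hp) (mul_mem_gapWords_of_mem hm' hw ho)
          | zero => simp
          | add p q _ _ hp hq => simp only [mul_add] at hp hq ⊢; exact Submodule.add_mem _ hp hq
          | smul c p _ hp => simp only [mul_smul_comm] at hp ⊢; exact Submodule.smul_mem _ c hp
        | add p _ q _ hp hq => rw [mul_add]; exact Submodule.add_mem _ hp hq

/-- Collecting the left coefficients of each right word bounds the number of products by `V.card`,
however many elements of `L` are involved. -/
lemma exists_eq_sum_mul {L : Subalgebra ℂ A} {V : Finset A} {X : A}
    (hX : X ∈ Subalgebra.toSubmodule L * Submodule.span ℂ (V : Set A)) :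
    ∃ c : A → A, (∀ w, c w ∈ L) ∧ X = ∑ w ∈ V, c w * w := by
  induction hX using Submodule.mul_induction_on' with
  | mem_mul_mem l hl n hn =>
    obtain ⟨f, -, rfl⟩ := Submodule.mem_span_finset.1 hn
    refine ⟨fun w => f w • l, fun w => L.smul_mem hl _, ?_⟩
    simp [Finset.mul_sum]
  | add p _ q _ hp hq =>
    obtain ⟨c, hc, rfl⟩ := hp
    obtain ⟨c', hc', rfl⟩ := hq
    exact ⟨fun w => c w + c' w, fun w => L.add_mem (hc w) (hc' w), by
      simp [add_mul, Finset.sum_add_distrib]⟩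

end WordSum

/-! ### The polynomial filter. -/

section Chebyshev

open Polynomial

/-- A rescaled Chebyshev polynomial: at least `1` on `(-∞, e]` and exponentially small on
`[lo, top]`. -/
lemma exists_poly_step (l : ℕ) {e lo top : ℝ} (h1 : e < lo) (h2 : lo < top)
    (h3 : lo - e ≤ (top - lo) / 2) :
    ∃ p : ℝ[X], p.natDegree ≤ l ∧ (∀ x ≤ e, 1 ≤ p.eval x) ∧
      ∀ x, lo ≤ x → x ≤ top →
        |p.eval x| ≤ 2 * Real.exp (-(l * Real.sqrt (2 * (lo - e) / (top - lo)))) := by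
  have hD : 0 < top - lo := sub_pos.2 h2
  set z := 2 * (lo - e) / (top - lo) with hz
  have hz0 : 0 < z := by have := sub_pos.2 h1; positivity
  have hz1 : z ≤ 1 := by rw [hz, div_le_one hD]; linarith
  -- The decreasing affine map taking `top` to `-1`, `lo` to `1` and `e` to `1 + z`.
  set c : ℝ[X] := C ((top + lo) / (top - lo)) - C (2 / (top - lo)) * X with hc
  have hceval : ∀ x, c.eval x = (top + lo - 2 * x) / (top - lo) := by
    intro x; simp [hc]; field_simp
  set θ := Real.sqrt z
  -- `cosh θ ≤ exp (z / 2) ≤ 1 + z / 2 + (z / 2)²`, and `z ≤ 1` finishes. Thus the Chebyshev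
  -- polynomial is at least `cosh (l θ)` from `1 + z` on.
  have hθ1 : Real.cosh θ ≤ 1 + z := by
    have hs : θ ^ 2 = z := Real.sq_sqrt hz0.le
    refine (Real.cosh_le_exp_half_sq θ).trans ?_
    rw [hs]
    have hb := Real.abs_exp_sub_one_sub_id_le (x := z / 2) (by rw [abs_le]; constructor <;> linarith)
    rw [abs_le] at hb
    nlinarith [hb.2]
  have hT1 : ∀ y, Real.cosh θ ≤ y → Real.cosh (l * θ) ≤ (Chebyshev.T ℝ l).eval y := by
    intro y hy
    have hy1 : 1 ≤ y := (Real.one_le_cosh θ).trans hy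
    have h := Chebyshev.T_real_cosh (Real.arcosh y) l
    rw [Real.cosh_arcosh hy1] at h
    rw [h, Int.cast_natCast, Real.cosh_le_cosh]
    have h0 := Real.arcosh_nonneg hy1
    have hθ : θ ≤ Real.arcosh y := by
      rw [← Real.cosh_arcosh hy1, Real.cosh_le_cosh, abs_of_nonneg h0,
        abs_of_nonneg (Real.sqrt_nonneg z)] at hy
      exact hy
    rw [abs_of_nonneg (mul_nonneg (Nat.cast_nonneg _) (Real.sqrt_nonneg z)),
      abs_of_nonneg (by positivity)]
    gcongr
  set M := Real.cosh (l * θ) with hM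
  have hM0 : 0 < M := Real.cosh_pos _
  refine ⟨C M⁻¹ * (Chebyshev.T ℝ l).comp c, ?_, ?_, ?_⟩
  · refine (natDegree_C_mul_le _ _).trans (natDegree_comp_le.trans ?_)
    have hcd : c.natDegree ≤ 1 := by
      rw [hc]
      refine (natDegree_sub_le _ _).trans ?_
      simp only [natDegree_C]
      exact max_le (by simp) ((natDegree_C_mul_le _ _).trans natDegree_X_le)
    have : (Chebyshev.T ℝ l).natDegree = l := by
      simp
    rw [this]
    simpa using Nat.mul_le_mul_left l hcd
  · intro x hx
    rw [eval_mul, eval_C, eval_comp, hceval, ← div_eq_inv_mul, one_le_div hM0]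
    refine hT1 _ (hθ1.trans ?_)
    rw [hz, le_div_iff₀ hD, add_mul, div_mul_cancel₀ _ hD.ne']
    linarith
  · intro x hx1 hx2
    rw [eval_mul, eval_C, eval_comp, hceval, abs_mul, abs_of_pos (inv_pos.2 hM0)]
    have hT : |(Chebyshev.T ℝ l).eval ((top + lo - 2 * x) / (top - lo))| ≤ 1 := by
      have ha : -1 ≤ (top + lo - 2 * x) / (top - lo) := by rw [le_div_iff₀ hD]; linarith
      have hb : (top + lo - 2 * x) / (top - lo) ≤ 1 := by rw [div_le_one hD]; linarith
      rw [← Real.cos_arccos ha hb, Chebyshev.T_real_cos]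
      exact Real.abs_cos_le_one _
    have hMe : Real.exp (l * θ) / 2 ≤ M := by
      rw [hM, Real.cosh_eq]
      have := Real.exp_pos (-(l * θ))
      linarith
    calc M⁻¹ * _ ≤ M⁻¹ * 1 := by gcongr
      _ ≤ (Real.exp (l * θ) / 2)⁻¹ := by
        rw [mul_one]
        exact inv_anti₀ (by positivity) hMe
      _ = _ := by rw [Real.exp_neg]; field_simp

end Chebyshev

/-! ### Approximating a subspace by filtered product vectors. -/

section Bootstrap

variable {E : Type*} [NormedAddCommGroup E] [InnerProductSpace ℂ E] [FiniteDimensional ℂ E]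

/-- Vectors of a spanning set `𝒬` whose projections form a nearly optimal basis of `G`: the
coordinate functionals are bounded by `2` on `𝒬`. -/
lemma exists_coordinates {𝒬 : Set E} (hspan : Submodule.span ℂ 𝒬 = ⊤) (h𝒬 : ∀ q ∈ 𝒬, ‖q‖ ≤ 1)
    (G : Submodule ℂ E) {g : ℕ} (hg : Module.finrank ℂ G = g) :
    ∃ (φ : Fin g → E) (Λ : Fin g → E →L[ℂ] ℂ), (∀ j, φ j ∈ 𝒬) ∧
      (∀ x ∈ G, x = ∑ j, Λ j x • G.starProjection (φ j)) ∧
      (∀ j z, Λ j z = Λ j (G.starProjection z)) ∧ ∀ j, ∀ q ∈ 𝒬, ‖Λ j q‖ ≤ 2 := by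
  classical
  let P : E →L[ℂ] G := G.orthogonalProjectionOnto
  have hPspan : Submodule.span ℂ (P '' 𝒬) = ⊤ := by
    have : (P '' 𝒬) = (P : E →ₗ[ℂ] G) '' 𝒬 := rfl
    rw [this, Submodule.span_image, hspan, Submodule.map_top, LinearMap.range_eq_top]
    exact fun x => ⟨x, G.orthogonalProjectionOnto_mem_subspace_eq_self x⟩
  let e : Module.Basis (Fin g) ℂ G := Module.finBasisOfFinrankEq ℂ G hg
  let D : (Fin g → E) → ℂ := fun φ => e.det fun j => P (φ j)
  have hDcont : Continuous D := by
    have : D = fun φ => (Matrix.of fun i j => e.coord i (P (φ j))).det := by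
      funext φ; rfl
    rw [this]
    refine Continuous.matrix_det ?_
    refine continuous_matrix fun i j => ?_
    exact (LinearMap.continuous_of_finiteDimensional (e.coord i)).comp
      (P.continuous.comp (continuous_apply j))
  set S : Set ℝ := {x | ∃ φ : Fin g → E, (∀ j, φ j ∈ 𝒬) ∧ x = ‖D φ‖} with hS
  have hSb : BddAbove S := by
    have hc : IsCompact (Set.pi Set.univ fun _ : Fin g => Metric.closedBall (0 : E) 1) :=
      isCompact_univ_pi fun _ => isCompact_closedBall 0 1
    obtain ⟨C, hC⟩ := (hc.image (hDcont.norm)).bddAbove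
    refine ⟨C, ?_⟩
    rintro _ ⟨φ, hφ, rfl⟩
    exact hC ⟨φ, fun j _ => by simpa using h𝒬 _ (hφ j), rfl⟩
  obtain ⟨φ₀, hφ₀, hD₀⟩ : ∃ φ : Fin g → E, (∀ j, φ j ∈ 𝒬) ∧ D φ ≠ 0 := by
    obtain ⟨f, hf, -, hli⟩ := Submodule.exists_fun_fin_finrank_span_eq ℂ (P '' 𝒬)
    have hfin : Module.finrank ℂ (Submodule.span ℂ (P '' 𝒬)) = g := by
      rw [hPspan, finrank_top, hg]
    choose q hq hqf using hf
    refine ⟨fun j => q (Fin.cast hfin.symm j), fun j => hq _, ?_⟩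
    have h1 : LinearIndependent ℂ fun j => P (q (Fin.cast hfin.symm j)) := by
      have : (fun j => P (q (Fin.cast hfin.symm j))) = f ∘ Fin.cast hfin.symm := by
        funext j; exact hqf _
      rw [this]
      exact hli.comp _ (Fin.cast_injective _)
    have h2 := (Module.Basis.is_basis_iff_det e (v := fun j => P (q (Fin.cast hfin.symm j)))).1
      ⟨h1, h1.span_eq_top_of_card_eq_finrank' (by simp [hg])⟩
    exact h2.ne_zero
  have hpos : 0 < sSup S :=
    lt_of_lt_of_le (norm_pos_iff.2 hD₀) (le_csSup hSb ⟨φ₀, hφ₀, rfl⟩)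
  -- `𝒬` is not assumed compact, so the supremum may not be attained; exceeding half of it suffices
  -- and produces the bound `2`.
  obtain ⟨_, ⟨φ, hφ, rfl⟩, hlt⟩ := exists_lt_of_lt_csSup (⟨_, φ₀, hφ₀, rfl⟩ : S.Nonempty)
    (half_lt_self hpos)
  have hDφ : D φ ≠ 0 := norm_pos_iff.1 ((half_pos hpos).trans hlt)
  obtain ⟨hli, hsp⟩ := (Module.Basis.is_basis_iff_det e (v := fun j => P (φ j))).2
    (isUnit_iff_ne_zero.2 hDφ)
  let b := Module.Basis.mk hli hsp.ge
  have hbcoe : ∀ j, b j = P (φ j) := fun j => by simp [b]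
  let Λ : Fin g → E →L[ℂ] ℂ := fun j => (LinearMap.toContinuousLinearMap (b.coord j)).comp P
  have hΛ : ∀ j z, Λ j z = b.coord j (P z) := fun _ _ => rfl
  refine ⟨φ, Λ, hφ, fun x hx => ?_, fun j z => ?_, fun j q hq => ?_⟩
  · have h1 := b.sum_repr (P x)
    have h2 := congrArg (Subtype.val) h1
    simp only [hbcoe] at h2
    have h3 : ((P x : G) : E) = x := by
      exact G.starProjection_eq_self_iff.2 hx
    rw [h3] at h2
    conv_lhs => rw [← h2]
    simp only [AddSubmonoidClass.coe_finsetSum, Submodule.coe_smul]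
    rfl
  · rw [hΛ, hΛ]
    congr 1
    exact (G.orthogonalProjectionOnto_mem_subspace_eq_self (P z)).symm
  -- Cramer's rule: the `j`-th coordinate of `P q` is a quotient of determinants, the numerator
  -- having `q` in place of `φ j`.
  · have h1 := LinearMap.congr_fun (Module.Basis.det_smul_mk_coord_eq_det_update e hli hsp.ge j) (P q)
    have h2 : D φ * Λ j q = D (Function.update φ j q) := by
      have h3 : (fun i => P (Function.update φ j q i)) = Function.update (fun i => P (φ i)) j (P q) := by
        funext i
        by_cases hi : i = j
        · subst hi; simp
        · simp [hi]
      simp only [D, h3]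
      exact h1
    have h4 : ‖D (Function.update φ j q)‖ ≤ sSup S := by
      refine le_csSup hSb ⟨_, fun i => ?_, rfl⟩
      by_cases hi : i = j
      · subst hi; simpa using hq
      · simpa [hi] using hφ i
    rw [← h2, norm_mul] at h4
    have h5 : ‖D φ‖ * ‖Λ j q‖ ≤ ‖D φ‖ * 2 := by linarith
    exact le_of_mul_le_mul_left h5 (norm_pos_iff.2 hDφ)

/-- If `K` fixes the splitting `G ⊕ Gᗮ`, is expanding on `G` and contracts `Gᗮ` by much more than
the inverse square root of the rank of its outputs, then the outputs of `K` on combinations of few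
elements of `𝒬` approximate all of `G`. -/
lemma exists_approx_of_contraction {𝒬 : Set E} (hspan : Submodule.span ℂ 𝒬 = ⊤)
    (h𝒬 : ∀ q ∈ 𝒬, ‖q‖ ≤ 1) (G : Submodule ℂ E) {g : ℕ}
    (hg : Module.finrank ℂ G = g) (K : E →L[ℂ] E) {η R : ℝ} (hη : 0 ≤ η)
    (hR : 0 ≤ R) (hPK : ∀ x, G.starProjection (K x) = K (G.starProjection x))
    (hK : ∀ x, ‖K (x - G.starProjection x)‖ ≤ η * ‖x‖)
    (hinv : ∀ y ∈ G, ∃ x ∈ G, K x = y ∧ ‖x‖ ≤ ‖y‖)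
    (hrank : ∀ (φ : Fin g → E) (c : Fin g → ℂ),
      (∀ j, φ j ∈ 𝒬) → ∀ (Λ : E →L[ℂ] ℂ), (∀ q ∈ 𝒬, ‖Λ q‖ ≤ 2) →
      ‖Λ (K (∑ j, c j • φ j))‖ ≤ 2 * R * ‖K (∑ j, c j • φ j)‖)
    (hsmall : 4 * R * η * g ≤ 1) {y : E} (hy : y ∈ G) :
    ∃ (φ : Fin g → E) (c : Fin g → ℂ),
      (∀ j, φ j ∈ 𝒬) ∧
      ‖K (∑ j, c j • φ j) - y‖ ≤ 4 * R * η * g * ‖y‖ := by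
  obtain ⟨φ, Λ, hφ, hexp, hΛP, hΛ2⟩ := exists_coordinates hspan h𝒬 G hg
  obtain ⟨ω, hω0, hω, hωle⟩ : ∃ ω : ℝ, 0 ≤ ω ∧ (∀ j, ‖Λ j‖ ≤ ω) ∧
      ∀ B : ℝ, 0 ≤ B → (∀ j, ‖Λ j‖ ≤ B) → ω ≤ B := by
    refine ⟨‖Λ‖, norm_nonneg _, norm_le_pi_norm Λ, fun B hB h => ?_⟩
    exact (pi_norm_le_iff_of_nonneg hB).2 h
  -- Expand the `K`-preimage of `y` in the projected vectors and then drop the projections: this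
  -- only adds a component in `Gᗮ`, which `K` contracts.
  have key : ∀ y ∈ G, ∃ c : Fin g → ℂ, G.starProjection (K (∑ j, c j • φ j)) = y ∧
      ‖K (∑ j, c j • φ j) - y‖ ≤ η * (g * ω * ‖y‖) := by
    intro y hy
    obtain ⟨x, hxG, rfl, hxy⟩ := hinv y hy
    refine ⟨fun j => Λ j x, ?_, ?_⟩
    · rw [hPK, map_sum]
      simp only [map_smul]
      rw [← hexp x hxG]
    · have h1 : G.starProjection (∑ j, Λ j x • φ j) = x := by
        rw [map_sum]; simp only [map_smul]; exact (hexp x hxG).symm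
      have h2 := hK (∑ j, Λ j x • φ j)
      rw [h1, map_sub] at h2
      refine h2.trans ?_
      gcongr
      calc ‖∑ j, Λ j x • φ j‖ ≤ ∑ j : Fin g, ω * ‖x‖ := by
            refine (norm_sum_le _ _).trans (Finset.sum_le_sum fun j _ => ?_)
            rw [norm_smul]
            calc ‖Λ j x‖ * ‖φ j‖ ≤ ‖Λ j x‖ * 1 := by gcongr; exact h𝒬 _ (hφ j)
              _ ≤ ω * ‖x‖ := by
                rw [mul_one]
                exact ((Λ j).le_opNorm x).trans (by gcongr; exact hω j)
        _ = g * ω * ‖x‖ := by simp; ring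
        _ ≤ g * ω * ‖K x‖ := by gcongr
  -- `Λ i` sees only the projection of `z`, so `z` may be replaced by a filter output with the same
  -- projection, to which `hrank` applies. The resulting bound on `ω` involves `ω` itself.
  have hωb : ω ≤ 2 * R * (1 + η * (g * ω)) := by
    refine hωle _ (by positivity) fun i => ?_
    refine ContinuousLinearMap.opNorm_le_bound _ (by positivity) fun z => ?_
    obtain ⟨c, hc1, hc2⟩ := key (G.starProjection z) (G.starProjection_apply_mem z)
    have h1 : Λ i z = Λ i (K (∑ j, c j • φ j)) := by
      rw [hΛP i z, hΛP i (K _), hc1]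
    have hz : ‖G.starProjection z‖ ≤ ‖z‖ := G.norm_starProjection_apply_le z
    rw [h1]
    refine (hrank φ c hφ (Λ i) (hΛ2 i)).trans ?_
    have h2 : ‖K (∑ j, c j • φ j)‖ ≤ ‖G.starProjection z‖ + η * (g * ω * ‖G.starProjection z‖) := by
      have := norm_add_le (K (∑ j, c j • φ j) - G.starProjection z) (G.starProjection z)
      rw [sub_add_cancel] at this
      linarith
    calc 2 * R * ‖K (∑ j, c j • φ j)‖ ≤ 2 * R * (‖z‖ + η * (g * ω * ‖z‖)) := by
          gcongr
          refine h2.trans ?_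
          gcongr
      _ = _ := by ring
  -- By `hsmall` the self-referential term is at most `ω / 2` and can be absorbed.
  have hω4 : ω ≤ 4 * R := by
    have : 2 * R * (η * (g * ω)) ≤ ω / 2 := by
      have := mul_le_mul_of_nonneg_right hsmall hω0
      linarith
    linarith
  obtain ⟨c, -, hc⟩ := key y hy
  refine ⟨φ, c, hφ, hc.trans ?_⟩
  calc η * (g * ω * ‖y‖) ≤ η * (g * (4 * R) * ‖y‖) := by gcongr
    _ = _ := by ring

end Bootstrap

/-! ### Conjugation by exponentials of local sums. -/

section Hadamard

variable {A : Type*} [NormedRing A] [NormedAlgebra ℂ A] [CompleteSpace A]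

open ContinuousLinearMap in
/-- The commutator with `a`. -/
noncomputable def adCLM (a : A) : A →L[ℂ] A := mul ℂ A a + (mul ℂ A).flip (-a)

omit [CompleteSpace A] in
lemma adCLM_apply (a x : A) : adCLM a x = a * x - x * a := by
  simp [adCLM, sub_eq_add_neg]

/-- The commutator with `a` is left multiplication by `a` plus right multiplication by `-a`. These
commute, so the exponential of the sum is the product of the exponentials. -/
lemma exp_conj_hasSum (a x : A) :
    HasSum (fun n : ℕ => ((n.factorial : ℂ)⁻¹) • (adCLM a ^ n) x)
      (NormedSpace.exp a * x * NormedSpace.exp (-a)) := by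
  let _ : NormedAlgebra ℚ (A →L[ℂ] A) := NormedAlgebra.restrictScalars ℚ ℂ (A →L[ℂ] A)
  have h1 := NormedSpace.exp_series_hasSum_exp' (𝕂 := ℂ) (adCLM a)
  have hl : ∀ n, (ContinuousLinearMap.mul ℂ A a ^ n) = ContinuousLinearMap.mul ℂ A (a ^ n) := by
    intro n
    induction n with
    | zero => ext y; simp
    | succ n ih => ext y; simp [pow_succ, ih, mul_assoc]
  have hr : ∀ b : A, ∀ n, ((ContinuousLinearMap.mul ℂ A).flip b ^ n) =
      (ContinuousLinearMap.mul ℂ A).flip (b ^ n) := by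
    intro b n
    induction n with
    | zero => ext y; simp
    | succ n ih => ext y; rw [pow_succ, ih, pow_succ']; simp [mul_assoc]
  have h2 : NormedSpace.exp (ContinuousLinearMap.mul ℂ A a) =
      ContinuousLinearMap.mul ℂ A (NormedSpace.exp a) := by
    refine (NormedSpace.exp_series_hasSum_exp' (𝕂 := ℂ) (ContinuousLinearMap.mul ℂ A a)).unique ?_
    have := (NormedSpace.exp_series_hasSum_exp' (𝕂 := ℂ) a).mapL (ContinuousLinearMap.mul ℂ A)
    simpa only [map_smul, hl] using this
  have h3 : NormedSpace.exp ((ContinuousLinearMap.mul ℂ A).flip (-a)) =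
      (ContinuousLinearMap.mul ℂ A).flip (NormedSpace.exp (-a)) := by
    refine (NormedSpace.exp_series_hasSum_exp' (𝕂 := ℂ)
      ((ContinuousLinearMap.mul ℂ A).flip (-a))).unique ?_
    have := (NormedSpace.exp_series_hasSum_exp' (𝕂 := ℂ) (-a)).mapL
      (ContinuousLinearMap.mul ℂ A).flip
    simpa only [map_smul, hr] using this
  have hcomm : Commute (ContinuousLinearMap.mul ℂ A a) ((ContinuousLinearMap.mul ℂ A).flip (-a)) := by
    ext y; simp [mul_assoc]
  have h4 := h1.mapL (ContinuousLinearMap.apply ℂ A x)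
  have h5 : NormedSpace.exp (adCLM a) x = NormedSpace.exp a * x * NormedSpace.exp (-a) := by
    rw [adCLM, NormedSpace.exp_add_of_commute hcomm, h2, h3]
    simp [mul_assoc]
  rw [← h5]
  simpa using h4

/-- The `n!` growth of the nested commutators cancels the `1 / n!` of the series, leaving a
geometric series of ratio at most `1 / 2`. -/
lemma norm_exp_conj_le {a x : A} {κ : ℝ} (hκ : 0 ≤ κ)
    (h : ∀ n : ℕ, ‖(adCLM a ^ n) x‖ ≤ κ ^ n * n.factorial) {t : ℂ} (ht : ‖t‖ * κ ≤ 1 / 2) :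
    ‖NormedSpace.exp (t • a) * x * NormedSpace.exp (-(t • a))‖ ≤ 2 := by
  have h1 := exp_conj_hasSum (t • a) x
  have had : ∀ n : ℕ, (adCLM (t • a) ^ n) x = t ^ n • (adCLM a ^ n) x := by
    have : adCLM (t • a) = t • adCLM a := by
      ext y; simp [adCLM_apply, smul_sub]
    intro n
    rw [this]
    induction n with
    | zero => simp
    | succ n ih =>
      rw [pow_succ', mul_apply_eq_comp, ih, pow_succ' (adCLM a), mul_apply_eq_comp, map_smul,
        smul_apply, smul_smul, pow_succ]
  refine h1.norm_le_of_bounded hasSum_geometric_two fun n => ?_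
  rw [had, norm_smul, norm_smul, norm_inv, norm_pow, Complex.norm_natCast]
  have hf : (0 : ℝ) < n.factorial := by exact_mod_cast n.factorial_pos
  calc (n.factorial : ℝ)⁻¹ * (‖t‖ ^ n * ‖(adCLM a ^ n) x‖)
      ≤ (n.factorial : ℝ)⁻¹ * (‖t‖ ^ n * (κ ^ n * n.factorial)) := by
        gcongr; exact h n
    _ = (‖t‖ * κ) ^ n := by rw [mul_pow]; field_simp
    _ ≤ (1 / 2) ^ n := by gcongr

omit [CompleteSpace A] in
/-- Nested commutators of a local term with a sum of local terms on a line grow at most like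
`6 ^ n * n!`. -/
lemma norm_adCLM_pow_le {m : ℕ} {H : Fin m → A} (hH : ∀ i, ‖H i‖ ≤ 1)
    (hcomm : ∀ i j : Fin m, (i : ℕ) + 1 < j → Commute (H i) (H j)) (S : Finset (Fin m))
    (c : Fin m) (n : ℕ) :
    ‖(adCLM (∑ i ∈ S, H i) ^ n) (H c)‖ ≤ 6 ^ n * n.factorial := by
  have hcomm' : ∀ i j : Fin m, ((i : ℕ) + 1 < j ∨ (j : ℕ) + 1 < i) → Commute (H i) (H j) :=
    fun i j h => h.elim (hcomm i j) fun h => (hcomm j i h).symm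
  -- The induction also carries the support, which grows by one bond on each side per commutator.
  suffices h : ‖(adCLM (∑ i ∈ S, H i) ^ n) (H c)‖ ≤ 6 ^ n * n.factorial ∧
      ∀ i : Fin m, ((i : ℕ) + n + 1 < c ∨ (c : ℕ) + n + 1 < i) →
        Commute (H i) ((adCLM (∑ i ∈ S, H i) ^ n) (H c)) from h.1
  induction n with
  | zero => exact ⟨by simpa using hH c, fun i hi => by simpa using hcomm' i c (by omega)⟩
  | succ n ih =>
    obtain ⟨ih1, ih2⟩ := ih
    set X := (adCLM (∑ i ∈ S, H i) ^ n) (H c) with hX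
    set near : Finset (Fin m) :=
      S.filter fun i => ¬ ((i : ℕ) + n + 1 < c ∨ (c : ℕ) + n + 1 < i) with hnear
    set B := ∑ i ∈ near, H i with hB
    have hstep : (adCLM (∑ i ∈ S, H i) ^ (n + 1)) (H c) = B * X - X * B := by
      rw [pow_succ', ContinuousLinearMap.mul_def, ContinuousLinearMap.comp_apply, ← hX, adCLM_apply,
        ← Finset.sum_filter_not_add_sum_filter S
          (fun i : Fin m => ((i : ℕ) + n + 1 < c ∨ (c : ℕ) + n + 1 < i)), ← hnear, ← hB, add_mul, mul_add]
      have : Commute (∑ i ∈ S.filter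
          (fun i : Fin m => ((i : ℕ) + n + 1 < c ∨ (c : ℕ) + n + 1 < i)), H i) X :=
        Commute.sum_left _ _ _ fun i hi => ih2 i (Finset.mem_filter.1 hi).2
      rw [this.eq]; abel
    -- Only bonds within distance `n + 1` of `c` contribute, so one commutator costs at most `2 (2n
    -- + 3) ≤ 6 (n + 1)`.
    have hcard : near.card ≤ 2 * n + 3 := by
      have : (near.image fun i : Fin m => (i : ℕ)) ⊆ Finset.Icc (c - (n + 1) : ℕ) (c + (n + 1)) := by
        intro k hk
        obtain ⟨i, hi, rfl⟩ := Finset.mem_image.1 hk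
        have := (Finset.mem_filter.1 hi).2
        rw [Finset.mem_Icc]; omega
      have h2 := Finset.card_le_card this
      rw [Finset.card_image_of_injective _ Fin.val_injective, Nat.card_Icc] at h2
      omega
    have hBn : ‖B‖ ≤ 2 * n + 3 := by
      refine (norm_sum_le _ _).trans ((Finset.sum_le_sum fun i _ => hH i).trans ?_)
      simp only [Finset.sum_const, nsmul_eq_mul, mul_one]
      exact_mod_cast hcard
    rw [hstep]
    constructor
    · have hn : (0 : ℝ) ≤ n := Nat.cast_nonneg n
      calc ‖B * X - X * B‖ ≤ ‖B‖ * ‖X‖ + ‖X‖ * ‖B‖ :=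
            (norm_sub_le _ _).trans (add_le_add (norm_mul_le _ _) (norm_mul_le _ _))
        _ = 2 * ‖B‖ * ‖X‖ := by ring
        _ ≤ 2 * (2 * n + 3) * (6 ^ n * n.factorial) := by gcongr
        _ ≤ (6 * (n + 1)) * (6 ^ n * n.factorial) := 
            mul_le_mul_of_nonneg_right (by linarith) (by positivity)
        _ = _ := by rw [Nat.factorial_succ]; push_cast; ring
    · intro i hi
      have h1 : Commute (H i) X := ih2 i (by omega)
      have h2 : Commute (H i) B := Commute.sum_right _ _ _ fun j hj => by
        have := (Finset.mem_filter.1 hj).2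
        exact hcomm' i j (by omega)
      exact (h2.mul_right h1).sub_right (h1.mul_right h2)

end Hadamard

/-! ### Quadratic forms in an eigenbasis. -/

section Spectral

set_option linter.unusedSectionVars false

variable {E : Type*} [NormedAddCommGroup E] [InnerProductSpace ℂ E] [FiniteDimensional ℂ E]

lemma exists_eigenbasis {T : E →L[ℂ] E} (hT : IsSelfAdjoint T) :
    ∃ (b : OrthonormalBasis (Fin (Module.finrank ℂ E)) ℂ E) (μ : Fin (Module.finrank ℂ E) → ℝ),
      ∀ j, T (b j) = (μ j : ℂ) • b j := by
  have hs := hT.isSymmetric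
  exact ⟨hs.eigenvectorBasis rfl, hs.eigenvalues rfl, fun j => hs.apply_eigenvectorBasis rfl j⟩

variable {ι : Type*} [Fintype ι] {T : E →L[ℂ] E} {b : OrthonormalBasis ι ℂ E} {μ : ι → ℝ}

lemma reApplyInnerSelf_eq_sum (h : ∀ j, T (b j) = (μ j : ℂ) • b j) (x : E) :
    T.reApplyInnerSelf x = ∑ j, μ j * ‖inner ℂ (b j) x‖ ^ 2 := by
  have h1 : T x = ∑ j, inner ℂ (b j) x • (μ j : ℂ) • b j := by
    conv_lhs => rw [← b.sum_repr' x]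
    simp [h]
  rw [ContinuousLinearMap.reApplyInnerSelf_apply, h1, sum_inner, map_sum]
  refine Finset.sum_congr rfl fun j _ => ?_
  rw [inner_smul_left, inner_smul_left, ← Complex.normSq_eq_norm_sq]
  simp only [Complex.conj_ofReal]
  rw [mul_left_comm, ← Complex.normSq_eq_conj_mul_self]
  simp [← Complex.ofReal_mul]

lemma norm_sq_eq_sum (x : E) : ‖x‖ ^ 2 = ∑ j, ‖inner ℂ (b j) x‖ ^ 2 :=
  (b.sum_sq_norm_inner_right x).symm

lemma exists_mem_orthogonal_of_finrank_lt {U V : Submodule ℂ E}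
    (h : Module.finrank ℂ U < Module.finrank ℂ V) : ∃ x ∈ V, x ∈ Uᗮ ∧ x ≠ 0 := by
  let P : V →ₗ[ℂ] U := (U.orthogonalProjectionOnto : E →ₗ[ℂ] U).comp V.subtype
  obtain ⟨x, hx, hx0⟩ := Submodule.exists_mem_ne_zero_of_ne_bot (LinearMap.ker_ne_bot_of_finrank_lt (f := P) h)
  refine ⟨x, x.2, ?_, by simpa using hx0⟩
  exact U.orthogonalProjectionOnto_eq_zero_iff.1 hx

lemma reApplyInnerSelf_mono {S T : E →L[ℂ] E} (h : S ≤ T) (x : E) :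
    S.reApplyInnerSelf x ≤ T.reApplyInnerSelf x := by
  have := (ContinuousLinearMap.le_def S T).1 h
  have h2 := this.2 x
  simp [ContinuousLinearMap.reApplyInnerSelf_apply, inner_sub_left] at h2 ⊢
  linarith

end Spectral

/-! ### Exponential decay of eigenvectors in the energy of one side. -/

section Decay

set_option linter.unusedSectionVars false

variable {E : Type*} [NormedAddCommGroup E] [InnerProductSpace ℂ E] [FiniteDimensional ℂ E]

/-- The operator `A` with its spectrum cut off at `t`. -/
noncomputable def truncOp (t : ℝ) (A : E →L[ℂ] E) : E →L[ℂ] E := cfc (fun x : ℝ => min x t) A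

/-- The exponential weight `exp (A / 12)`. -/
noncomputable def expWeight (A : E →L[ℂ] E) : E →L[ℂ] E := cfc (fun x : ℝ => Real.exp (x / 12)) A

lemma expWeight_eq_exp {A : E →L[ℂ] E} (hA : IsSelfAdjoint A) :
    expWeight A = NormedSpace.exp ((1 / 12 : ℂ) • A) := by
  have h1 : (1 / 12 : ℂ) • A = cfc (fun x : ℝ => x / 12) A := by
    have : (fun x : ℝ => x / 12) = fun x : ℝ => (1 / 12 : ℝ) * x := by funext x; ring
    rw [this, cfc_const_mul_id (1 / 12 : ℝ) A, ← Complex.coe_smul]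
    norm_num
  rw [h1, ← CFC.real_exp_eq_normedSpace_exp (a := cfc (fun x : ℝ => x / 12) A),
    ← cfc_comp' (fun x : ℝ => Real.exp x) (fun x : ℝ => x / 12) A]
  rfl

lemma continuousLinearMap_exp_neg_mul_exp (A : E →L[ℂ] E) :
    NormedSpace.exp (-A) * NormedSpace.exp A = 1 := by
  let _ : NormedAlgebra ℚ (E →L[ℂ] E) := NormedAlgebra.restrictScalars ℚ ℂ (E →L[ℂ] E)
  rw [← NormedSpace.exp_add_of_commute (Commute.neg_left (Commute.refl A)), neg_add_cancel,
    NormedSpace.exp_zero]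

lemma reApplyInnerSelf_add (S T : E →L[ℂ] E) (x : E) :
    (S + T).reApplyInnerSelf x = S.reApplyInnerSelf x + T.reApplyInnerSelf x := by
  simp [ContinuousLinearMap.reApplyInnerSelf_apply, inner_add_left]

lemma reApplyInnerSelf_real_smul (c : ℝ) (T : E →L[ℂ] E) (x : E) :
    (c • T).reApplyInnerSelf x = c * T.reApplyInnerSelf x := by
  simp [ContinuousLinearMap.reApplyInnerSelf_apply, ← Complex.coe_smul, inner_smul_left,
    -Complex.real_smul]

lemma reApplyInnerSelf_one (x : E) : (1 : E →L[ℂ] E).reApplyInnerSelf x = ‖x‖ ^ 2 := by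
  rw [ContinuousLinearMap.reApplyInnerSelf_apply]
  exact inner_self_eq_norm_sq (𝕜 := ℂ) x

lemma reApplyInnerSelf_conj {W T : E →L[ℂ] E} (hW : IsSelfAdjoint W) (x : E) :
    (W * T * W).reApplyInnerSelf x = T.reApplyInnerSelf (W x) := by
  simp only [ContinuousLinearMap.reApplyInnerSelf_apply, mul_apply_eq_comp]
  rw [hW.isSymmetric.apply_clm]

lemma isSelfAdjoint_expWeight (A : E →L[ℂ] E) : IsSelfAdjoint (expWeight A) :=
  cfc_predicate _ A

/-- Above `2B` the cut-off energy is at least `2B`, so its excess over `B` pays for the weight;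
below `2B` the squared weight `exp (x / 6)` is at most `exp (B / 3)`. -/
lemma exp_mul_exp_le_of_min {B t x : ℝ} (hB : 0 < B) (htB : 2 * B ≤ t) (hx0 : 0 ≤ x) :
    Real.exp (x / 12) * Real.exp (x / 12) ≤
      B⁻¹ * (Real.exp (x / 12) * min x t * Real.exp (x / 12) +
        (-B) * (Real.exp (x / 12) * Real.exp (x / 12))) + 2 * Real.exp (B / 3) := by
  rw [← Real.exp_add, mul_right_comm, ← Real.exp_add]
  set y := Real.exp (x / 12 + x / 12) with hy
  have hy0 : 0 < y := Real.exp_pos _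
  have hBne := hB.ne'
  have hsplit : B⁻¹ * (y * min x t + -B * y) = B⁻¹ * (y * min x t) - y := by field_simp; ring
  rw [hsplit]
  rcases le_total (2 * B) x with hc | hc
  · have hm : 2 * B ≤ min x t := le_min hc htB
    have h1 : y * (2 * B) ≤ y * min x t := mul_le_mul_of_nonneg_left hm hy0.le
    have h3 := mul_le_mul_of_nonneg_left h1 (inv_pos.2 hB).le
    have h4 : B⁻¹ * (y * (2 * B)) = 2 * y := by field_simp
    have := Real.exp_pos (B / 3)
    linarith
  · have hm : 0 ≤ min x t := le_min hx0 (by linarith)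
    have hyB : y ≤ Real.exp (B / 3) := Real.exp_le_exp.2 (by linarith)
    have : 0 ≤ B⁻¹ * (y * min x t) := by positivity
    linarith

lemma expWeight_mul_self_le {A : E →L[ℂ] E} (hA : 0 ≤ A) {t B : ℝ} (hB : 0 < B)
    (htB : 2 * B ≤ t) :
    expWeight A * 1 * expWeight A ≤ B⁻¹ • (expWeight A * truncOp t A * expWeight A +
      (-B) • (expWeight A * 1 * expWeight A)) + (2 * Real.exp (B / 3)) • (1 : E →L[ℂ] E) := by
  have hAs : IsSelfAdjoint A := IsSelfAdjoint.of_nonneg hA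
  have e1 : expWeight A * 1 * expWeight A = cfc (fun x : ℝ => Real.exp (x / 12) * Real.exp (x / 12)) A := by
    rw [mul_one, expWeight, cfc_mul (fun x : ℝ => Real.exp (x / 12)) _ A]
  have e2 : expWeight A * truncOp t A * expWeight A =
      cfc (fun x : ℝ => Real.exp (x / 12) * min x t * Real.exp (x / 12)) A := by
    rw [expWeight, truncOp, cfc_mul (fun x : ℝ => Real.exp (x / 12) * min x t) _ A,
      cfc_mul (fun x : ℝ => Real.exp (x / 12)) _ A]
  have e3 : B⁻¹ • (expWeight A * truncOp t A * expWeight A + (-B) • (expWeight A * 1 * expWeight A)) +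
      (2 * Real.exp (B / 3)) • (1 : E →L[ℂ] E) =
      cfc (fun x : ℝ => B⁻¹ * (Real.exp (x / 12) * min x t * Real.exp (x / 12) +
        (-B) * (Real.exp (x / 12) * Real.exp (x / 12))) + 2 * Real.exp (B / 3)) A := by
    rw [cfc_add_const (2 * Real.exp (B / 3)) _ A, cfc_const_mul B⁻¹ _ A,
      cfc_add A (fun x : ℝ => Real.exp (x / 12) * min x t * Real.exp (x / 12)) _,
      cfc_const_mul (-B) _ A, ← e1, ← e2, Algebra.algebraMap_eq_smul_one]
  rw [e3, e1]
  refine cfc_mono fun x hx => ?_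
  exact exp_mul_exp_le_of_min hB htB (spectrum_nonneg_of_nonneg hA hx)

/-- Exponential decay of the high-energy components of an eigenvector. -/
lemma norm_expWeight_apply_sq_le {A X Y : E →L[ℂ] E} (hA : 0 ≤ A) (hY : 0 ≤ Y) (hAY : Commute A Y)
    (hX : ‖NormedSpace.exp ((1 / 12 : ℂ) • A) * X * NormedSpace.exp (-((1 / 12 : ℂ) • A))‖ ≤ 2)
    {t B e : ℝ} (hB : 0 < B) (htB : 2 * B ≤ t) (heB : e + 2 ≤ B) {φ : E}
    (hφ : (truncOp t A + X + Y) φ = (e : ℂ) • φ) :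
    ‖expWeight A φ‖ ^ 2 ≤ 2 * Real.exp (B / 3) * ‖φ‖ ^ 2 := by
  have hAs : IsSelfAdjoint A := IsSelfAdjoint.of_nonneg hA
  set W := expWeight A with hW
  set Z := NormedSpace.exp ((1 / 12 : ℂ) • A) * X * NormedSpace.exp (-((1 / 12 : ℂ) • A)) with hZ
  have hWs : IsSelfAdjoint W := isSelfAdjoint_expWeight A
  have hWX : W * X = Z * W := by
    rw [hW, expWeight_eq_exp hAs, hZ, mul_assoc, continuousLinearMap_exp_neg_mul_exp, mul_one]
  have hWY : Commute W Y := hAs.commute_cfc hAY _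
  have hWT : Commute W (truncOp t A) := cfc_commute_cfc _ _ A
  -- The weight commutes with everything except `X`, which turns into its conjugate `Z`. The weight
  -- is built from the uncut `A`: that is the operator whose commutators with local terms are
  -- controlled.
  have h1 : truncOp t A (W φ) + Z (W φ) + Y (W φ) = (e : ℂ) • W φ := by
    have h2 := congrArg W hφ
    have a1 : W (truncOp t A φ) = truncOp t A (W φ) := DFunLike.congr_fun hWT.eq φ
    have a2 : W (Y φ) = Y (W φ) := DFunLike.congr_fun hWY.eq φ
    have a3 : W (X φ) = Z (W φ) := DFunLike.congr_fun hWX φ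
    simpa [a1, a2, a3] using h2
  -- Pair the equation with `W φ`: `Y` only helps and `Z` costs at most `2`, which `e + 2 ≤ B`
  -- allows for.
  have h2 : (truncOp t A).reApplyInnerSelf (W φ) ≤ B * ‖W φ‖ ^ 2 := by
    have hYp : 0 ≤ Y.reApplyInnerSelf (W φ) := by
      simpa [ContinuousLinearMap.reApplyInnerSelf_apply] using reApplyInnerSelf_mono hY (W φ)
    have hZp : -(2 * ‖W φ‖ ^ 2) ≤ Z.reApplyInnerSelf (W φ) := by
      have h3 : ‖inner ℂ (Z (W φ)) (W φ)‖ ≤ 2 * ‖W φ‖ ^ 2 := by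
        refine (norm_inner_le_norm _ _).trans ?_
        have := Z.le_of_opNorm_le hX (W φ)
        nlinarith [norm_nonneg (W φ)]
      have h4 := Complex.abs_re_le_norm (inner ℂ (Z (W φ)) (W φ))
      rw [ContinuousLinearMap.reApplyInnerSelf_apply]
      exact (abs_le.1 (h4.trans h3)).1
    have h5 := congrArg (fun v => RCLike.re (inner ℂ v (W φ))) h1
    simp only [inner_add_left, map_add, inner_smul_left, Complex.conj_ofReal] at h5
    have h6 : RCLike.re ((e : ℂ) * inner ℂ (W φ) (W φ)) = e * ‖W φ‖ ^ 2 := by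
      rw [inner_self_eq_norm_sq_to_K]
      change ((e : ℂ) * ((‖W φ‖ : ℝ) : ℂ) ^ 2).re = _
      rw [← Complex.ofReal_pow, ← Complex.ofReal_mul, Complex.ofReal_re]
    rw [h6] at h5
    simp only [ContinuousLinearMap.reApplyInnerSelf_apply] at hYp hZp ⊢
    nlinarith [sq_nonneg ‖W φ‖]
  have hle := expWeight_mul_self_le hA hB htB
  rw [← hW] at hle
  have h3 := reApplyInnerSelf_mono hle φ
  rw [reApplyInnerSelf_add, reApplyInnerSelf_real_smul, reApplyInnerSelf_add,
    reApplyInnerSelf_real_smul, reApplyInnerSelf_real_smul, reApplyInnerSelf_conj hWs,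
    reApplyInnerSelf_conj hWs, reApplyInnerSelf_one, reApplyInnerSelf_one] at h3
  have h4 : B⁻¹ * ((truncOp t A).reApplyInnerSelf (W φ) + -B * ‖W φ‖ ^ 2) ≤ 0 :=
    mul_nonpos_of_nonneg_of_nonpos (inv_pos.2 hB).le (by linarith)
  linarith

lemma truncOp_le {A : E →L[ℂ] E} (hA : IsSelfAdjoint A) (t : ℝ) : truncOp t A ≤ A := by
  conv_rhs => rw [← cfc_id' ℝ A]
  exact cfc_mono fun x _ => min_le_left x t

lemma truncOp_le_smul_one {A : E →L[ℂ] E} (hA : IsSelfAdjoint A) (t : ℝ) :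
    truncOp t A ≤ t • (1 : E →L[ℂ] E) := by
  rw [← Algebra.algebraMap_eq_smul_one, ← cfc_const t A]
  exact cfc_mono fun x _ => min_le_right x t

lemma truncOp_nonneg {A : E →L[ℂ] E} (hA : 0 ≤ A) {t : ℝ} (ht : 0 ≤ t) : 0 ≤ truncOp t A :=
  cfc_nonneg fun _ hx => le_min (spectrum_nonneg_of_nonneg hA hx) ht

/-- Above the cutoff `x - t ≤ 6 exp ((x - t) / 6)`, and `exp (x / 6)` is the square of the weight.
-/
lemma reApplyInnerSelf_sub_truncOp_le {A : E →L[ℂ] E} (hA : IsSelfAdjoint A) (t : ℝ) (φ : E) :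
    A.reApplyInnerSelf φ ≤ (truncOp t A).reApplyInnerSelf φ +
      6 * Real.exp (-(t / 6)) * ‖expWeight A φ‖ ^ 2 := by
  have hWs := isSelfAdjoint_expWeight A
  have hle : A ≤ truncOp t A + (6 * Real.exp (-(t / 6))) • (expWeight A * 1 * expWeight A) := by
    have e3 : truncOp t A + (6 * Real.exp (-(t / 6))) • (expWeight A * 1 * expWeight A) =
        cfc (fun x : ℝ => min x t +
          6 * Real.exp (-(t / 6)) * (Real.exp (x / 12) * Real.exp (x / 12))) A := by
      rw [mul_one, expWeight, truncOp, cfc_add A (fun x : ℝ => min x t) _,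
        cfc_const_mul (6 * Real.exp (-(t / 6))) _ A, cfc_mul (fun x : ℝ => Real.exp (x / 12)) _ A]
    rw [e3]
    conv_lhs => rw [← cfc_id' ℝ A]
    refine cfc_mono fun x _ => ?_
    rw [mul_assoc, ← Real.exp_add, ← Real.exp_add]
    have h1 := Real.add_one_le_exp (-(t / 6) + (x / 12 + x / 12))
    have h2 := Real.exp_pos (-(t / 6) + (x / 12 + x / 12))
    rcases le_total x t with hc | hc
    · rw [min_eq_left hc]; linarith
    · rw [min_eq_right hc]; linarith
  have h3 := reApplyInnerSelf_mono hle φ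
  rwa [reApplyInnerSelf_add, reApplyInnerSelf_real_smul, reApplyInnerSelf_conj hWs,
    reApplyInnerSelf_one] at h3

end Decay

/-! ### The low spectrum survives truncation. -/

section Truncation

set_option linter.unusedSectionVars false

variable {E : Type*} [NormedAddCommGroup E] [InnerProductSpace ℂ E] [FiniteDimensional ℂ E]

lemma finrank_span_orthonormalBasis_image {ι : Type*} [Fintype ι] (b : OrthonormalBasis ι ℂ E)
    (J : Finset ι) : Module.finrank ℂ (Submodule.span ℂ (b '' (J : Set ι))) = J.card := by
  classical
  have h1 : LinearIndependent ℂ (fun j : J => b j) :=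
    b.orthonormal.linearIndependent.comp _ Subtype.val_injective
  have h2 := finrank_span_eq_card h1
  rw [Fintype.card_coe] at h2
  rw [← h2, Set.image_eq_range]
  rfl

lemma inner_eq_zero_of_mem_span_image {ι : Type*} [Fintype ι] (b : OrthonormalBasis ι ℂ E)
    {J : Finset ι} {x : E} (hx : x ∈ Submodule.span ℂ (b '' (J : Set ι))) {j : ι} (hj : j ∉ J) :
    inner ℂ (b j) x = 0 := by
  induction hx using Submodule.span_induction with
  | mem y hy =>
    obtain ⟨i, hi, rfl⟩ := hy
    exact b.orthonormal.2 fun h => hj (h ▸ hi)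
  | zero => simp
  | add y z _ _ hy hz => rw [inner_add_right, hy, hz, add_zero]
  | smul c y _ hy => rw [inner_smul_right, hy, mul_zero]

/-- The energy lost by cutting off `A` at `t`, for vectors spanned by few decaying ones. -/
lemma reApplyInnerSelf_le_of_decay {ι : Type*} [Fintype ι] {b : OrthonormalBasis ι ℂ E}
    {A : E →L[ℂ] E} (hA : IsSelfAdjoint A) {t D : ℝ} {J : Finset ι}
    (hD : ∀ j ∈ J, ‖expWeight A (b j)‖ ^ 2 ≤ D) {x : E} (hx : ∀ j ∉ J, inner ℂ (b j) x = 0) :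
    A.reApplyInnerSelf x ≤ (truncOp t A).reApplyInnerSelf x +
      6 * Real.exp (-(t / 6)) * (J.card * D * ‖x‖ ^ 2) := by
  classical
  refine (reApplyInnerSelf_sub_truncOp_le hA t x).trans ?_
  gcongr
  have hxJ : x = ∑ j ∈ J, inner ℂ (b j) x • b j := by
    conv_lhs => rw [← b.sum_repr' x]
    refine (Finset.sum_subset (Finset.subset_univ J) fun j _ hj => ?_).symm
    rw [hx j hj, zero_smul]
  have hnx : ∑ j ∈ J, ‖inner ℂ (b j) x‖ ^ 2 = ‖x‖ ^ 2 := by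
    rw [norm_sq_eq_sum (b := b) x]
    refine Finset.sum_subset (Finset.subset_univ J) fun j _ hj => ?_
    rw [hx j hj]; simp
  calc ‖expWeight A x‖ ^ 2 ≤ (∑ j ∈ J, ‖inner ℂ (b j) x‖ * ‖expWeight A (b j)‖) ^ 2 := by
        gcongr
        conv_lhs => rw [hxJ]
        rw [map_sum]
        refine (norm_sum_le _ _).trans_eq ?_
        simp [norm_smul]
    _ ≤ (∑ j ∈ J, ‖inner ℂ (b j) x‖ ^ 2) * ∑ j ∈ J, ‖expWeight A (b j)‖ ^ 2 :=
        Finset.sum_mul_sq_le_sq_mul_sq _ _ _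
    _ ≤ ‖x‖ ^ 2 * (J.card * D) := by
        rw [hnx]
        gcongr
        refine (Finset.sum_le_sum hD).trans_eq ?_
        simp
    _ = _ := by ring

/-- Low-lying spectrum of the Hamiltonian truncated on both sides. -/
theorem exists_eigenbasis_truncated {AL AR M XL XR : E →L[ℂ] E} (hAL : 0 ≤ AL) (hAR : 0 ≤ AR)
    (hM : 0 ≤ M) (hAA : Commute AL AR) (hYL : 0 ≤ M - XL) (hYR : 0 ≤ M - XR)
    (hcL : Commute AL (M - XL)) (hcR : Commute AR (M - XR))
    (hXL : ‖NormedSpace.exp ((1 / 12 : ℂ) • AL) * XL *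
      NormedSpace.exp (-((1 / 12 : ℂ) • AL))‖ ≤ 2)
    (hXR : ‖NormedSpace.exp ((1 / 12 : ℂ) • AR) * XR *
      NormedSpace.exp (-((1 / 12 : ℂ) • AR))‖ ≤ 2)
    {G : Submodule ℂ E} {e ε B t δ : ℝ} {f : ℕ} (hf : Module.finrank ℂ G = f)
    (hG : ∀ x ∈ G, (AL + AR + M) x = (e : ℂ) • x)
    (hmin : ∀ x, e * ‖x‖ ^ 2 ≤ (AL + AR + M).reApplyInnerSelf x)
    (hgap : ∀ x ∈ Gᗮ, (e + ε) * ‖x‖ ^ 2 ≤ (AL + AR + M).reApplyInnerSelf x)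
    (hB : 0 < B) (heB : e + ε + 2 ≤ B) (htB : 2 * B ≤ t)
    (hδ : 24 * (f + 1) * Real.exp ((2 * B - t) / 6) ≤ δ) (hδε : δ ≤ ε / 4) (hε : 0 < ε) :
    ∃ (b : OrthonormalBasis (Fin (Module.finrank ℂ E)) ℂ E) (μ : Fin (Module.finrank ℂ E) → ℝ),
      (∀ j, (truncOp t AL + truncOp t AR + M) (b j) = (μ j : ℂ) • b j) ∧ (∀ j, e - δ ≤ μ j) ∧
      (Finset.univ.filter fun j => μ j ≤ e).card ≤ f ∧ ∀ j, μ j ≤ e ∨ e + ε / 2 ≤ μ j := by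
  have hALs := IsSelfAdjoint.of_nonneg hAL
  have hARs := IsSelfAdjoint.of_nonneg hAR
  have hMs := IsSelfAdjoint.of_nonneg hM
  have ht0 : 0 ≤ t := by linarith
  set H' := truncOp t AL + truncOp t AR + M with hH'
  have hH's : IsSelfAdjoint H' :=
    ((cfc_predicate _ AL : IsSelfAdjoint (truncOp t AL)).add
      (cfc_predicate _ AR : IsSelfAdjoint (truncOp t AR))).add hMs
  obtain ⟨b, μ, hb⟩ := exists_eigenbasis hH's
  have hle : H' ≤ AL + AR + M :=
    add_le_add (add_le_add (truncOp_le hALs t) (truncOp_le hARs t)) le_rfl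
  -- Seen from the left, the truncated right side belongs to the harmless part `Y`: it is
  -- nonnegative and commutes with `AL`.
  have hdecL : ∀ j, μ j ≤ e + ε → ‖expWeight AL (b j)‖ ^ 2 ≤ 2 * Real.exp (B / 3) := by
    intro j hj
    have h := norm_expWeight_apply_sq_le (A := AL) (X := XL) (Y := truncOp t AR + (M - XL)) hAL
      (add_nonneg (truncOp_nonneg hAR ht0) hYL)
      ((hARs.commute_cfc hAA.symm _).symm.add_right hcL) hXL hB htB (e := μ j) (by linarith)
      (φ := b j) (by rw [← hb j, hH']; congr 1; abel)
    simpa using h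
  have hdecR : ∀ j, μ j ≤ e + ε → ‖expWeight AR (b j)‖ ^ 2 ≤ 2 * Real.exp (B / 3) := by
    intro j hj
    have h := norm_expWeight_apply_sq_le (A := AR) (X := XR) (Y := truncOp t AL + (M - XR)) hAR
      (add_nonneg (truncOp_nonneg hAL ht0) hYR)
      ((hALs.commute_cfc hAA _).symm.add_right hcR) hXR hB htB (e := μ j) (by linarith)
      (φ := b j) (by rw [← hb j, hH']; congr 1; abel)
    simpa using h
  have hloss : ∀ J : Finset (Fin (Module.finrank ℂ E)), J.card ≤ f + 1 → (∀ j ∈ J, μ j ≤ e + ε) →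
      ∀ x, (∀ j ∉ J, inner ℂ (b j) x = 0) →
      (AL + AR + M).reApplyInnerSelf x ≤ H'.reApplyInnerSelf x + δ * ‖x‖ ^ 2 := by
    intro J hJ hJμ x hx
    have h1 := reApplyInnerSelf_le_of_decay (t := t) hALs (fun j hj => hdecL j (hJμ j hj)) hx
    have h2 := reApplyInnerSelf_le_of_decay (t := t) hARs (fun j hj => hdecR j (hJμ j hj)) hx
    have h3 : 6 * Real.exp (-(t / 6)) * (J.card * (2 * Real.exp (B / 3)) * ‖x‖ ^ 2) ≤
        δ / 2 * ‖x‖ ^ 2 := by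
      have hJ' : (J.card : ℝ) ≤ f + 1 := by exact_mod_cast hJ
      have hexp : Real.exp ((2 * B - t) / 6) = Real.exp (-(t / 6)) * Real.exp (B / 3) := by
        rw [← Real.exp_add]; congr 1; ring
      calc _ = 12 * J.card * Real.exp ((2 * B - t) / 6) * ‖x‖ ^ 2 := by rw [hexp]; ring
        _ ≤ 12 * (f + 1) * Real.exp ((2 * B - t) / 6) * ‖x‖ ^ 2 := by gcongr
        _ ≤ δ / 2 * ‖x‖ ^ 2 := by gcongr; linarith
    rw [hH', reApplyInnerSelf_add, reApplyInnerSelf_add, reApplyInnerSelf_add,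
      reApplyInnerSelf_add]
    linarith
  have hδ0 : 0 ≤ δ := le_trans (by positivity) hδ
  -- Among `f + 1` such eigenvectors some combination is orthogonal to `G`; its untruncated energy
  -- would be at most `e + ε / 2 + δ`, below the gap.
  have hlow : (Finset.univ.filter fun j => μ j < e + ε / 2).card ≤ f := by
    by_contra hcon
    obtain ⟨J, hJS, hJc⟩ := Finset.exists_subset_card_eq (Nat.succ_le_of_lt (not_le.1 hcon))
    have hJμ : ∀ j ∈ J, μ j < e + ε / 2 := fun j hj => (Finset.mem_filter.1 (hJS hj)).2
    obtain ⟨x, hxV, hxG, hx0⟩ := exists_mem_orthogonal_of_finrank_lt (U := G)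
      (V := Submodule.span ℂ (b '' (J : Set _)))
      (by rw [finrank_span_orthonormalBasis_image, hf, hJc]; exact Nat.lt_succ_self f)
    have hx : ∀ j ∉ J, inner ℂ (b j) x = 0 := fun j hj => inner_eq_zero_of_mem_span_image b hxV hj
    have h1 := hgap x hxG
    have h2 := hloss J hJc.le (fun j hj => by linarith [hJμ j hj]) x hx
    have h3 : H'.reApplyInnerSelf x ≤ (e + ε / 2) * ‖x‖ ^ 2 := by
      rw [reApplyInnerSelf_eq_sum hb, norm_sq_eq_sum (b := b), Finset.mul_sum]
      refine Finset.sum_le_sum fun j _ => ?_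
      by_cases hj : j ∈ J
      · gcongr; exact (hJμ j hj).le
      · simp [hx j hj]
    have h4 : 0 < ‖x‖ ^ 2 := by positivity
    nlinarith
  -- Truncation only lowers energies, so at least `f` eigenvalues are at most `e`. Together with
  -- `hlow` this leaves none strictly between `e` and `e + ε / 2`.
  have hhigh : f ≤ (Finset.univ.filter fun j => μ j ≤ e).card := by
    by_contra hcon
    set J := Finset.univ.filter fun j => μ j ≤ e with hJ
    obtain ⟨x, hxG, hxJ, hx0⟩ := exists_mem_orthogonal_of_finrank_lt (V := G)
      (U := Submodule.span ℂ (b '' (J : Set _)))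
      (by rw [finrank_span_orthonormalBasis_image, hf]; exact not_le.1 hcon)
    have h1 : H'.reApplyInnerSelf x ≤ e * ‖x‖ ^ 2 := by
      refine (reApplyInnerSelf_mono hle x).trans_eq ?_
      rw [ContinuousLinearMap.reApplyInnerSelf_apply, hG x hxG, inner_smul_left,
        inner_self_eq_norm_sq_to_K]
      change ((starRingEnd ℂ) (e : ℂ) * ((‖x‖ : ℝ) : ℂ) ^ 2).re = _
      rw [Complex.conj_ofReal, ← Complex.ofReal_pow, ← Complex.ofReal_mul, Complex.ofReal_re]
    rw [reApplyInnerSelf_eq_sum hb, norm_sq_eq_sum (b := b), Finset.mul_sum,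
      ← sub_nonneg, ← Finset.sum_sub_distrib] at h1
    have hterm : ∀ j, inner ℂ (b j) x = 0 ∨ e < μ j := by
      intro j
      by_cases hj : μ j ≤ e
      · left
        refine hxJ (b j) (Submodule.subset_span ⟨j, ?_, rfl⟩)
        simp [hJ, hj]
      · right; exact not_le.1 hj
    have hnonpos : ∀ j ∈ Finset.univ,
        e * ‖inner ℂ (b j) x‖ ^ 2 - μ j * ‖inner ℂ (b j) x‖ ^ 2 ≤ 0 := by
      intro j _
      rcases hterm j with h | h
      · simp [h]
      · nlinarith [sq_nonneg ‖inner ℂ (b j) x‖]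
    have hzero := (Finset.sum_eq_zero_iff_of_nonpos hnonpos).1
      (le_antisymm (Finset.sum_nonpos hnonpos) h1)
    refine hx0 ?_
    rw [← b.sum_repr' x]
    refine Finset.sum_eq_zero fun j hj => ?_
    rcases hterm j with h | h
    · rw [h, zero_smul]
    · have h2 := hzero j hj
      have h3 : ‖inner ℂ (b j) x‖ ^ 2 = 0 := by
        have : (e - μ j) * ‖inner ℂ (b j) x‖ ^ 2 = 0 := by linarith
        exact (mul_eq_zero.1 this).resolve_left (by linarith)
      have h4 : inner ℂ (b j) x = 0 := by simpa using h3
      rw [h4, zero_smul]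
  have hsub : (Finset.univ.filter fun j => μ j ≤ e) ⊆
      Finset.univ.filter fun j => μ j < e + ε / 2 := by
    intro j hj
    rw [Finset.mem_filter] at hj ⊢
    exact ⟨hj.1, by linarith [hj.2]⟩
  refine ⟨b, μ, hb, fun j => ?_, (Finset.card_le_card hsub).trans hlow, fun j => ?_⟩
  · by_cases hj : μ j ≤ e + ε
    · have h1 := hloss {j} (by simp) (by simpa using hj) (b j)
        (fun i hi => b.orthonormal.2 (by simpa using hi))
      have h2 := hmin (b j)
      have h3 : H'.reApplyInnerSelf (b j) = μ j := by
        rw [ContinuousLinearMap.reApplyInnerSelf_apply, hb j, inner_smul_left]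
        simp
      rw [h3] at h1
      simp only [b.norm_eq_one, one_pow, mul_one] at h1 h2
      linarith
    · linarith [not_le.1 hj]
  · by_cases hj : μ j < e + ε / 2
    · left
      have heq := Finset.eq_of_subset_of_card_le hsub (hlow.trans hhigh)
      have : j ∈ Finset.univ.filter fun j => μ j < e + ε / 2 := by simp [hj]
      rw [← heq] at this
      exact (Finset.mem_filter.1 this).2
    · right; exact not_lt.1 hj

end Truncation

/-! ### Polynomial filters and the bootstrap combined. -/

section Filter

variable {E : Type*} [NormedAddCommGroup E] [InnerProductSpace ℂ E] [FiniteDimensional ℂ E]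

set_option linter.unusedSectionVars false

lemma aeval_apply_eigenvector {T : E →L[ℂ] E} {μ : ℝ} {v : E} (h : T v = (μ : ℂ) • v)
    (p : Polynomial ℝ) : (Polynomial.aeval T p) v = ((p.eval μ : ℝ) : ℂ) • v := by
  induction p using Polynomial.induction_on' with
  | add p q hp hq => simp [hp, hq, add_smul]
  | monomial n a =>
    have hn : (T ^ n) v = ((μ : ℂ) ^ n) • v := by
      induction n with
      | zero => simp
      | succ n ih => rw [pow_succ, mul_apply_eq_comp, h, map_smul, ih, smul_smul, pow_succ']
    rw [Polynomial.aeval_monomial, mul_apply_eq_comp, hn, Algebra.algebraMap_eq_smul_one,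
      Polynomial.eval_monomial]
    simp [smul_smul, ← Complex.coe_smul, mul_comm]

variable {ι : Type*} [Fintype ι] {b : OrthonormalBasis ι ℂ E} {K : E →L[ℂ] E} {κ : ι → ℝ}

lemma inner_apply_of_eigenbasis (h : ∀ j, K (b j) = (κ j : ℂ) • b j) (j : ι) (x : E) :
    inner ℂ (b j) (K x) = κ j * inner ℂ (b j) x := by
  classical
  conv_lhs => rw [← b.sum_repr' x]
  rw [map_sum, inner_sum, Finset.sum_eq_single j]
  · rw [map_smul, h, inner_smul_right, inner_smul_right, inner_self_eq_norm_sq_to_K, b.norm_eq_one]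
    simp [mul_comm]
  · intro i _ hi
    rw [map_smul, h, inner_smul_right, inner_smul_right, b.orthonormal.2 hi.symm]
    simp
  · simp

lemma ext_inner_basis {x y : E} (h : ∀ j, inner ℂ (b j) x = inner ℂ (b j) y) : x = y := by
  rw [← b.sum_repr' x, ← b.sum_repr' y]
  simp only [h]

open Classical in
lemma inner_starProjection_span_image (J : Finset ι) (j : ι) (x : E) :
    inner ℂ (b j) ((Submodule.span ℂ (b '' (J : Set ι))).starProjection x) =
      if j ∈ J then inner ℂ (b j) x else 0 := by
  set G := Submodule.span ℂ (b '' (J : Set ι))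
  split_ifs with hj
  · have hbG : b j ∈ G := Submodule.subset_span ⟨j, hj, rfl⟩
    rw [← Submodule.inner_starProjection_left_eq_right,
      Submodule.starProjection_eq_self_iff.2 hbG]
  · exact inner_eq_zero_of_mem_span_image b (G.starProjection_apply_mem x) hj

/-- A polynomial that is at least `1` on the low part of the spectrum of `T` and small on the rest
turns few elements of `𝒬` into good approximations of every vector of low energy. -/
theorem exists_approx_of_filter {T : E →L[ℂ] E} {μ : ι → ℝ} (hb : ∀ j, T (b j) = (μ j : ℂ) • b j)
    {e ε δ top η R : ℝ} {f : ℕ} (hε : 0 < ε) (hη : 0 ≤ η) (hR : 0 ≤ R)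
    (hlow : ∀ j, e - δ ≤ μ j) (hcard : (Finset.univ.filter fun j => μ j ≤ e).card ≤ f)
    (hgap : ∀ j, μ j ≤ e ∨ e + ε / 2 ≤ μ j) (htop : ∀ j, μ j ≤ top) {p : Polynomial ℝ}
    (hp1 : ∀ x ≤ e, 1 ≤ p.eval x) (hp2 : ∀ x, e + ε / 2 ≤ x → x ≤ top → |p.eval x| ≤ η)
    {𝒬 : Set E} (hspan : Submodule.span ℂ 𝒬 = ⊤) (h𝒬 : ∀ q ∈ 𝒬, ‖q‖ ≤ 1)
    (hrank : ∀ g ≤ f, ∀ (φ : Fin g → E) (c : Fin g → ℂ),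
      (∀ j, φ j ∈ 𝒬) → ∀ (Λ : E →L[ℂ] ℂ), (∀ q ∈ 𝒬, ‖Λ q‖ ≤ 2) →
      ‖Λ (Polynomial.aeval T p (∑ j, c j • φ j))‖ ≤
        2 * R * ‖Polynomial.aeval T p (∑ j, c j • φ j)‖)
    (hsmall : 4 * R * η * f ≤ 1) {Ψ : E} (hΨ : ‖Ψ‖ = 1) (hΨe : T.reApplyInnerSelf Ψ ≤ e) :
    ∃ g ≤ f, ∃ (φ : Fin g → E) (c : Fin g → ℂ), (∀ j, φ j ∈ 𝒬) ∧
      ‖Polynomial.aeval T p (∑ j, c j • φ j) - Ψ‖ ≤ 4 * R * η * f + Real.sqrt (2 * δ / ε) := by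
  classical
  set K : E →L[ℂ] E := Polynomial.aeval T p with hKdef
  have hK : ∀ j, K (b j) = ((p.eval (μ j) : ℝ) : ℂ) • b j := fun j =>
    aeval_apply_eigenvector (hb j) p
  set J := Finset.univ.filter fun j => μ j ≤ e with hJ
  have hmemJ : ∀ j, j ∈ J ↔ μ j ≤ e := fun j => by simp [hJ]
  set G := Submodule.span ℂ (b '' (J : Set ι)) with hG
  have hgf : (J.card : ℝ) ≤ f := by exact_mod_cast hcard
  have hPi : ∀ j x, inner ℂ (b j) (G.starProjection x) = if j ∈ J then inner ℂ (b j) x else 0 :=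
    fun j x => inner_starProjection_span_image J j x
  have hKi := inner_apply_of_eigenbasis hK
  have hPK : ∀ x, G.starProjection (K x) = K (G.starProjection x) := by
    intro x
    refine ext_inner_basis (b := b) fun j => ?_
    rw [hKi, hPi, hPi, hKi]
    split_ifs <;> simp
  have hKη : ∀ x, ‖K (x - G.starProjection x)‖ ≤ η * ‖x‖ := by
    intro x
    refine le_of_sq_le_sq ?_ (by positivity)
    rw [mul_pow, norm_sq_eq_sum (b := b), norm_sq_eq_sum (b := b) x, Finset.mul_sum]
    refine Finset.sum_le_sum fun j _ => ?_
    rw [hKi, inner_sub_right, hPi]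
    split_ifs with hj
    · simp; positivity
    · rw [sub_zero, norm_mul, mul_pow, Complex.norm_real, Real.norm_eq_abs]
      have := hp2 (μ j) ((hgap j).resolve_left fun h => hj ((hmemJ j).2 h)) (htop j)
      gcongr
  have hinv : ∀ y ∈ G, ∃ x ∈ G, K x = y ∧ ‖x‖ ≤ ‖y‖ := by
    intro y hy
    set x : E := ∑ j ∈ J, (((p.eval (μ j))⁻¹ : ℝ) : ℂ) • inner ℂ (b j) y • b j with hx
    have hxi : ∀ j, inner ℂ (b j) x =
        if j ∈ J then (((p.eval (μ j))⁻¹ : ℝ) : ℂ) * inner ℂ (b j) y else 0 := by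
      intro j
      rw [hx, inner_sum]
      simp only [inner_smul_right]
      split_ifs with hj
      · rw [Finset.sum_eq_single_of_mem j hj]
        · rw [inner_self_eq_norm_sq_to_K, b.norm_eq_one]; simp
        · intro i _ hi; rw [b.orthonormal.2 hi.symm]; simp
      · refine Finset.sum_eq_zero fun i hi => ?_
        rw [b.orthonormal.2 (show j ≠ i from fun h => hj (h.symm ▸ hi))]; simp
    have hp1' : ∀ j ∈ J, 1 ≤ p.eval (μ j) := fun j hj => hp1 _ ((hmemJ j).1 hj)
    refine ⟨x, ?_, ?_, ?_⟩
    · exact Submodule.sum_mem _ fun j hj => Submodule.smul_mem _ _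
        (Submodule.smul_mem _ _ (Submodule.subset_span ⟨j, hj, rfl⟩))
    · refine ext_inner_basis (b := b) fun j => ?_
      rw [hKi, hxi]
      split_ifs with hj
      · have : p.eval (μ j) ≠ 0 := by linarith [hp1' j hj]
        rw [← mul_assoc, ← Complex.ofReal_mul, mul_inv_cancel₀ this]; simp
      · rw [mul_zero, inner_eq_zero_of_mem_span_image b hy hj]
    · refine le_of_sq_le_sq ?_ (norm_nonneg _)
      rw [norm_sq_eq_sum (b := b), norm_sq_eq_sum (b := b) y]
      refine Finset.sum_le_sum fun j _ => ?_
      rw [hxi]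
      split_ifs with hj
      · rw [norm_mul, mul_pow, Complex.norm_real, Real.norm_eq_abs]
        have h1 : |(p.eval (μ j))⁻¹| ≤ 1 := by
          rw [abs_inv, abs_of_pos (by linarith [hp1' j hj])]
          exact inv_le_one_of_one_le₀ (hp1' j hj)
        have h2 : |(p.eval (μ j))⁻¹| ^ 2 ≤ 1 := pow_le_one₀ (abs_nonneg _) h1
        exact mul_le_of_le_one_left (by positivity) h2
      · simp
  -- `Ψ` has mean energy at most `e` and no eigenvalue lies below `e - δ`. A weight `q` outside `G`
  -- adds at least `ε q / 2` to `e - δ`, so `q ≤ 2δ / ε`.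
  have hdist : ‖G.starProjection Ψ - Ψ‖ ≤ Real.sqrt (2 * δ / ε) := by
    refine Real.le_sqrt_of_sq_le ?_
    set q := ‖G.starProjection Ψ - Ψ‖ ^ 2 with hq
    have hq1 : q = ∑ j, if j ∈ J then 0 else ‖inner ℂ (b j) Ψ‖ ^ 2 := by
      rw [hq, norm_sq_eq_sum (b := b)]
      refine Finset.sum_congr rfl fun j _ => ?_
      rw [inner_sub_right, hPi]
      split_ifs <;> simp
    have h1 : (e - δ) * ‖Ψ‖ ^ 2 + ε / 2 * q ≤ T.reApplyInnerSelf Ψ := by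
      rw [reApplyInnerSelf_eq_sum hb, norm_sq_eq_sum (b := b), hq1, Finset.mul_sum, Finset.mul_sum,
        ← Finset.sum_add_distrib]
      refine Finset.sum_le_sum fun j _ => ?_
      split_ifs with hj
      · rw [mul_zero, add_zero]; gcongr; exact hlow j
      · have h2 := (hgap j).resolve_left fun h => hj ((hmemJ j).2 h)
        -- For negative `δ` every eigenvalue would exceed `e`, contradicting the energy of `Ψ`.
        have hδ : 0 ≤ δ := by
          by_contra hδ
          have h3 : ∀ j, e < μ j := fun j => by linarith [hlow j]
          have h4 : e * ‖Ψ‖ ^ 2 < T.reApplyInnerSelf Ψ := by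
            have h5 : (e - δ) * ‖Ψ‖ ^ 2 ≤ T.reApplyInnerSelf Ψ := by
              rw [reApplyInnerSelf_eq_sum hb, norm_sq_eq_sum (b := b), Finset.mul_sum]
              exact Finset.sum_le_sum fun j _ => by gcongr; exact hlow j
            rw [hΨ] at h5 ⊢
            linarith
          rw [hΨ] at h4
          linarith
        nlinarith [sq_nonneg ‖inner ℂ (b j) Ψ‖]
    rw [hΨ] at h1
    rw [le_div_iff₀ hε]
    linarith
  have hfin : Module.finrank ℂ G = J.card := finrank_span_orthonormalBasis_image b J
  obtain ⟨φ, c, hφ, hc⟩ := exists_approx_of_contraction hspan h𝒬 G hfin K hη hR hPK hKη hinv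
    (hrank J.card hcard) (le_trans (by gcongr) hsmall) (G.starProjection_apply_mem Ψ)
  refine ⟨J.card, hcard, φ, c, hφ, ?_⟩
  have hPle : ‖G.starProjection Ψ‖ ≤ 1 := hΨ ▸ G.norm_starProjection_apply_le Ψ
  calc ‖K (∑ j, c j • φ j) - Ψ‖
      ≤ ‖K (∑ j, c j • φ j) - G.starProjection Ψ‖ + ‖G.starProjection Ψ - Ψ‖ :=
        norm_sub_le_norm_sub_add_norm_sub _ _ _
    _ ≤ 4 * R * η * J.card * ‖G.starProjection Ψ‖ + Real.sqrt (2 * δ / ε) := add_le_add hc hdist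
    _ ≤ 4 * R * η * f * 1 + Real.sqrt (2 * δ / ε) := by gcongr
    _ = _ := by ring

end Filter

/-! ### Bond terms as operators on the chain. -/

section Chain

variable {N m d : ℕ}

lemma sum_filter_agree_off {β : Type*} [AddCommMonoid β] {i j : Fin N} (hij : i ≠ j)
    (σ : Fin N → Fin d) (F : (Fin N → Fin d) → β) :
    ∑ τ ∈ Finset.univ.filter (fun τ => ∀ k, k ≠ i → k ≠ j → σ k = τ k), F τ =
      ∑ ab : Fin d × Fin d, F (Function.update (Function.update σ i ab.1) j ab.2) := by
  refine (Finset.sum_nbij' (fun p : Fin d × Fin d => Function.update (Function.update σ i p.1) j p.2)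
    (fun τ => (τ i, τ j)) ?_ ?_ ?_ ?_ ?_).symm
  · intro p _
    simp only [Finset.mem_filter, Finset.mem_univ, true_and]
    intro k hi hj
    simp [hi, hj]
  · simp
  · intro p _
    simp [hij]
  · intro τ hτ
    simp only [Finset.mem_filter, Finset.mem_univ, true_and] at hτ
    ext k
    by_cases hkj : k = j
    · subst hkj; simp
    by_cases hki : k = i
    · subst hki; simp [hkj]
    simp [hki, hkj, hτ k hki hkj]
  · intro p _
    rfl

lemma bondOperator_mul {i j : Fin N} (hij : i ≠ j) (A B : Matrix (Fin d × Fin d) (Fin d × Fin d) ℂ) :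
    bondOperator i j (A * B) = bondOperator i j A * bondOperator i j B := by
  ext σ τ
  rw [Matrix.mul_apply]
  have h1 : ∀ ρ, bondOperator i j A σ ρ * bondOperator i j B ρ τ =
      if ∀ k, k ≠ i → k ≠ j → σ k = ρ k then
        A (σ i, σ j) (ρ i, ρ j) * bondOperator i j B ρ τ else 0 := by
    intro ρ; simp only [bondOperator, ite_mul, zero_mul]
  simp only [h1]
  rw [← Finset.sum_filter, sum_filter_agree_off hij]
  have h2 : ∀ ab : Fin d × Fin d, (∀ k, k ≠ i → k ≠ j →
      Function.update (Function.update σ i ab.1) j ab.2 k = τ k) ↔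
      ∀ k, k ≠ i → k ≠ j → σ k = τ k := by
    intro ab
    refine forall_congr' fun k => forall_congr' fun hi => forall_congr' fun hj => ?_
    simp [hi, hj]
  simp only [bondOperator, h2]
  by_cases h : ∀ k, k ≠ i → k ≠ j → σ k = τ k
  · simp [Matrix.mul_apply, hij]
  · simp [h]

lemma bondOperator_conjTranspose (i j : Fin N) (A : Matrix (Fin d × Fin d) (Fin d × Fin d) ℂ) :
    bondOperator i j A.conjTranspose = (bondOperator i j A).conjTranspose := by
  ext σ τ
  simp only [bondOperator, Matrix.conjTranspose_apply, eq_comm (a := σ _)]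
  split_ifs <;> simp

lemma bondOperator_sub (i j : Fin N) (A B : Matrix (Fin d × Fin d) (Fin d × Fin d) ℂ) :
    bondOperator i j (A - B) = bondOperator i j A - bondOperator i j B := by
  ext σ τ
  simp only [bondOperator, Matrix.sub_apply]
  split_ifs <;> simp

lemma bondOperator_one (i j : Fin N) :
    bondOperator i j (1 : Matrix (Fin d × Fin d) (Fin d × Fin d) ℂ) = 1 := by
  ext σ τ
  by_cases h : σ = τ
  · subst h; simp [bondOperator]
  · rw [Matrix.one_apply_ne h]
    simp only [bondOperator]
    split_ifs with hk
    · refine Matrix.one_apply_ne fun heq => h (funext fun k => ?_)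
      rw [Prod.mk.injEq] at heq
      by_cases hi : k = i
      · rw [hi]; exact heq.1
      by_cases hj : k = j
      · rw [hj]; exact heq.2
      exact hk k hi hj
    · rfl

/-- The `i`-th term of the Hamiltonian as an operator on the chain. -/
noncomputable def bondTerm (h : Fin m → Matrix (Fin d × Fin d) (Fin d × Fin d) ℂ) (i : Fin m) :
    ChainSpace (m + 1) d →L[ℂ] ChainSpace (m + 1) d :=
  Matrix.toEuclideanCLM (n := Fin (m + 1) → Fin d) (𝕜 := ℂ)
    (bondOperator i.castSucc i.succ (h i))

lemma castSucc_ne_succ (i : Fin m) : i.castSucc ≠ i.succ := (Fin.castSucc_lt_succ (i := i)).ne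

-- Embedding a two-spin matrix preserves products and adjoints, so `C* C` goes to an operator of the
-- same form.
open scoped MatrixOrder Matrix.Norms.L2Operator in
lemma toEuclideanCLM_bondOperator_nonneg {i j : Fin N} (hij : i ≠ j)
    {A : Matrix (Fin d × Fin d) (Fin d × Fin d) ℂ} (hA : A.PosSemidef) :
    0 ≤ Matrix.toEuclideanCLM (n := Fin N → Fin d) (𝕜 := ℂ) (bondOperator i j A) := by
  obtain ⟨C, rfl⟩ := CStarAlgebra.nonneg_iff_eq_star_mul_self.1 hA.nonneg
  rw [bondOperator_mul hij, Matrix.star_eq_conjTranspose, bondOperator_conjTranspose, map_mul, ← Matrix.star_eq_conjTranspose,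
    map_star]
  exact star_mul_self_nonneg _

variable {h : Fin m → Matrix (Fin d × Fin d) (Fin d × Fin d) ℂ}

lemma bondTerm_nonneg (hh : ∀ i, (h i).PosSemidef ∧ (1 - h i).PosSemidef) (i : Fin m) :
    0 ≤ bondTerm h i :=
  toEuclideanCLM_bondOperator_nonneg (castSucc_ne_succ i) (hh i).1

lemma bondTerm_le_one (hh : ∀ i, (h i).PosSemidef ∧ (1 - h i).PosSemidef) (i : Fin m) :
    bondTerm h i ≤ 1 := by
  have := toEuclideanCLM_bondOperator_nonneg (castSucc_ne_succ i) (hh i).2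
  rw [bondOperator_sub, bondOperator_one, map_sub, map_one] at this
  exact sub_nonneg.1 this

lemma norm_bondTerm_le (hh : ∀ i, (h i).PosSemidef ∧ (1 - h i).PosSemidef) (i : Fin m) :
    ‖bondTerm h i‖ ≤ 1 :=
  (CStarAlgebra.norm_le_one_iff_of_nonneg _ (bondTerm_nonneg hh i)).2 (bondTerm_le_one hh i)

lemma bondTerm_mem_localAlg {S : Set (Fin (m + 1))} {i : Fin m} (h1 : i.castSucc ∈ S)
    (h2 : i.succ ∈ S) : bondTerm h i ∈ localAlg S :=
  bondOperator_mem_localAlg (castSucc_ne_succ i) h1 h2 _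

lemma commute_bondTerm (i j : Fin m) (hij : (i : ℕ) + 1 < j) :
    Commute (bondTerm h i) (bondTerm h j) := by
  refine commute_of_mem_localAlg (S := {k | (k : ℕ) < j}) (T := {k | (j : ℕ) ≤ k}) ?_
    (bondTerm_mem_localAlg ?_ ?_) (bondTerm_mem_localAlg ?_ ?_)
  · rw [Set.disjoint_left]; intro k (hk : (k : ℕ) < j) (hk' : (j : ℕ) ≤ k); omega
  all_goals simp
  all_goals omega

lemma chainHamiltonian_eq (h : Fin m → Matrix (Fin d × Fin d) (Fin d × Fin d) ℂ) :
    chainHamiltonian h = (∑ i, bondTerm h i : ChainSpace (m + 1) d →L[ℂ] ChainSpace (m + 1) d).toLinearMap := by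
  unfold chainHamiltonian bondTerm
  rw [← map_sum]
  rfl

end Chain

/-! ### Energy levels and the variational gap. -/

section Gap

variable {N d : ℕ}

lemma energyLevels_subset {T : ChainSpace N d →L[ℂ] ChainSpace N d} {ι : Type*} [Fintype ι]
    {b : OrthonormalBasis ι ℂ (ChainSpace N d)} {μ : ι → ℝ} (hb : ∀ j, T (b j) = (μ j : ℂ) • b j) :
    energyLevels T.toLinearMap = Set.range μ := by
  ext E
  constructor
  · intro hE
    obtain ⟨v, hv⟩ := hE.exists_hasEigenvector
    by_contra hcon
    refine hv.2 (ext_inner_basis (b := b) fun j => ?_)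
    have h1 := inner_apply_of_eigenbasis hb j v
    have h2 : T v = (E : ℂ) • v := hv.apply_eq_smul
    rw [h2, inner_smul_right] at h1
    have h3 : ((E : ℂ) - μ j) * inner ℂ (b j) v = 0 := by rw [sub_mul, h1, sub_self]
    rcases mul_eq_zero.1 h3 with h4 | h4
    · exact absurd ⟨j, by exact_mod_cast (sub_eq_zero.1 h4).symm⟩ hcon
    · rw [h4, inner_zero_right]
  · rintro ⟨j, rfl⟩
    exact Module.End.hasEigenvalue_of_hasEigenvector (x := b j)
      ⟨Module.End.mem_eigenspace_iff.2 (hb j), b.orthonormal.ne_zero j⟩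

/-- Variational form of the spectral gap. -/
lemma IsEnergyGap.variational {T : ChainSpace N d →L[ℂ] ChainSpace N d} (hT : IsSelfAdjoint T)
    {ε : ℝ} (hε : IsEnergyGap T.toLinearMap ε) :
    0 < ε ∧ (∀ x ∈ groundSpace T.toLinearMap, T x = (groundEnergy T.toLinearMap : ℂ) • x) ∧
    (∀ x, groundEnergy T.toLinearMap * ‖x‖ ^ 2 ≤ T.reApplyInnerSelf x) ∧
    (∀ x ∈ (groundSpace T.toLinearMap)ᗮ,
      (groundEnergy T.toLinearMap + ε) * ‖x‖ ^ 2 ≤ T.reApplyInnerSelf x) ∧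
    groundSpace T.toLinearMap ≠ ⊤ := by
  obtain ⟨b, μ, hb⟩ := exists_eigenbasis hT
  have hlev := energyLevels_subset hb
  have hG : ∀ x, x ∈ groundSpace T.toLinearMap ↔ T x = (groundEnergy T.toLinearMap : ℂ) • x :=
    fun x => Module.End.mem_eigenspace_iff
  set e := groundEnergy T.toLinearMap with he
  have hmin : ∀ j, e ≤ μ j := by
    intro j
    rw [he, groundEnergy, hlev]
    exact csInf_le (Set.finite_range μ).bddBelow ⟨j, rfl⟩
  have hpos : 0 < ε := by
    have := hε.1.2
    rw [← he] at this
    linarith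
  refine ⟨hpos, fun x hx => (hG x).1 hx, fun x => ?_, fun x hx => ?_, fun htop => ?_⟩
  · rw [reApplyInnerSelf_eq_sum hb, norm_sq_eq_sum (b := b), Finset.mul_sum]
    exact Finset.sum_le_sum fun j _ => by gcongr; exact hmin j
  · rw [reApplyInnerSelf_eq_sum hb, norm_sq_eq_sum (b := b), Finset.mul_sum]
    refine Finset.sum_le_sum fun j _ => ?_
    rcases (hmin j).eq_or_lt with h | h
    · have : inner ℂ (b j) x = 0 := hx _ ((hG _).2 (by rw [hb j, h]))
      simp [this]
    · have h2 : e + ε ≤ μ j := hε.2 ⟨by rw [hlev]; exact ⟨j, rfl⟩, h⟩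
      gcongr
  · obtain ⟨v, hv⟩ := hε.1.1.exists_hasEigenvector
    have h1 : T v = ((e + ε : ℝ) : ℂ) • v := hv.apply_eq_smul
    have h2 : T v = (e : ℂ) • v := (hG v).1 (by rw [htop]; trivial)
    rw [h2] at h1
    have h3 := smul_left_injective ℂ hv.2 h1
    have : e = e + ε := by exact_mod_cast h3
    linarith

end Gap

/-! ### Product vectors, local eigenvectors and local functional calculus. -/

section ProductVectors

variable {N d : ℕ}

/-- Normalized (or shorter) product vectors. -/
def unitProducts (S : Set (Fin N)) : Set (ChainSpace N d) :=
  {x | ‖x‖ ≤ 1 ∧ ∃ u ∈ dependsOnSubmodule S, ∃ v ∈ dependsOnSubmodule Sᶜ, x = cmul u v}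

lemma cmul_eq_smul_unitProduct {S : Set (Fin N)} {u v : ChainSpace N d}
    (hu : u ∈ dependsOnSubmodule S) (hv : v ∈ dependsOnSubmodule Sᶜ) :
    ∃ q ∈ unitProducts S, cmul u v = (‖cmul u v‖ : ℂ) • q := by
  refine ⟨((‖cmul u v‖⁻¹ : ℝ) : ℂ) • cmul u v, ⟨?_, ((‖cmul u v‖⁻¹ : ℝ) : ℂ) • u,
    Submodule.smul_mem _ _ hu, v, hv, (cmul_smul_left _ _ _).symm⟩, ?_⟩
  · rw [norm_smul, Complex.norm_real, Real.norm_eq_abs, abs_inv, abs_norm]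
    exact inv_mul_le_one
  · by_cases h : ‖cmul u v‖ = 0
    · rw [norm_eq_zero.1 h]; simp
    · rw [smul_smul, ← Complex.ofReal_mul, mul_inv_cancel₀ h]; simp

lemma span_unitProducts (S : Set (Fin N)) :
    Submodule.span ℂ (unitProducts (d := d) S) = ⊤ := by
  rw [eq_top_iff]
  intro ψ _
  rw [eq_sum_cmul_agreeOn S ψ]
  refine Submodule.sum_mem _ fun τ _ => ?_
  obtain ⟨q, hq, he⟩ := cmul_eq_smul_unitProduct (agreeOn_mem S τ)
    (Submodule.smul_mem _ (ψ τ) (agreeOn_mem Sᶜ τ))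
  rw [he]
  exact Submodule.smul_mem _ _ (Submodule.subset_span hq)

lemma isSumOfProducts_of_mem_unitProducts {S : Set (Fin N)} {x : ChainSpace N d}
    (hx : x ∈ unitProducts S) : IsSumOfProducts S 1 x := by
  obtain ⟨-, u, hu, v, hv, rfl⟩ := hx
  exact IsSumOfProducts.cmul hu hv

lemma IsSumOfProducts.norm_apply_le_of_unitProducts {S : Set (Fin N)} {r : ℕ} {ψ : ChainSpace N d}
    (h : IsSumOfProducts S r ψ) {Λ : ChainSpace N d →L[ℂ] ℂ}
    (hΛ : ∀ q ∈ unitProducts S, ‖Λ q‖ ≤ 2) : ‖Λ ψ‖ ≤ 2 * Real.sqrt r * ‖ψ‖ := by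
  refine h.norm_apply_le (by norm_num) fun u hu v hv => ?_
  obtain ⟨q, hq, he⟩ := cmul_eq_smul_unitProduct hu hv
  have h1 : ‖Λ (_root_.cmul u v)‖ = ‖_root_.cmul u v‖ * ‖Λ q‖ := by
    conv_lhs => rw [he]
    rw [map_smul, norm_smul, Complex.norm_real, norm_norm]
  rw [h1]
  nlinarith [hΛ q hq, norm_nonneg (_root_.cmul u v)]

/-- An eigenvector of a local operator may be chosen local. -/
lemma exists_local_eigenvector {S : Set (Fin N)} {X : ChainSpace N d →L[ℂ] ChainSpace N d}
    (hX : X ∈ localAlg S) {c : ℂ} {u : ChainSpace N d} (hu : X u = c • u) (hu0 : u ≠ 0) :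
    ∃ u' ∈ dependsOnSubmodule S, X u' = c • u' ∧ ∃ σ, u' σ ≠ 0 := by
  classical
  obtain ⟨σ₀, hσ₀⟩ : ∃ σ, u σ ≠ 0 := by
    by_contra! h
    exact hu0 (by ext σ; simpa using h σ)
  -- Freeze the spins outside `S` at `σ₀`. The slice `u'` agrees with `u` after multiplication by an
  -- indicator of these spins, and `X` commutes with that multiplication.
  let mix : (Fin N → Fin d) → (Fin N → Fin d) := fun σ k => if k ∈ S then σ k else σ₀ k
  let u' : ChainSpace N d := WithLp.toLp 2 fun σ => u (mix σ)
  have hu' : u' ∈ dependsOnSubmodule S := by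
    intro σ τ h
    have : mix σ = mix τ := by
      funext k; by_cases hk : k ∈ S
      · simp [mix, hk, h k hk]
      · simp [mix, hk]
    simp only [u', this]
  have hδ : cmul u (agreeOn Sᶜ σ₀) = cmul u' (agreeOn Sᶜ σ₀) := by
    ext σ
    by_cases h : ∀ k ∈ Sᶜ, σ k = σ₀ k
    · have : mix σ = σ := by
        funext k; by_cases hk : k ∈ S
        · simp [mix, hk]
        · simp [mix, hk, h k hk]
      simp [u', this]
    · simp only [cmul_apply, agreeOn, if_neg h, mul_zero]
  have h1 : cmul (X u') (agreeOn Sᶜ σ₀) = cmul (c • u') (agreeOn Sᶜ σ₀) := by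
    rw [← hX.1 _ _ (agreeOn_mem _ _), ← hδ, hX.1 _ _ (agreeOn_mem _ _), hu, cmul_smul_left, hδ,
      cmul_smul_left]
  refine ⟨u', hu', ?_, σ₀, ?_⟩
  · ext σ
    have h2 := congrArg (fun w : ChainSpace N d => w (mix σ)) h1
    have hone : agreeOn Sᶜ σ₀ (mix σ) = 1 := by
      have : ∀ k ∈ Sᶜ, mix σ k = σ₀ k := fun k hk => if_neg hk
      simp only [agreeOn, if_pos this]
    simp only [cmul_apply, hone, mul_one] at h2
    have hagree : ∀ k ∈ S, mix σ k = σ k := fun k hk => if_pos hk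
    have h3 : c • u' ∈ dependsOnSubmodule S := Submodule.smul_mem _ c hu'
    rwa [hX.2 S subset_rfl u' hu' hagree, h3 hagree] at h2
  · have : mix σ₀ = σ₀ := by funext k; simp [mix]
    simpa [u', this] using hσ₀

lemma cmul_ne_zero {S : Set (Fin N)} {u v : ChainSpace N d} (hu : u ∈ dependsOnSubmodule S)
    (hv : v ∈ dependsOnSubmodule Sᶜ) (hu0 : ∃ σ, u σ ≠ 0) (hv0 : ∃ σ, v σ ≠ 0) :
    cmul u v ≠ 0 := by
  classical
  obtain ⟨σ, hσ⟩ := hu0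
  obtain ⟨τ, hτ⟩ := hv0
  intro h
  have h1 := congrArg (fun w : ChainSpace N d => w fun k => if k ∈ S then σ k else τ k) h
  simp only [cmul_apply] at h1
  rw [hu (x := fun k => if k ∈ S then σ k else τ k) (y := σ) (fun k hk => if_pos hk),
    hv (x := fun k => if k ∈ S then σ k else τ k) (y := τ) (fun k hk => if_neg hk)] at h1
  exact (mul_ne_zero hσ hτ) (by simpa using h1)

lemma exists_ground {E : Type*} [NormedAddCommGroup E] [InnerProductSpace ℂ E]
    [FiniteDimensional ℂ E] [Nontrivial E] {T : E →L[ℂ] E} (hT : IsSelfAdjoint T) :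
    ∃ (e : ℝ) (v : E), v ≠ 0 ∧ T v = (e : ℂ) • v ∧ 0 ≤ T - (e : ℂ) • 1 := by
  obtain ⟨b, μ, hb⟩ := exists_eigenbasis hT
  have : Nonempty (Fin (Module.finrank ℂ E)) := ⟨⟨0, Module.finrank_pos⟩⟩
  obtain ⟨j, hj⟩ := Finite.exists_min μ
  refine ⟨μ j, b j, b.orthonormal.ne_zero j, hb j, ?_⟩
  have hsa : IsSelfAdjoint (T - ((μ j : ℝ) : ℂ) • (1 : E →L[ℂ] E)) := by
    refine hT.sub (IsSelfAdjoint.smul ?_ (IsSelfAdjoint.one _))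
    exact Complex.conj_ofReal _
  rw [ContinuousLinearMap.nonneg_iff_isPositive, ContinuousLinearMap.isPositive_def']
  refine ⟨hsa, fun x => ?_⟩
  have hb' : ∀ i, (T - ((μ j : ℝ) : ℂ) • (1 : E →L[ℂ] E)) (b i) = ((μ i - μ j : ℝ) : ℂ) • b i := by
    intro i
    simp [hb, sub_smul]
  rw [reApplyInnerSelf_eq_sum hb']
  exact Finset.sum_nonneg fun i _ => mul_nonneg (sub_nonneg.2 (hj i)) (by positivity)

/-- On finitely many eigenvalues every function is a Lagrange interpolant, so `cfc f T` is a
polynomial in `T`. This keeps the truncated sides local. -/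
lemma cfc_mem_subalgebra {E : Type*} [NormedAddCommGroup E] [InnerProductSpace ℂ E]
    [FiniteDimensional ℂ E] {T : E →L[ℂ] E} (hT : IsSelfAdjoint T) {L : Subalgebra ℂ (E →L[ℂ] E)}
    (hL : T ∈ L) (f : ℝ → ℝ) : cfc f T ∈ L := by
  classical
  obtain ⟨b, μ, hb⟩ := exists_eigenbasis hT
  set s := Finset.univ.image μ
  have hspec : ∀ r ∈ spectrum ℝ T, r ∈ s := by
    intro r hr
    set p : Polynomial ℝ := ∏ x ∈ s, (Polynomial.X - Polynomial.C x) with hp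
    have h0 : Polynomial.aeval T p = 0 := by
      refine ContinuousLinearMap.ext fun x => ?_
      rw [← b.sum_repr' x, map_sum]
      simp only [map_smul, aeval_apply_eigenvector (hb _)]
      refine Finset.sum_eq_zero fun j _ => ?_
      have : p.eval (μ j) = 0 := by
        rw [hp, Polynomial.eval_prod]
        exact Finset.prod_eq_zero (Finset.mem_image_of_mem _ (Finset.mem_univ j)) (by simp)
      simp [this]
    have h1 := spectrum.subset_polynomial_aeval T p ⟨r, hr, rfl⟩
    rw [h0] at h1
    have h2 : p.eval r = 0 := by
      by_contra hne
      refine h1 ?_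
      rw [spectrum.mem_resolventSet_iff, sub_zero]
      exact (IsUnit.mk0 _ hne).map (algebraMap ℝ (E →L[ℂ] E))
    rw [hp, Polynomial.eval_prod, Finset.prod_eq_zero_iff] at h2
    obtain ⟨x, hx, hxr⟩ := h2
    have : r = x := by simpa [sub_eq_zero] using hxr
    rwa [this]
  set q := Lagrange.interpolate s id f with hq
  have h1 : cfc f T = cfc q.eval T := by
    refine cfc_congr fun r hr => ?_
    have := Lagrange.eval_interpolate_at_node f (Set.injOn_id (s : Set ℝ)) (hspec r hr)
    exact this.symm
  rw [h1, cfc_polynomial q T]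
  have hle : Algebra.adjoin ℝ {T} ≤ L.restrictScalars ℝ := Algebra.adjoin_le (by simpa using hL)
  exact hle (Polynomial.aeval_mem_adjoin_singleton ℝ T)

end ProductVectors

/-! ### A bound on the gap, and the rank of a filtered vector. -/

section ChainBounds

variable {d : ℕ}

lemma reApplyInnerSelf_of_apply_eq_smul {E : Type*} [NormedAddCommGroup E] [InnerProductSpace ℂ E]
    {T : E →L[ℂ] E} {e : ℝ} {x : E} (h : T x = (e : ℂ) • x) :
    T.reApplyInnerSelf x = e * ‖x‖ ^ 2 := by
  rw [ContinuousLinearMap.reApplyInnerSelf_apply, h, inner_smul_left, inner_self_eq_norm_sq_to_K]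
  change ((starRingEnd ℂ) (e : ℂ) * ((‖x‖ : ℝ) : ℂ) ^ 2).re = _
  rw [Complex.conj_ofReal, ← Complex.ofReal_pow, ← Complex.ofReal_mul, Complex.ofReal_re]

lemma sum_bondTerm_nonneg {m : ℕ} {h : Fin m → Matrix (Fin d × Fin d) (Fin d × Fin d) ℂ}
    (hh : ∀ i, (h i).PosSemidef ∧ (1 - h i).PosSemidef) (s : Finset (Fin m)) :
    0 ≤ ∑ i ∈ s, bondTerm h i :=
  Finset.sum_nonneg fun i _ => bondTerm_nonneg hh i

lemma sum_bondTerm_reApplyInnerSelf_le {m : ℕ}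
    {h : Fin m → Matrix (Fin d × Fin d) (Fin d × Fin d) ℂ}
    (hh : ∀ i, (h i).PosSemidef ∧ (1 - h i).PosSemidef) (s : Finset (Fin m))
    (x : ChainSpace (m + 1) d) :
    (∑ i ∈ s, bondTerm h i).reApplyInnerSelf x ≤ s.card * ‖x‖ ^ 2 := by
  classical
  induction s using Finset.induction_on with
  | empty => simp [ContinuousLinearMap.reApplyInnerSelf_apply]
  | insert a s ha ih =>
    rw [Finset.sum_insert ha, reApplyInnerSelf_add, Finset.card_insert_of_notMem ha]
    have := reApplyInnerSelf_mono (bondTerm_le_one hh a) x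
    rw [reApplyInnerSelf_one] at this
    push_cast
    linarith

lemma isSelfAdjoint_sum_bondTerm {m : ℕ} {h : Fin m → Matrix (Fin d × Fin d) (Fin d × Fin d) ℂ}
    (hh : ∀ i, (h i).PosSemidef ∧ (1 - h i).PosSemidef) (s : Finset (Fin m)) :
    IsSelfAdjoint (∑ i ∈ s, bondTerm h i) :=
  IsSelfAdjoint.of_nonneg (sum_bondTerm_nonneg hh s)

lemma reApplyInnerSelf_nonneg_of_nonneg {E : Type*} [NormedAddCommGroup E]
    [InnerProductSpace ℂ E] [FiniteDimensional ℂ E] {T : E →L[ℂ] E} (hT : 0 ≤ T) (x : E) :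
    0 ≤ T.reApplyInnerSelf x := by
  simpa [ContinuousLinearMap.reApplyInnerSelf_apply] using reApplyInnerSelf_mono hT x

lemma le_reApplyInnerSelf_of_sub_nonneg {E : Type*} [NormedAddCommGroup E]
    [InnerProductSpace ℂ E] [FiniteDimensional ℂ E] {T : E →L[ℂ] E} {e : ℝ}
    (hT : 0 ≤ T - (e : ℂ) • 1) (x : E) : e * ‖x‖ ^ 2 ≤ T.reApplyInnerSelf x := by
  have h1 := reApplyInnerSelf_mono (sub_nonneg.1 hT) x
  rwa [Complex.coe_smul, reApplyInnerSelf_real_smul, reApplyInnerSelf_one] at h1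

/-- The energy gap is at most the degeneracy of the ground state. -/
lemma energyGap_le {m f : ℕ} {h : Fin m → Matrix (Fin d × Fin d) (Fin d × Fin d) ℂ}
    (hh : ∀ i, (h i).PosSemidef ∧ (1 - h i).PosSemidef) {G : Submodule ℂ (ChainSpace (m + 1) d)}
    (hf : Module.finrank ℂ G = f) (hf1 : 1 ≤ f) (htop : G ≠ ⊤) {e ε : ℝ}
    (hG : ∀ x ∈ G, (∑ i, bondTerm h i) x = (e : ℂ) • x)
    (hgap : ∀ x ∈ Gᗮ, (e + ε) * ‖x‖ ^ 2 ≤ (∑ i, bondTerm h i).reApplyInnerSelf x) : ε ≤ f := by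
  have hfin : Module.finrank ℂ (ChainSpace (m + 1) d) = d ^ (m + 1) := by simp
  have hlt : f < d ^ (m + 1) := by
    rw [← hf, ← hfin]; exact Submodule.finrank_lt htop
  obtain ⟨y, hyG, hy0⟩ : ∃ y ∈ G, y ≠ 0 := by
    refine Submodule.exists_mem_ne_zero_of_ne_bot fun hbot => ?_
    rw [hbot, finrank_bot] at hf
    omega
  have hy := reApplyInnerSelf_of_apply_eq_smul (hG y hyG)
  have hypos : 0 < ‖y‖ ^ 2 := by positivity
  suffices hmain : ∃ x, x ≠ 0 ∧ x ∈ Gᗮ ∧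
      (∑ i, bondTerm h i).reApplyInnerSelf x ≤ (e + f) * ‖x‖ ^ 2 by
    obtain ⟨x, hx0, hx, hle⟩ := hmain
    have hxpos : 0 < ‖x‖ ^ 2 := by positivity
    have := le_of_mul_le_mul_right ((hgap x hx).trans hle) hxpos
    linarith
  have he0 : 0 ≤ e := by
    have := reApplyInnerSelf_nonneg_of_nonneg (sum_bondTerm_nonneg hh Finset.univ) y
    rw [hy] at this
    exact nonneg_of_mul_nonneg_left this hypos
  -- A short chain has all its energies at most `m ≤ f`, so any vector orthogonal to `G` will do.
  by_cases hmf : m ≤ f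
  · obtain ⟨x, -, hx, hx0⟩ := exists_mem_orthogonal_of_finrank_lt (U := G) (V := ⊤)
      (by rw [finrank_top, hf, hfin]; exact hlt)
    refine ⟨x, hx0, hx, (sum_bondTerm_reApplyInnerSelf_le hh _ x).trans ?_⟩
    have : (m : ℝ) ≤ f := by exact_mod_cast hmf
    rw [Finset.card_univ, Fintype.card_fin]
    gcongr
    linarith
  push Not at hmf
  have hd : 2 ≤ d := by
    by_contra hd
    have : d ^ (m + 1) ≤ 1 := Nat.pow_le_one_iff (by omega) |>.2 (by omega)
    omega
  -- Detach the last `f` spins. A ground state of the remaining bonds times an arbitrary vector on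
  -- them has energy at most `e + f`; such vectors span `d ^ f > f` dimensions, so one of them is
  -- orthogonal to `G`.
  set S : Set (Fin (m + 1)) := {k | (k : ℕ) < m + 1 - f} with hS
  set inside := Finset.univ.filter fun i : Fin m => (i : ℕ) + 1 < m + 1 - f with hin
  set outside := Finset.univ.filter fun i : Fin m => ¬ (i : ℕ) + 1 < m + 1 - f with hout
  have hsplit : ∑ i, bondTerm h i = ∑ i ∈ inside, bondTerm h i + ∑ i ∈ outside, bondTerm h i :=
    (Finset.sum_filter_add_sum_filter_not _ _ _).symm
  have hcard : outside.card ≤ f := by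
    have hsub : (outside.image fun i : Fin m => (i : ℕ)) ⊆ Finset.Ico (m - f) m := by
      intro k hk
      obtain ⟨i, hi, rfl⟩ := Finset.mem_image.1 hk
      have := (Finset.mem_filter.1 hi).2
      rw [Finset.mem_Ico]; omega
    have h2 := Finset.card_le_card hsub
    rw [Finset.card_image_of_injective _ Fin.val_injective, Nat.card_Ico] at h2
    omega
  have hloc : ∑ i ∈ inside, bondTerm h i ∈ localAlg S := by
    refine Subalgebra.sum_mem _ fun i hi => ?_
    have := (Finset.mem_filter.1 hi).2
    refine bondTerm_mem_localAlg ?_ ?_ <;> simp [hS] <;> omega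
  have : Nontrivial (ChainSpace (m + 1) d) := ⟨y, 0, hy0⟩
  obtain ⟨eS, u, hu0, hu, hpos⟩ := exists_ground (isSelfAdjoint_sum_bondTerm hh inside)
  obtain ⟨u', hu'S, hu', σ₀, hσ₀⟩ := exists_local_eigenvector hloc hu hu0
  have heS : eS ≤ e := by
    have h1 := le_reApplyInnerSelf_of_sub_nonneg hpos y
    have h2 := reApplyInnerSelf_nonneg_of_nonneg (sum_bondTerm_nonneg hh outside) y
    rw [hsplit, reApplyInnerSelf_add] at hy
    exact le_of_mul_le_mul_right (by linarith) hypos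
  let tail : (Fin (m + 1) → Fin d) → Fin f → Fin d := fun σ k => σ ⟨m + 1 - f + k, by omega⟩
  let Φ : ((Fin f → Fin d) → ℂ) →ₗ[ℂ] ChainSpace (m + 1) d :=
    { toFun := fun w => cmul u' (WithLp.toLp 2 fun σ => w (tail σ))
      map_add' := fun w w' => by ext σ; simp [mul_add]
      map_smul' := fun c w => by ext σ; simp [mul_left_comm] }
  have hΦinj : Function.Injective Φ := by
    rw [← LinearMap.ker_eq_bot, LinearMap.ker_eq_bot']
    intro w hw
    funext a
    let σ : Fin (m + 1) → Fin d := fun k =>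
      if hk : (k : ℕ) < m + 1 - f then σ₀ k else a ⟨k - (m + 1 - f), by omega⟩
    have h1 : tail σ = a := by
      funext k; simp [tail, σ]
    have h2 : u' σ = u' σ₀ := hu'S fun k hk => dif_pos hk
    have h3 := congrArg (fun v : ChainSpace (m + 1) d => v σ) hw
    have h4 : u' σ * w (tail σ) = 0 := h3
    rw [h1, h2] at h4
    exact (mul_eq_zero.1 h4).resolve_left hσ₀
  obtain ⟨x, ⟨w, rfl⟩, hxG, hx0⟩ := exists_mem_orthogonal_of_finrank_lt (U := G)
    (V := LinearMap.range Φ) (by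
      rw [hf, LinearMap.finrank_range_of_inj hΦinj]
      simp only [Module.finrank_fintype_fun_eq_card, Fintype.card_pi, Fintype.card_fin,
        Finset.prod_const, Finset.card_univ]
      exact Nat.lt_pow_self hd)
  refine ⟨Φ w, hx0, hxG, ?_⟩
  have hx : (∑ i ∈ inside, bondTerm h i) (Φ w) = (eS : ℂ) • Φ w := by
    have : WithLp.toLp 2 (fun σ => w (tail σ)) ∈ dependsOnSubmodule (d := d) Sᶜ := by
      intro σ τ hστ
      have : tail σ = tail τ := by
        funext k
        exact hστ _ (by simp [hS])
      simp only [this]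
    change (∑ i ∈ inside, bondTerm h i) (cmul u' _) = _
    rw [hloc.1 _ _ this, hu', cmul_smul_left]
    rfl
  rw [hsplit, reApplyInnerSelf_add, reApplyInnerSelf_of_apply_eq_smul hx]
  have h1 := sum_bondTerm_reApplyInnerSelf_le hh outside (Φ w)
  have h2 : (outside.card : ℝ) ≤ f := by exact_mod_cast hcard
  have h3 : (0 : ℝ) ≤ ‖Φ w‖ ^ 2 := by positivity
  nlinarith

/-- Bound on the Schmidt rank produced by a polynomial of degree `l` of the truncated Hamiltonian. -/
lemma isSumOfProducts_aeval {n s l k : ℕ} (hs : s ≤ n)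
    (h : Fin (2 * n + 1) → Matrix (Fin d × Fin d) (Fin d × Fin d) ℂ)
    {a₀ r₀ : ChainSpace (2 * n + 1 + 1) d →L[ℂ] ChainSpace (2 * n + 1 + 1) d}
    (ha₀ : a₀ ∈ localAlg {i : Fin (2 * n + 1 + 1) | (i : ℕ) < n - s + 1})
    (hr₀ : r₀ ∈ localAlg {i : Fin (2 * n + 1 + 1) | n ≤ (i : ℕ)}) (hl : l < s * (k + 1))
    {p : Polynomial ℝ} (hp : p.natDegree ≤ l) {x : ChainSpace (2 * n + 1 + 1) d}
    (hx : IsSumOfProducts {i : Fin (2 * n + 1 + 1) | (i : ℕ) < n + 1} 1 x) :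
    IsSumOfProducts {i : Fin (2 * n + 1 + 1) | (i : ℕ) < n + 1}
      (s * (d ^ s * ((l + 1) * ((d * d + 1) * (l + 1)) ^ k) * d ^ s))
      (Polynomial.aeval (a₀ + r₀ + ∑ j : Fin s, bondTerm h ⟨n - s + j, by omega⟩) p x) := by
  classical
  set b : Fin s → ChainSpace (2 * n + 1 + 1) d →L[ℂ] ChainSpace (2 * n + 1 + 1) d :=
    fun j => bondTerm h ⟨n - s + j, by omega⟩ with hb
  set Y : Fin s → ChainSpace (2 * n + 1 + 1) d →L[ℂ] ChainSpace (2 * n + 1 + 1) d :=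
    fun j => ∑ i ∈ Finset.range (l + 1), p.coeff i • wordSum (a₀ + r₀) b i (firstSparse k j) with hY
  have hsum : Polynomial.aeval (a₀ + r₀ + ∑ j, b j) p = ∑ j, Y j := by
    rw [Polynomial.aeval_eq_sum_range' (Nat.lt_succ_of_le hp), hY, Finset.sum_comm]
    refine Finset.sum_congr rfl fun i hi => ?_
    rw [← Finset.smul_sum, pow_eq_sum_wordSum_firstSparse]
    have := Finset.mem_range.1 hi
    omega
  rw [hsum, sum_apply]
  have hcard : s * (d ^ s * ((l + 1) * ((d * d + 1) * (l + 1)) ^ k) * d ^ s) =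
      ∑ _j : Fin s, d ^ s * ((l + 1) * ((d * d + 1) * (l + 1)) ^ k) * d ^ s := by simp
  rw [hcard]
  refine IsSumOfProducts.sum _ fun j _ => ?_
  -- The auxiliary cut runs through the sparse bond itself, between its two spins, `s - j` sites
  -- left of the middle cut.
  set c := n - s + j + 1 with hc
  set S : Set (Fin (2 * n + 1 + 1)) := {i | (i : ℕ) < c} with hS
  let O : Finset (ChainSpace (2 * n + 1 + 1) d →L[ℂ] ChainSpace (2 * n + 1 + 1) d) :=
    insert 1 (Finset.univ.image fun ab : Fin d × Fin d =>
      siteOp (⟨n - s + j, by omega⟩ : Fin (2 * n + 1)).succ (Matrix.single ab.1 ab.2 1))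
  have hjs := j.2
  have hOcard : O.card ≤ d * d + 1 := by
    refine (Finset.card_insert_le _ _).trans (Nat.succ_le_succ (Finset.card_image_le.trans ?_))
    simp
  have hO : ∀ o ∈ O, o ∈ localAlg (d := d) Sᶜ := by
    intro o ho
    rcases Finset.mem_insert.1 ho with rfl | ho
    · exact Subalgebra.one_mem _
    · obtain ⟨ab, -, rfl⟩ := Finset.mem_image.1 ho
      refine siteOp_mem_localAlg ?_ _
      simp [hS, hc]
  have hbj : b j ∈ Subalgebra.toSubmodule (localAlg (d := d) S) * Submodule.span ℂ (O : Set _) := by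
    rw [hb]
    change Matrix.toEuclideanCLM (n := Fin (2 * n + 1 + 1) → Fin d) (𝕜 := ℂ)
      (bondOperator _ _ _) ∈ _
    rw [toEuclideanCLM_bondOperator (castSucc_ne_succ _)]
    refine Submodule.sum_mem _ fun ab _ => Submodule.mul_mem_mul ?_ (Submodule.subset_span ?_)
    · refine siteOp_mem_localAlg ?_ _
      simp [hS, hc]
    · exact Finset.mem_insert_of_mem (Finset.mem_image_of_mem _ (Finset.mem_univ ab))
  have hword : ∀ i ≤ l, wordSum (a₀ + r₀) b i (firstSparse k j) ∈
      Subalgebra.toSubmodule (localAlg (d := d) S) * Submodule.span ℂ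
        (gapWords (r₀ + ∑ x ∈ Finset.univ.filter (j < ·), b x) O l k l : Set _) := by
    intro i hi
    refine mul_le_mul' le_rfl (Submodule.span_mono (Finset.coe_subset.2 (gapWords_mono k hi)))
      (wordSum_mem (R := localAlg Sᶜ)
        (fun x hx y hy => commute_of_mem_localAlg disjoint_compl_right hx hy) j ?_ ?_ ?_ ?_ hO
        (Finset.mem_insert_self _ _) hbj hi ?_ ?_)
    · refine localAlg_mono ?_ ha₀
      intro i hi
      simp only [hS, Set.mem_ofPred_eq] at hi ⊢; omega
    · refine localAlg_mono ?_ hr₀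
      intro i hi
      simp only [hS, Set.mem_compl_iff, Set.mem_ofPred_eq] at hi ⊢; omega
    · intro x hx
      have : (x : ℕ) < j := hx
      refine bondTerm_mem_localAlg ?_ ?_ <;> simp [hS, hc] <;> omega
    · intro x hx
      have : (j : ℕ) < x := hx
      refine bondTerm_mem_localAlg ?_ ?_ <;> simp [hS, hc] <;> omega
    · intro x hx v
      have h1 : ∀ y, y ≤ j → (v + Pi.single x 1 : Fin s → ℕ) y = v y := by
        intro y hy
        simp [(lt_of_le_of_lt hy hx).ne]
      have h2 : (∀ y < j, k < (v + Pi.single x 1 : Fin s → ℕ) y) ↔ ∀ y < j, k < v y :=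
        forall₂_congr fun y hy => by rw [h1 y hy.le]
      simp only [firstSparse, h2, h1 j le_rfl]
    · intro v hv
      exact if_neg fun hc => absurd hc.2 (not_le.2 hv)
  have hYmem : Y j ∈ Subalgebra.toSubmodule (localAlg (d := d) S) * Submodule.span ℂ
        (gapWords (r₀ + ∑ x ∈ Finset.univ.filter (j < ·), b x) O l k l : Set _) := by
    refine Submodule.sum_mem _ fun i hi => ?_
    exact Submodule.smul_of_tower_mem _ _ (hword i (Nat.lt_succ_iff.1 (Finset.mem_range.1 hi)))
  set V := gapWords (r₀ + ∑ x ∈ Finset.univ.filter (j < ·), b x) O l k l with hV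
  have hVR : ∀ w ∈ V, w ∈ localAlg (d := d) Sᶜ := by
    refine gapWords_subset (Subalgebra.add_mem _ ?_ (Subalgebra.sum_mem _ fun x hx => ?_)) hO k l
    · refine localAlg_mono ?_ hr₀
      intro i hi
      simp only [hS, Set.mem_compl_iff, Set.mem_ofPred_eq] at hi ⊢; omega
    · have : (j : ℕ) < x := by simpa using hx
      refine bondTerm_mem_localAlg ?_ ?_ <;> simp [hS, hc] <;> omega
  have hVcard : V.card ≤ (l + 1) * ((d * d + 1) * (l + 1)) ^ k :=
    (card_gapWords_le k l le_rfl).trans (by gcongr)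
  obtain ⟨q, hq, hYq⟩ := exists_eq_sum_mul hYmem
  have hcn : c + (s - j - 0) = n + 1 := by omega
  -- The input is moved to the auxiliary cut, where each right word keeps the number of products,
  -- and the result is moved back; both moves cost `d ^ (s - j)`.
  have hxc : IsSumOfProducts S (1 * d ^ (s - j - 0)) x := by
    refine IsSumOfProducts.lt_of_add (m := c) ?_ (by omega)
    rw [hcn]; exact hx
  have hYc : IsSumOfProducts S (∑ _w ∈ V, 1 * d ^ (s - j - 0)) (Y j x) := by
    rw [hYq, sum_apply]
    exact IsSumOfProducts.sum _ fun w hw => (hxc.map_right (hVR w hw)).map_left (hq w)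
  have hfinal := hYc.lt_add (s - j - 0) (by omega)
  rw [hcn] at hfinal
  by_cases hd : d = 0
  · subst hd
    refine hfinal.mono ?_
    have : s - j - 0 ≠ 0 := by omega
    simp
  have hpow : d ^ (s - j - 0) ≤ d ^ s := Nat.pow_le_pow_right (by omega) (by omega)
  refine hfinal.mono ?_
  rw [Finset.sum_const, smul_eq_mul, one_mul, mul_comm (d ^ s) (_ * _)]
  gcongr

end ChainBounds

/-! ### Approximation of a ground state for given parameters. -/

section ChainApprox

variable {d : ℕ}

lemma adCLM_sub_smul_one {A : Type*} [NormedRing A] [NormedAlgebra ℂ A] (a : A) (e : ℂ) :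
    adCLM (a - e • 1) = adCLM a := by
  ext x
  simp [adCLM_apply, sub_mul, mul_sub]

/-- The energy shift drops out of commutators, and the weight `1 / 12` is matched to the growth rate
`6`. -/
lemma norm_exp_conj_bondTerm_le {m : ℕ} {h : Fin m → Matrix (Fin d × Fin d) (Fin d × Fin d) ℂ}
    (hh : ∀ i, (h i).PosSemidef ∧ (1 - h i).PosSemidef) (S : Finset (Fin m)) (c : Fin m) (e : ℂ) :
    ‖NormedSpace.exp ((1 / 12 : ℂ) • (∑ i ∈ S, bondTerm h i - e • 1)) * bondTerm h c *
      NormedSpace.exp (-((1 / 12 : ℂ) • (∑ i ∈ S, bondTerm h i - e • 1)))‖ ≤ 2 := by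
  refine norm_exp_conj_le (κ := 6) (by norm_num) (fun k => ?_) (by norm_num)
  rw [adCLM_sub_smul_one]
  exact norm_adCLM_pow_le (norm_bondTerm_le hh) (fun i j hij => commute_bondTerm i j hij) S c k

lemma sum_filter_val_eq_sum_fin {m a s : ℕ} (hm : a + s ≤ m) {β : Type*} [AddCommMonoid β]
    (F : Fin m → β) :
    ∑ i ∈ Finset.univ.filter (fun i : Fin m => a ≤ i ∧ (i : ℕ) < a + s), F i =
      ∑ j : Fin s, F ⟨a + j, by omega⟩ := by
  refine (Finset.sum_nbij (fun j : Fin s => (⟨a + j, by omega⟩ : Fin m)) ?_ ?_ ?_ ?_).symm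
  · intro j _; simp
  · intro i _ j _ hij
    have := congrArg Fin.val hij
    ext; simp at this; omega
  · intro i hi
    have hi' := (Finset.mem_filter.1 hi).2
    exact ⟨⟨i - a, by omega⟩, by simp, by ext; simp; omega⟩
  · intro j _; rfl

/-- The ground energies of two terms acting on disjoint regions can be attained simultaneously. -/
lemma exists_joint_ground {N : ℕ} {S T : Set (Fin N)} (hST : Disjoint S T)
    {X Y : ChainSpace N d →L[ℂ] ChainSpace N d} (hX : X ∈ localAlg S) (hY : Y ∈ localAlg T)
    {x y : ℂ} {u v : ChainSpace N d} (hu : X u = x • u) (hu0 : u ≠ 0) (hv : Y v = y • v)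
    (hv0 : v ≠ 0) : ∃ w : ChainSpace N d, w ≠ 0 ∧ X w = x • w ∧ Y w = y • w := by
  obtain ⟨u', hu'S, hu', hu'0⟩ := exists_local_eigenvector hX hu hu0
  have hY' : Y ∈ localAlg Sᶜ := localAlg_mono hST.subset_compl_left hY
  obtain ⟨v', hv'S, hv', hv'0⟩ := exists_local_eigenvector hY' hv hv0
  refine ⟨cmul u' v', cmul_ne_zero hu'S hv'S hu'0 hv'0, ?_, ?_⟩
  · rw [hX.1 _ _ hv'S, hu', cmul_smul_left]
  · rw [cmul_comm, hY'.1 _ _ (by rwa [compl_compl]), hv', cmul_smul_left]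

set_option maxHeartbeats 1000000 in
/-- Approximation of a ground state by sums of few product vectors, filtered by a polynomial of a
Hamiltonian that is truncated away from the middle cut. -/
theorem exists_isSumOfProducts_approx {n s l k f : ℕ} (hs1 : 1 ≤ s) (hs : s ≤ n)
    {h : Fin (2 * n + 1) → Matrix (Fin d × Fin d) (Fin d × Fin d) ℂ}
    (hh : ∀ i, (h i).PosSemidef ∧ (1 - h i).PosSemidef)
    (hf : Module.finrank ℂ (groundSpace (chainHamiltonian h)) = f)
    {ε : ℝ} (hε : IsEnergyGap (chainHamiltonian h) ε) {Ψ : ChainSpace (2 * n + 1 + 1) d}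
    (hΨG : Ψ ∈ groundSpace (chainHamiltonian h)) (hΨ : ‖Ψ‖ = 1) (hl : l < s * (k + 1))
    {t δ : ℝ} (ht : 2 * (s + f + 2) ≤ t)
    (hδ : 24 * (f + 1) * Real.exp ((2 * (s + f + 2) - t) / 6) ≤ δ) (hδε : δ ≤ ε / 4)
    {r : ℕ} (hr : f * (s * (d ^ s * ((l + 1) * ((d * d + 1) * (l + 1)) ^ k) * d ^ s)) ≤ r)
    {η : ℝ} (hη : 2 * Real.exp (-(l * Real.sqrt (ε / (2 * t + s + ε)))) ≤ η)
    (hsmall : 4 * Real.sqrt r * η * f ≤ 1) :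
    ∃ v, IsSumOfProducts {i : Fin (2 * n + 1 + 1) | (i : ℕ) < n + 1} r v ∧
      ‖v - Ψ‖ ≤ 4 * Real.sqrt r * η * f + Real.sqrt (2 * δ / ε) := by
  classical
  rw [chainHamiltonian_eq] at hf hε hΨG
  have hsa := isSelfAdjoint_sum_bondTerm hh Finset.univ
  obtain ⟨hε0, hG, hmin, hgap, htop⟩ := hε.variational hsa
  set G := groundSpace (∑ i, bondTerm h i :
    ChainSpace (2 * n + 1 + 1) d →L[ℂ] ChainSpace (2 * n + 1 + 1) d).toLinearMap with hGdef
  set E₀ := groundEnergy (∑ i, bondTerm h i :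
    ChainSpace (2 * n + 1 + 1) d →L[ℂ] ChainSpace (2 * n + 1 + 1) d).toLinearMap with hE₀
  have hΨ0 : Ψ ≠ 0 := by rintro rfl; simp at hΨ
  have : Nontrivial (ChainSpace (2 * n + 1 + 1) d) := ⟨Ψ, 0, hΨ0⟩
  have hf1 : 1 ≤ f := by
    rw [← hf, Nat.succ_le_iff, Module.finrank_pos_iff]
    exact ⟨⟨Ψ, hΨG⟩, 0, fun h0 => hΨ0 (congrArg Subtype.val h0)⟩
  have hεf : ε ≤ f := energyGap_le hh hf hf1 htop hG hgap
  -- The block consists of the bonds `n - s, …, n - 1`, all left of the middle cut; the bond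
  -- crossing that cut belongs to the right part.
  set left := Finset.univ.filter fun i : Fin (2 * n + 1) => (i : ℕ) < n - s with hleft
  set mid := Finset.univ.filter fun i : Fin (2 * n + 1) => n - s ≤ i ∧ (i : ℕ) < n - s + s with hmid
  set right := Finset.univ.filter fun i : Fin (2 * n + 1) => n ≤ (i : ℕ) with hright
  set HL := ∑ i ∈ left, bondTerm h i with hHL
  set HR := ∑ i ∈ right, bondTerm h i with hHR
  set M := ∑ i ∈ mid, bondTerm h i with hM
  have hsplit : ∑ i, bondTerm h i = HL + HR + M := by
    have hu : (Finset.univ : Finset (Fin (2 * n + 1))) = left ∪ right ∪ mid := by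
      ext i
      simp only [hleft, hmid, hright, Finset.mem_union, Finset.mem_filter, Finset.mem_univ,
        true_and, true_iff]
      omega
    rw [hu, Finset.sum_union, Finset.sum_union]
    all_goals
      rw [Finset.disjoint_left]
      intro i
      simp only [hleft, hmid, hright, Finset.mem_union, Finset.mem_filter, Finset.mem_univ,
        true_and]
      omega
  have hlocL : HL ∈ localAlg {i : Fin (2 * n + 1 + 1) | (i : ℕ) < n - s + 1} := by
    refine Subalgebra.sum_mem _ fun i hi => ?_
    have := (Finset.mem_filter.1 hi).2
    refine bondTerm_mem_localAlg ?_ ?_ <;> simp <;> omega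
  have hlocR : HR ∈ localAlg {i : Fin (2 * n + 1 + 1) | n ≤ (i : ℕ)} := by
    refine Subalgebra.sum_mem _ fun i hi => ?_
    have := (Finset.mem_filter.1 hi).2
    refine bondTerm_mem_localAlg ?_ ?_ <;> simp <;> omega
  have hdisj : Disjoint {i : Fin (2 * n + 1 + 1) | (i : ℕ) < n - s + 1}
      {i : Fin (2 * n + 1 + 1) | n ≤ (i : ℕ)} := by
    rw [Set.disjoint_left]
    intro i (hi : (i : ℕ) < n - s + 1) (hi' : n ≤ (i : ℕ))
    omega
  have hLsa : IsSelfAdjoint HL := isSelfAdjoint_sum_bondTerm hh left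
  have hRsa : IsSelfAdjoint HR := isSelfAdjoint_sum_bondTerm hh right
  obtain ⟨eL, uL, huL0, huL, hLpos⟩ := exists_ground hLsa
  obtain ⟨eR, uR, huR0, huR, hRpos⟩ := exists_ground hRsa
  set AL := HL - (eL : ℂ) • (1 : ChainSpace (2 * n + 1 + 1) d →L[ℂ] ChainSpace (2 * n + 1 + 1) d)
    with hAL
  set AR := HR - (eR : ℂ) • (1 : ChainSpace (2 * n + 1 + 1) d →L[ℂ] ChainSpace (2 * n + 1 + 1) d)
    with hAR
  have hALloc : AL ∈ localAlg {i : Fin (2 * n + 1 + 1) | (i : ℕ) < n - s + 1} :=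
    Subalgebra.sub_mem _ hlocL (Subalgebra.smul_mem _ (Subalgebra.one_mem _) _)
  have hARloc : AR ∈ localAlg {i : Fin (2 * n + 1 + 1) | n ≤ (i : ℕ)} :=
    Subalgebra.sub_mem _ hlocR (Subalgebra.smul_mem _ (Subalgebra.one_mem _) _)
  have hM0 : 0 ≤ M := sum_bondTerm_nonneg hh mid
  have hMcard : mid.card = s := by
    have := sum_filter_val_eq_sum_fin (m := 2 * n + 1) (a := n - s) (s := s) (by omega)
      (fun _ => (1 : ℕ))
    rw [Finset.card_eq_sum_ones, hmid, this]
    simp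
  have hMle : ∀ x, M.reApplyInnerSelf x ≤ s * ‖x‖ ^ 2 := by
    intro x
    have := sum_bondTerm_reApplyInnerSelf_le hh mid x
    rwa [hMcard] at this
  set e := E₀ - eL - eR with he
  have hshift : ∀ x, (AL + AR + M) x = (∑ i, bondTerm h i) x - ((eL + eR : ℝ) : ℂ) • x := by
    intro x
    rw [hsplit, hAL, hAR]
    simp only [add_apply, sub_apply, smul_apply, one_apply_eq_self, Complex.ofReal_add, add_smul]
    abel
  have hshiftR : ∀ x, (AL + AR + M).reApplyInnerSelf x =
      (∑ i, bondTerm h i).reApplyInnerSelf x - (eL + eR) * ‖x‖ ^ 2 := by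
    intro x
    have h1 : ∑ i, bondTerm h i = (AL + AR + M) + (eL + eR : ℝ) •
        (1 : ChainSpace (2 * n + 1 + 1) d →L[ℂ] ChainSpace (2 * n + 1 + 1) d) := by
      ext1 x
      rw [add_apply, hshift, smul_apply, Complex.coe_smul]
      simp
    rw [h1, reApplyInnerSelf_add (AL + AR + M), reApplyInnerSelf_real_smul, reApplyInnerSelf_one]
    ring
  have hGs : ∀ x ∈ G, (AL + AR + M) x = (e : ℂ) • x := by
    intro x hx
    rw [hshift, hG x hx, ← sub_smul, he]
    push_cast
    congr 1
    ring
  have he0 : 0 ≤ e := by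
    have h1 := reApplyInnerSelf_of_apply_eq_smul (hGs Ψ hΨG)
    have h2 := reApplyInnerSelf_nonneg_of_nonneg (add_nonneg (add_nonneg hLpos hRpos) hM0) Ψ
    rw [h1, hΨ] at h2
    linarith
  -- A joint ground state of the two sides is a trial state in which only the `s` block terms cost
  -- energy.
  have hes : e ≤ s := by
    obtain ⟨w, hw0, hwL, hwR⟩ := exists_joint_ground hdisj hlocL hlocR huL huL0 huR huR0
    have h1 := hmin w
    rw [hsplit, reApplyInnerSelf_add, reApplyInnerSelf_add, reApplyInnerSelf_of_apply_eq_smul hwL,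
      reApplyInnerSelf_of_apply_eq_smul hwR] at h1
    have h2 := hMle w
    have hwpos : 0 < ‖w‖ ^ 2 := by positivity
    refine le_of_mul_le_mul_right ?_ hwpos
    rw [he]
    linarith
  have hα : ∀ {a b : ℕ} {i : Fin (2 * n + 1)} {S : Set (Fin (2 * n + 1 + 1))},
      a ≤ (i : ℕ) → (i : ℕ) + 1 < b → (∀ q : Fin (2 * n + 1 + 1), a ≤ q → (q : ℕ) < b → q ∈ S) →
      bondTerm h i ∈ localAlg S := by
    intro a b i S h1 h2 h3
    refine bondTerm_mem_localAlg (h3 _ ?_ ?_) (h3 _ ?_ ?_) <;> simp <;> omega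
  -- The end bonds of the block are the only ones sharing a spin with the left and right part
  -- respectively; for `s = 1` they coincide.
  let cL : Fin (2 * n + 1) := ⟨n - s, by omega⟩
  let cR : Fin (2 * n + 1) := ⟨n - 1, by omega⟩
  have hcLm : cL ∈ mid := by simp [hmid, cL]; omega
  have hcRm : cR ∈ mid := by simp [hmid, cR]; omega
  have hYL : M - bondTerm h cL = ∑ i ∈ mid.erase cL, bondTerm h i := by
    rw [hM, ← Finset.add_sum_erase _ _ hcLm, add_sub_cancel_left]
  have hYR : M - bondTerm h cR = ∑ i ∈ mid.erase cR, bondTerm h i := by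
    rw [hM, ← Finset.add_sum_erase _ _ hcRm, add_sub_cancel_left]
  have hYL0 : 0 ≤ M - bondTerm h cL := hYL ▸ sum_bondTerm_nonneg hh _
  have hYR0 : 0 ≤ M - bondTerm h cR := hYR ▸ sum_bondTerm_nonneg hh _
  have hcL : Commute AL (M - bondTerm h cL) := by
    rw [hYL]
    refine commute_of_mem_localAlg (T := {i : Fin (2 * n + 1 + 1) | n - s + 1 ≤ (i : ℕ)}) ?_ hALloc
      (Subalgebra.sum_mem _ fun i hi => ?_)
    · rw [Set.disjoint_left]
      intro i (hi : (i : ℕ) < n - s + 1) (hi' : n - s + 1 ≤ (i : ℕ))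
      omega
    · have h1 := (Finset.mem_erase.1 hi).1
      have h2 := (Finset.mem_filter.1 (Finset.mem_erase.1 hi).2).2
      have h3 : (i : ℕ) ≠ n - s := fun h3 => h1 (Fin.ext h3)
      exact hα (a := n - s + 1) (b := 2 * n + 2) (by omega) (by omega) fun q hq _ => hq
  have hcR : Commute AR (M - bondTerm h cR) := by
    rw [hYR]
    refine commute_of_mem_localAlg (T := {i : Fin (2 * n + 1 + 1) | (i : ℕ) < n}) ?_ hARloc
      (Subalgebra.sum_mem _ fun i hi => ?_)
    · rw [Set.disjoint_left]
      intro i (hi : n ≤ (i : ℕ)) (hi' : (i : ℕ) < n)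
      omega
    · have h1 := (Finset.mem_erase.1 hi).1
      have h2 := (Finset.mem_filter.1 (Finset.mem_erase.1 hi).2).2
      have h3 : (i : ℕ) ≠ n - 1 := fun h3 => h1 (Fin.ext h3)
      exact hα (a := 0) (b := n) (by omega) (by omega) fun q _ hq => hq
  have hALs : IsSelfAdjoint AL := IsSelfAdjoint.of_nonneg hLpos
  have hARs : IsSelfAdjoint AR := IsSelfAdjoint.of_nonneg hRpos
  have hs0 : (0 : ℝ) ≤ s := Nat.cast_nonneg s
  have hf0 : (0 : ℝ) ≤ f := Nat.cast_nonneg f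
  have ht0 : 0 ≤ t := by linarith
  -- This `B` dominates `e + ε + 2` because `e ≤ s` and `ε ≤ f`.
  obtain ⟨b, μ, hb, hlow, hcard, hμ⟩ := exists_eigenbasis_truncated (B := s + f + 2) (t := t)
    hLpos hRpos hM0 (commute_of_mem_localAlg hdisj hALloc hARloc) hYL0 hYR0 hcL hcR
    (norm_exp_conj_bondTerm_le hh left cL eL) (norm_exp_conj_bondTerm_le hh right cR eR) hf hGs
    (fun x => by rw [hshiftR, he]; linarith [hmin x])
    (fun x hx => by rw [hshiftR, he]; linarith [hgap x hx]) (by positivity) (by linarith) ht hδ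
    hδε hε0
  set T := truncOp t AL + truncOp t AR + M with hT
  have hTle : ∀ x, T.reApplyInnerSelf x ≤ (2 * t + s) * ‖x‖ ^ 2 := by
    intro x
    have h1 := reApplyInnerSelf_mono (truncOp_le_smul_one hALs t) x
    have h2 := reApplyInnerSelf_mono (truncOp_le_smul_one hARs t) x
    rw [reApplyInnerSelf_real_smul, reApplyInnerSelf_one] at h1 h2
    rw [hT, reApplyInnerSelf_add, reApplyInnerSelf_add]
    linarith [hMle x]
  have hμtop : ∀ j, μ j ≤ e + ε / 2 + (2 * t + s + ε) := by
    intro j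
    have h1 := hTle (b j)
    rw [reApplyInnerSelf_of_apply_eq_smul (hb j), b.norm_eq_one] at h1
    linarith
  -- The interval has length `2t + s + ε`: enough to contain the spectrum, which is at most `2t +
  -- s`, and at least twice the step `ε / 2`.
  obtain ⟨p, hpdeg, hp1, hp2⟩ := exists_poly_step l (e := e) (lo := e + ε / 2)
    (top := e + ε / 2 + (2 * t + s + ε)) (by linarith) (by linarith) (by linarith)
  have hz : 2 * (e + ε / 2 - e) / (e + ε / 2 + (2 * t + s + ε) - (e + ε / 2)) =
      ε / (2 * t + s + ε) := by
    congr 1 <;> ring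
  rw [hz] at hp2
  set S : Set (Fin (2 * n + 1 + 1)) := {i | (i : ℕ) < n + 1} with hS
  have hTs : T = truncOp t AL + truncOp t AR + ∑ j : Fin s, bondTerm h ⟨n - s + j, by omega⟩ := by
    rw [hT, hM, ← sum_filter_val_eq_sum_fin (m := 2 * n + 1) (a := n - s) (s := s) (by omega)
      (fun i => bondTerm h i)]
  have hrank : ∀ g ≤ f, ∀ (φ : Fin g → ChainSpace (2 * n + 1 + 1) d) (c : Fin g → ℂ),
      (∀ j, φ j ∈ unitProducts S) →
      IsSumOfProducts S r (Polynomial.aeval T p (∑ j, c j • φ j)) := by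
    intro g hg φ c hφ
    have h1 : IsSumOfProducts S (∑ _j : Fin g,
        s * (d ^ s * ((l + 1) * ((d * d + 1) * (l + 1)) ^ k) * d ^ s))
        (Polynomial.aeval T p (∑ j, c j • φ j)) := by
      rw [map_sum]
      refine IsSumOfProducts.sum _ fun j _ => ?_
      rw [hTs]
      exact isSumOfProducts_aeval hs h (cfc_mem_subalgebra hALs hALloc _)
        (cfc_mem_subalgebra hARs hARloc _) hl hpdeg
        ((isSumOfProducts_of_mem_unitProducts (hφ j)).smul _)
    refine h1.mono (le_trans ?_ hr)
    rw [Finset.sum_const, Finset.card_univ, Fintype.card_fin, smul_eq_mul]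
    exact Nat.mul_le_mul_right _ hg
  have hΨe : T.reApplyInnerSelf Ψ ≤ e := by
    have hle : T ≤ AL + AR + M :=
      add_le_add (add_le_add (truncOp_le hALs t) (truncOp_le hARs t)) le_rfl
    have h1 := reApplyInnerSelf_mono hle Ψ
    rwa [reApplyInnerSelf_of_apply_eq_smul (hGs Ψ hΨG), hΨ, one_pow, mul_one] at h1
  have hη0 : 0 ≤ η := le_trans (by positivity) hη
  obtain ⟨g, hg, φ, c, hφ, hclose⟩ := exists_approx_of_filter hb hε0 hη0 (Real.sqrt_nonneg r) hlow
    hcard hμ hμtop hp1 (fun x h1 h2 => (hp2 x h1 h2).trans hη) (span_unitProducts S)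
    (fun q hq => hq.1)
    (fun g hg φ c hφ Λ hΛ => (hrank g hg φ c hφ).norm_apply_le_of_unitProducts hΛ) hsmall hΨ hΨe
  exact ⟨_, hrank g hg φ c hφ, hclose⟩

/-- A vector close to a unit vector can be normalized without losing much of the overlap. -/
lemma exists_unit_overlap {E : Type*} [NormedAddCommGroup E] [InnerProductSpace ℂ E] {v Ψ : E}
    (hΨ : ‖Ψ‖ = 1) {κ : ℝ} (hκ : κ < 1) (hv : ‖v - Ψ‖ ≤ κ) :
    ∃ c : ℂ, ‖c • v‖ = 1 ∧ 1 - 2 * κ ≤ ‖inner ℂ (c • v) Ψ‖ := by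
  have h1 : ‖Ψ‖ - ‖v‖ ≤ ‖v - Ψ‖ := by
    rw [norm_sub_rev]; exact norm_sub_norm_le _ _
  have hvpos : 0 < ‖v‖ := by linarith
  set q : E := ((‖v‖⁻¹ : ℝ) : ℂ) • v with hq
  have hq1 : ‖q‖ = 1 := by
    rw [hq, norm_smul, Complex.norm_real, Real.norm_eq_abs, abs_of_pos (by positivity),
      inv_mul_cancel₀ hvpos.ne']
  refine ⟨_, hq1, ?_⟩
  have h2 : ‖v‖ - ‖Ψ‖ ≤ κ := (norm_sub_norm_le _ _).trans hv
  have hdist : ‖q - Ψ‖ ≤ 2 * κ := by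
    have h3 : ‖q - v‖ ≤ κ := by
      have : q - v = ((‖v‖⁻¹ - 1 : ℝ) : ℂ) • v := by
        rw [hq, Complex.ofReal_sub, sub_smul]; simp
      rw [this, norm_smul, Complex.norm_real, Real.norm_eq_abs, ← abs_of_pos hvpos, ← abs_mul,
        abs_of_pos hvpos, sub_mul, inv_mul_cancel₀ hvpos.ne', one_mul, abs_le]
      constructor <;> linarith
    calc ‖q - Ψ‖ ≤ ‖q - v‖ + ‖v - Ψ‖ := norm_sub_le_norm_sub_add_norm_sub _ _ _
      _ ≤ 2 * κ := by linarith
  have h4 : inner ℂ q Ψ = inner ℂ q q - inner ℂ q (q - Ψ) := by rw [inner_sub_right]; ring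
  have h5 : ‖inner ℂ q q‖ = 1 := by
    rw [inner_self_eq_norm_sq_to_K, hq1]; simp
  have h6 : ‖inner ℂ q (q - Ψ)‖ ≤ 2 * κ := by
    refine (norm_inner_le_norm _ _).trans ?_
    rwa [hq1, one_mul]
  rw [h4]
  have := norm_sub_norm_le (inner ℂ q q) (inner ℂ q (q - Ψ))
  linarith

lemma schmidtRank_le_pow {N d : ℕ} (m : ℕ) (hm : m ≤ N) (ψ : ChainSpace N d) :
    schmidtRank m ψ ≤ d ^ m := by
  refine (Matrix.rank_le_card_height _).trans ?_
  rw [Fintype.card_fun, Fintype.card_fin]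
  refine le_of_eq ?_
  congr 1
  rw [Fintype.card_subtype, Fin.card_filter_val_lt, min_eq_right hm]

end ChainApprox

/-! ### Choice of parameters. -/

section Parameters

/-- The rank for `l = 48 s²` and `k = 48 s`. The prefactor `1024 f² = (32 f)²` later absorbs the
constants multiplying `√r` in the error. -/
lemma filter_rank_le_pow (d f : ℕ) {s : ℕ} (hs : 1 ≤ s) :
    1024 * f ^ 2 * (f * (s * (d ^ s * ((48 * s ^ 2 + 1) * ((d * d + 1) * (48 * s ^ 2 + 1)) ^ (48 * s)) *
      d ^ s))) ≤ ((1024 * f ^ 3 + (d * d + 1) + 49) * (2 + s)) ^ (100 * s) := by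
  set Q := 1024 * f ^ 3 + (d * d + 1) + 49 with hQ
  set W := 2 + s with hW
  have hQ1 : 1 ≤ Q := by omega
  have hW1 : 1 ≤ W := by omega
  have hd : d ≤ Q := by have := Nat.le_mul_self d; omega
  have hl : 48 * s ^ 2 + 1 ≤ Q * W ^ 2 :=
    calc 48 * s ^ 2 + 1 ≤ 49 * W ^ 2 := by rw [hW]; nlinarith
      _ ≤ Q * W ^ 2 := Nat.mul_le_mul_right _ (by omega)
  have hdd : d * d + 1 ≤ Q := by omega
  have hf : 1024 * f ^ 3 ≤ Q := by omega
  calc 1024 * f ^ 2 * (f * (s * (d ^ s * ((48 * s ^ 2 + 1) *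
        ((d * d + 1) * (48 * s ^ 2 + 1)) ^ (48 * s)) * d ^ s)))
      = (1024 * f ^ 3) * s * (d ^ s * ((48 * s ^ 2 + 1) *
        ((d * d + 1) * (48 * s ^ 2 + 1)) ^ (48 * s)) * d ^ s) := by ring
    _ ≤ Q * W * (Q ^ s * ((Q * W ^ 2) * (Q * (Q * W ^ 2)) ^ (48 * s)) * Q ^ s) := by
        gcongr; omega
    _ = Q ^ (2 + 98 * s) * W ^ (3 + 96 * s) := by ring_nf
    _ ≤ Q ^ (100 * s) * W ^ (100 * s) := by gcongr <;> omega
    _ = (Q * W) ^ (100 * s) := (mul_pow _ _ _).symm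

lemma exists_filter_rank_le (d f : ℕ) : ∃ A : ℝ, 1 ≤ A ∧ ∀ s : ℕ, 1 ≤ s →
    (1024 * (f : ℝ) ^ 2) * ((f * (s * (d ^ s * ((48 * s ^ 2 + 1) *
      ((d * d + 1) * (48 * s ^ 2 + 1)) ^ (48 * s)) * d ^ s)) : ℕ) : ℝ) ≤
      Real.exp (A * s * Real.log (2 + s)) := by
  set Q : ℕ := 1024 * f ^ 3 + (d * d + 1) + 49 with hQ
  have hQ1 : (1 : ℝ) ≤ Q := by exact_mod_cast (by omega : 1 ≤ Q)
  have hlQ : 0 ≤ Real.log Q := Real.log_nonneg hQ1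
  refine ⟨100 * (Real.log Q + 1), by linarith, fun s hs => ?_⟩
  have h1 : ((1024 * f ^ 2 * (f * (s * (d ^ s * ((48 * s ^ 2 + 1) *
      ((d * d + 1) * (48 * s ^ 2 + 1)) ^ (48 * s)) * d ^ s))) : ℕ) : ℝ) ≤
      ((Q * (2 + s)) ^ (100 * s) : ℕ) := by exact_mod_cast filter_rank_le_pow d f hs
  rw [Nat.cast_mul (1024 * f ^ 2), Nat.cast_mul 1024, Nat.cast_pow f] at h1
  refine h1.trans ?_
  have hs' : (1 : ℝ) ≤ s := by exact_mod_cast hs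
  have hW : 1 ≤ Real.log (2 + s) := by
    rw [Real.le_log_iff_exp_le (by positivity)]
    linarith [Real.exp_one_lt_d9]
  have h2 : ((Q * (2 + s) : ℕ) : ℝ) ≤ Real.exp ((Real.log Q + 1) * Real.log (2 + s)) := by
    calc ((Q * (2 + s) : ℕ) : ℝ) = Real.exp (Real.log Q + Real.log (2 + s)) := by
          rw [Real.exp_add, Real.exp_log (by linarith), Real.exp_log (by positivity)]
          push_cast; ring
      _ ≤ _ := by
          apply Real.exp_le_exp.2
          nlinarith
  calc (((Q * (2 + s)) ^ (100 * s) : ℕ) : ℝ) = ((Q * (2 + s) : ℕ) : ℝ) ^ (100 * s) :=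
        Nat.cast_pow _ _
    _ ≤ Real.exp ((Real.log Q + 1) * Real.log (2 + s)) ^ (100 * s) := by gcongr
    _ = _ := by
        rw [← Real.exp_nat_mul]; congr 1; push_cast; ring

lemma mul_log_le_of_sq_le {A a : ℝ} (hA : 1 ≤ A) (ha : 36 * A ^ 2 ≤ a) :
    A * (3 * Real.log a) ≤ a := by
  have ha0 : 0 < a := by nlinarith
  have h1 : Real.log a ≤ 2 * Real.sqrt a := by
    have h2 := Real.log_le_sub_one_of_pos (Real.sqrt_pos.2 ha0)
    rw [Real.log_sqrt ha0.le] at h2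
    linarith
  have h3 : 6 * A ≤ Real.sqrt a := Real.le_sqrt_of_sq_le (by nlinarith)
  have h4 := Real.mul_self_sqrt ha0.le
  nlinarith [Real.sqrt_nonneg a]

set_option maxHeartbeats 1000000 in
/-- Admissible parameters of the truncation and of the polynomial, for `y = ε⁻¹`. -/
lemma parameters_admissible {s : ℕ} {F A a ε : ℝ} (hF : 1 ≤ F) (hA : 1 ≤ A) (hε : 0 < ε)
    (hεf : ε ≤ F) (ha : 36 * A ^ 2 + 256 * (F + 2) ≤ a) (haΛ : A * Real.log (2 + ε⁻¹) ≤ a)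
    (hs : s = ⌈ε⁻¹ * a ^ 3⌉₊) {r : ℝ}
    (hr : 1024 * F ^ 2 * r ≤ Real.exp (A * s * Real.log (2 + s))) :
    1 ≤ s ∧ (s : ℝ) ≤ 2 * (ε⁻¹ * a ^ 3) ∧
    2 * (s + F + 2) ≤ 36 * (ε⁻¹ * a ^ 4) ∧
    24 * (F + 1) * Real.exp ((2 * (s + F + 2) - 36 * (ε⁻¹ * a ^ 4)) / 6) ≤
      24 * (F + 1) * Real.exp (-(5 * (ε⁻¹ * a ^ 4))) ∧
    24 * (F + 1) * Real.exp (-(5 * (ε⁻¹ * a ^ 4))) ≤ ε / 4 ∧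
    2 * Real.exp (-(((48 * s ^ 2 : ℕ) : ℝ) * Real.sqrt (ε / (2 * (36 * (ε⁻¹ * a ^ 4)) + s + ε)))) ≤
      2 * Real.exp (-(4 * (ε⁻¹ * a ^ 4))) ∧
    4 * Real.sqrt r * (2 * Real.exp (-(4 * (ε⁻¹ * a ^ 4)))) * F ≤
      Real.exp (-(ε⁻¹ * a ^ 4)) / 4 ∧
    Real.sqrt (2 * (24 * (F + 1) * Real.exp (-(5 * (ε⁻¹ * a ^ 4)))) / ε) ≤
      Real.exp (-(ε⁻¹ * a ^ 4)) / 4 := by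
  set y := ε⁻¹ with hy
  have hy0 : 0 < y := inv_pos.2 hε
  have hεy : ε * y = 1 := mul_inv_cancel₀ hε.ne'
  have hFy : 1 ≤ F * y := by nlinarith
  have ha1 : 256 * (F + 2) ≤ a := by nlinarith
  have ha0 : 0 < a := by linarith
  set T := y * a ^ 4 with hT
  have ha2 : a ≤ a ^ 2 := by nlinarith
  have ha3 : a ≤ a ^ 3 := le_self_pow₀ (by linarith) (by norm_num)
  have ha4 : a ≤ a ^ 4 := le_self_pow₀ (by linarith) (by norm_num)
  have hya : 256 ≤ y * a := by nlinarith
  have hy3 : 1 ≤ y * a ^ 3 := by nlinarith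
  have hsR : (s : ℝ) ≤ 2 * (y * a ^ 3) := by
    have := (Nat.ceil_lt_add_one (show 0 ≤ y * a ^ 3 by linarith)).le
    rw [hs]; linarith
  have hsl : y * a ^ 3 ≤ s := hs ▸ Nat.le_ceil _
  have hs1 : 1 ≤ s := by
    have : (1 : ℝ) ≤ s := hy3.trans hsl
    exact_mod_cast this
  have hs0 : (0 : ℝ) < s := by linarith
  have hTa : T = y * a ^ 3 * a := by rw [hT]; ring
  have hsT : (s : ℝ) ≤ T := by nlinarith
  have hFT : F + 2 ≤ T := by
    have : F + 2 ≤ a := by linarith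
    nlinarith
  have hT0 : 0 < T := by linarith
  have hexp5 : 24 * (F + 1) * Real.exp (-(5 * T)) * 32 ≤ ε * Real.exp (-(2 * T)) := by
    have h1 : 768 * (F + 1) ≤ ε * Real.exp (3 * T) := by
      have h2 := Real.add_one_le_exp (3 * T)
      have h3 : ε * (3 * T) = 3 * a ^ 4 := by rw [hT]; linear_combination (3 * a ^ 4) * hεy
      nlinarith
    have h4 : Real.exp (-(2 * T)) = Real.exp (3 * T) * Real.exp (-(5 * T)) := by
      rw [← Real.exp_add]; congr 1; ring
    rw [h4]
    nlinarith [Real.exp_pos (-(5 * T))]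
  have hexp2 : Real.exp (-(2 * T)) ≤ 1 := Real.exp_le_one_iff.2 (by linarith)
  refine ⟨hs1, hsR, by linarith, ?_, by nlinarith, ?_, ?_, ?_⟩
  · have : (2 * ((s : ℝ) + F + 2) - 36 * T) / 6 ≤ -(5 * T) := by linarith
    gcongr
  -- The denominator is at most `144 T`, and `√(ε / (144 T)) = ε / (12 a²)`. Multiplied by `48 s² ≥
  -- 48 (y a³)²` this gives the exponent `4T`.
  · have h1 : y⁻¹ / (12 * a ^ 2) ≤ Real.sqrt (ε / (2 * (36 * T) + s + ε)) := by
      refine Real.le_sqrt_of_sq_le ?_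
      have h2 : ε / (144 * T) ≤ ε / (2 * (36 * T) + s + ε) := by
        gcongr
        linarith
      refine le_trans (le_of_eq ?_) h2
      rw [hT, hy]
      field_simp
      norm_num
    have h3 : 4 * T ≤ ((48 * s ^ 2 : ℕ) : ℝ) * Real.sqrt (ε / (2 * (36 * T) + s + ε)) := by
      calc 4 * T = 48 * (y * a ^ 3) ^ 2 * (y⁻¹ / (12 * a ^ 2)) := by
            rw [hT]; field_simp; norm_num
        _ ≤ 48 * (s : ℝ) ^ 2 * Real.sqrt (ε / (2 * (36 * T) + s + ε)) := by gcongr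
        _ = _ := by push_cast; ring
    gcongr
  -- The logarithm of the rank is then at most `2 y a³ · 3a = 6T`, so `√r` costs `exp (3T)` against
  -- a gain of `exp (4T)`.
  · have hlog : A * Real.log (2 + s) ≤ 3 * a := by
      have h1 : (2 : ℝ) + s ≤ (2 + y) * (2 * a ^ 3) := by nlinarith
      have h2 : Real.log (2 + s) ≤ Real.log (2 + y) + (Real.log 2 + 3 * Real.log a) := by
        refine (Real.log_le_log (by positivity) h1).trans (le_of_eq ?_)
        rw [Real.log_mul (by positivity) (by positivity), Real.log_mul (by norm_num) (by positivity),
          Real.log_pow]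
        norm_num
      have h3 := mul_log_le_of_sq_le hA (show 36 * A ^ 2 ≤ a by linarith)
      have h4 : A * Real.log 2 ≤ a := by
        have := Real.log_two_lt_d9
        nlinarith
      nlinarith
    have hr6 : 1024 * F ^ 2 * r ≤ Real.exp (6 * T) := by
      refine hr.trans (Real.exp_le_exp.2 ?_)
      calc A * s * Real.log (2 + s) = s * (A * Real.log (2 + s)) := by ring
        _ ≤ 2 * (y * a ^ 3) * (3 * a) := by
            refine mul_le_mul hsR hlog ?_ (by positivity)
            exact mul_nonneg (by linarith) (Real.log_nonneg (by linarith))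
        _ = 6 * T := by rw [hT]; ring
    have h1 : 32 * F * Real.sqrt r ≤ Real.exp (3 * T) := by
      have h2 : 32 * F * Real.sqrt r = Real.sqrt (1024 * F ^ 2 * r) := by
        rw [Real.sqrt_mul (by positivity), show 1024 * F ^ 2 = (32 * F) ^ 2 by ring,
          Real.sqrt_sq (by positivity)]
      rw [h2]
      refine (Real.sqrt_le_sqrt hr6).trans (le_of_eq ?_)
      rw [show 6 * T = 3 * T + 3 * T by ring, Real.exp_add, Real.sqrt_mul_self (Real.exp_pos _).le]
    have h4 : Real.exp (-T) = Real.exp (3 * T) * Real.exp (-(4 * T)) := by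
      rw [← Real.exp_add]; congr 1; ring
    rw [h4]
    nlinarith [Real.exp_pos (-(4 * T))]
  · refine Real.sqrt_le_iff.2 ⟨by positivity, ?_⟩
    have h4 : (Real.exp (-T) / 4) ^ 2 = Real.exp (-(2 * T)) / 16 := by
      rw [div_pow, ← Real.exp_nat_mul]; norm_num
    rw [h4, div_le_iff₀ hε]
    linarith

lemma cube_add_le {p q : ℝ} (hp : 0 ≤ p) (hq : 0 ≤ q) : (p + q) ^ 3 ≤ 4 * (p ^ 3 + q ^ 3) := by
  nlinarith [mul_nonneg (add_nonneg hp hq) (sq_nonneg (p - q))]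

/-- The rank that the parameters lead to, in terms of `x = ε⁻¹ (1 + q ^ 3)`. -/
lemma exp_mul_log_le_softO {A C₁ : ℝ} (hA : 1 ≤ A) (hC₁ : 1 ≤ C₁) :
    ∃ C, 0 < C ∧ ∀ {y q s : ℝ}, 0 < y → 0 ≤ q → 0 ≤ s →
      s ≤ 2 * (y * (q + C₁ * Real.log (2 + y)) ^ 3) →
      Real.exp (A * s * Real.log (2 + s)) ≤ (2 : ℝ) ^ softO C 4 (y + y * q ^ 3) := by
  set C₅ := 8 * (8 + C₁ ^ 3) with hC₅
  have hC₅0 : 1 ≤ C₅ := by have : 0 ≤ C₁ ^ 3 := by positivity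
                           linarith
  set C₆ := 2 * Real.log (1 + C₅) + 4 with hC₆
  have hC₆0 : 0 < C₆ := by
    have := Real.log_nonneg (show 1 ≤ 1 + C₅ by linarith)
    linarith
  have hl2 : 0 < Real.log 2 := Real.log_pos (by norm_num)
  refine ⟨A * C₅ * C₆ / Real.log 2, by positivity, fun {y q s} hy hq hs0 hs => ?_⟩
  set x := y + y * q ^ 3 with hx
  set L := Real.log (2 + x) with hL
  have hq3 : 0 ≤ y * q ^ 3 := by positivity
  have hx0 : 0 < x := by linarith
  have hL2 : Real.log 2 ≤ L := Real.log_le_log (by norm_num) (by linarith)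
  have hLh : 1 / 2 ≤ L := by linarith [Real.log_two_gt_d9]
  have hΛL : Real.log (2 + y) ≤ L := Real.log_le_log (by positivity) (by linarith)
  have hΛ0 : 0 ≤ Real.log (2 + y) := Real.log_nonneg (by linarith)
  have hL3 : 1 ≤ 8 * L ^ 3 := by
    have : (1 / 2 : ℝ) ^ 3 ≤ L ^ 3 := by gcongr
    linarith
  -- Cubing the logarithmic part of `a` yields `L ^ 3`; the factor `log (2 + s)` adds one more,
  -- whence the power `4`.
  have hsx : s ≤ C₅ * x * L ^ 3 := by
    have h1 : (q + C₁ * Real.log (2 + y)) ^ 3 ≤ 4 * (q ^ 3 + C₁ ^ 3 * L ^ 3) :=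
      calc (q + C₁ * Real.log (2 + y)) ^ 3 ≤ (q + C₁ * L) ^ 3 := by gcongr
        _ ≤ 4 * (q ^ 3 + (C₁ * L) ^ 3) := cube_add_le hq (by positivity)
        _ = _ := by ring
    calc s ≤ 2 * (y * (4 * (q ^ 3 + C₁ ^ 3 * L ^ 3))) := hs.trans (by gcongr)
      _ = 8 * (y * q ^ 3) + 8 * C₁ ^ 3 * L ^ 3 * y := by ring
      _ ≤ 8 * (x * (8 * L ^ 3)) + 8 * C₁ ^ 3 * L ^ 3 * x := by
          refine add_le_add ?_ (by gcongr; linarith)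
          have : y * q ^ 3 ≤ x := by linarith
          nlinarith
      _ = C₅ * x * L ^ 3 := by rw [hC₅]; ring
  have hlog : Real.log (2 + s) ≤ C₆ * L := by
    have h1 : L ≤ 2 + x := (Real.log_le_sub_one_of_pos (by linarith)).trans (by linarith)
    have h2 : 2 + s ≤ (1 + C₅) * (2 + x) ^ 4 := by
      have h3 : L ^ 3 ≤ (2 + x) ^ 3 := by gcongr
      have h4 : C₅ * x * L ^ 3 ≤ C₅ * (2 + x) * (2 + x) ^ 3 := by gcongr; linarith
      have h5 : 2 + x ≤ (2 + x) ^ 4 := le_self_pow₀ (by linarith) (by norm_num)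
      nlinarith
    calc Real.log (2 + s) ≤ Real.log ((1 + C₅) * (2 + x) ^ 4) := Real.log_le_log (by linarith) h2
      _ = Real.log (1 + C₅) + 4 * L := by
          rw [Real.log_mul (by positivity) (by positivity), Real.log_pow]; norm_num [hL]
      _ ≤ C₆ * L := by
          have := Real.log_nonneg (show 1 ≤ 1 + C₅ by linarith)
          rw [hC₆]; nlinarith
  rw [softO, Real.rpow_def_of_pos (by norm_num)]
  apply Real.exp_le_exp.2
  calc A * s * Real.log (2 + s) ≤ A * (C₅ * x * L ^ 3) * (C₆ * L) := by
        have := Real.log_nonneg (show 1 ≤ 2 + s by linarith)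
        gcongr
    _ = Real.log 2 * (A * C₅ * C₆ / Real.log 2 * x * L ^ 4) := by field_simp

end Parameters

/-! ### The main theorem. -/

section Main

lemma IsEnergyGap.le_finrank_groundSpace {m d : ℕ}
    {h : Fin m → Matrix (Fin d × Fin d) (Fin d × Fin d) ℂ}
    (hh : ∀ i, (h i).PosSemidef ∧ (1 - h i).PosSemidef) {ε : ℝ}
    (hε : IsEnergyGap (chainHamiltonian h) ε) {Ψ : ChainSpace (m + 1) d}
    (hΨG : Ψ ∈ groundSpace (chainHamiltonian h)) (hΨ : Ψ ≠ 0) :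
    0 < ε ∧ 1 ≤ Module.finrank ℂ (groundSpace (chainHamiltonian h)) ∧
      ε ≤ Module.finrank ℂ (groundSpace (chainHamiltonian h)) := by
  rw [chainHamiltonian_eq] at hε hΨG ⊢
  obtain ⟨hε0, hG, -, hgap, htop⟩ := hε.variational (isSelfAdjoint_sum_bondTerm hh Finset.univ)
  have hf1 : 1 ≤ Module.finrank ℂ (groundSpace (∑ i, bondTerm h i :
      ChainSpace (m + 1) d →L[ℂ] ChainSpace (m + 1) d).toLinearMap) := by
    rw [Nat.succ_le_iff, Module.finrank_pos_iff]
    exact ⟨⟨Ψ, hΨG⟩, 0, fun h0 => hΨ (congrArg Subtype.val h0)⟩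
  exact ⟨hε0, hf1, energyGap_le hh rfl hf1 htop hG hgap⟩

lemma inv_mul_rpow_cube {ε i : ℝ} (hε : 0 < ε) (hi : 0 ≤ i) :
    ε⁻¹ * ((ε * i) ^ (1 / 4 : ℝ)) ^ 3 = ε ^ (-(1 / 4) : ℝ) * i ^ (3 / 4 : ℝ) := by
  rw [← Real.rpow_natCast, ← Real.rpow_mul (by positivity), Real.mul_rpow hε.le hi, ← mul_assoc,
    ← Real.rpow_neg_one, ← Real.rpow_add hε]
  norm_num

lemma le_inv_mul_rpow_add_pow {ε i b : ℝ} (hε : 0 < ε) (hi : 0 ≤ i) (hb : 0 ≤ b) :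
    i ≤ ε⁻¹ * ((ε * i) ^ (1 / 4 : ℝ) + b) ^ 4 := by
  have h1 : ((ε * i) ^ (1 / 4 : ℝ)) ^ 4 = ε * i := by
    rw [← Real.rpow_natCast, ← Real.rpow_mul (by positivity)]
    norm_num
  have h2 : 0 ≤ (ε * i) ^ (1 / 4 : ℝ) := by positivity
  calc i = ε⁻¹ * (ε * i) := by rw [← mul_assoc, inv_mul_cancel₀ hε.ne', one_mul]
    _ = ε⁻¹ * ((ε * i) ^ (1 / 4 : ℝ)) ^ 4 := by rw [h1]
    _ ≤ _ := by gcongr; linarith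

theorem mainTheorem3 (d f : ℕ) :
    ∃ c : ℝ, 0 < c ∧ ∃ C : ℝ, 0 < C ∧ ∃ k : ℕ,
      ∀ (n : ℕ) (h : Fin (2 * n + 1) → Matrix (Fin d × Fin d) (Fin d × Fin d) ℂ),
        (∀ i, (h i).PosSemidef ∧ (1 - h i).PosSemidef) →
        Module.finrank ℂ (groundSpace (chainHamiltonian h)) = f →
        ∀ ε : ℝ, IsEnergyGap (chainHamiltonian h) ε →
        ∀ Ψ ∈ groundSpace (chainHamiltonian h), ‖Ψ‖ = 1 →
          ∃ Φ : ℕ → ChainSpace (2 * n + 1 + 1) d, ∀ i : ℕ,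
            ‖Φ i‖ = 1 ∧
            1 - (2 : ℝ) ^ (-(c * (i : ℝ))) ≤ ‖inner ℂ (Φ i) Ψ‖ ∧
            (schmidtRank (n + 1) (Φ i) : ℝ) ≤
              (2 : ℝ) ^ softO C k (ε⁻¹ + ε ^ (-(1 / 4) : ℝ) * (i : ℝ) ^ (3 / 4 : ℝ)) := by
  obtain ⟨A, hA, hrank⟩ := exists_filter_rank_le d f
  set a₀ : ℝ := 36 * A ^ 2 + 256 * (f + 2) with ha₀
  have hA0 : A ≤ a₀ := by
    have : (0 : ℝ) ≤ f := Nat.cast_nonneg f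
    nlinarith
  obtain ⟨C, hC, hsoft⟩ := exp_mul_log_le_softO (C₁ := 2 * a₀) hA (by linarith)
  refine ⟨1, one_pos, C, hC, 4, fun n h hh hf ε hε Ψ hΨG hΨ => ?_⟩
  have hΨ0 : Ψ ≠ 0 := by rintro rfl; simp at hΨ
  obtain ⟨hε0, hf1, hεf⟩ := hε.le_finrank_groundSpace hh hΨG hΨ0
  rw [hf] at hf1 hεf
  refine ⟨_, fun i => Classical.choose_spec (p := fun φ : ChainSpace (2 * n + 1 + 1) d => ‖φ‖ = 1 ∧
    1 - (2 : ℝ) ^ (-(1 * (i : ℝ))) ≤ ‖inner ℂ φ Ψ‖ ∧ (schmidtRank (n + 1) φ : ℝ) ≤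
      (2 : ℝ) ^ softO C 4 (ε⁻¹ + ε ^ (-(1 / 4) : ℝ) * (i : ℝ) ^ (3 / 4 : ℝ))) ?_⟩
  have hi0 : (0 : ℝ) ≤ i := Nat.cast_nonneg i
  have hy0 : 0 < ε⁻¹ := inv_pos.2 hε0
  have hΛ : 1 / 2 ≤ Real.log (2 + ε⁻¹) := by
    have := Real.log_le_log (show (0 : ℝ) < 2 by norm_num) (show 2 ≤ 2 + ε⁻¹ by linarith)
    linarith [Real.log_two_gt_d9]
  set q : ℝ := (ε * i) ^ (1 / 4 : ℝ) with hq
  have hq0 : 0 ≤ q := by positivity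
  have ha₀Λ : a₀ ≤ 2 * a₀ * Real.log (2 + ε⁻¹) := by nlinarith
  have hAΛ : A * Real.log (2 + ε⁻¹) ≤ 2 * a₀ * Real.log (2 + ε⁻¹) :=
    mul_le_mul_of_nonneg_right (by linarith) (by linarith)
  -- The term `q` gives `ε⁻¹ a⁴ ≥ i`, and `ε⁻¹ q³` is the second summand of the exponent. The
  -- logarithmic term keeps `a` above both `a₀` and `A log (2 + ε⁻¹)`; the factor `2` compensates
  -- for `log (2 + ε⁻¹)` being only known to be at least `1 / 2`.
  set a : ℝ := q + 2 * a₀ * Real.log (2 + ε⁻¹) with ha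
  set s : ℕ := ⌈ε⁻¹ * a ^ 3⌉₊ with hs
  set r : ℕ := f * (s * (d ^ s * ((48 * s ^ 2 + 1) *
      ((d * d + 1) * (48 * s ^ 2 + 1)) ^ (48 * s)) * d ^ s)) with hr
  have hs1 : 1 ≤ s := by
    rw [Nat.one_le_ceil_iff]
    have : 0 < a := by linarith
    positivity
  obtain ⟨-, hs2, ht, hδ, hδε, hη, hsmall, hdist⟩ := parameters_admissible (F := f) (s := s)
    (r := r) (a := a) (by exact_mod_cast hf1) hA hε0 hεf (by linarith) (by linarith) hs
    (hrank s hs1)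
  set T := ε⁻¹ * a ^ 4 with hT
  have hiT : (i : ℝ) ≤ T := le_inv_mul_rpow_add_pow hε0 hi0 (by linarith)
  have hr1 : (r : ℝ) ≤ (2 : ℝ) ^ softO C 4 (ε⁻¹ + ε ^ (-(1 / 4) : ℝ) * (i : ℝ) ^ (3 / 4 : ℝ)) := by
    rw [← inv_mul_rpow_cube hε0 hi0]
    refine le_trans ?_ (hsoft hy0 hq0 (Nat.cast_nonneg s) hs2)
    refine le_trans ?_ (hrank s hs1)
    have : (1 : ℝ) ≤ 1024 * (f : ℝ) ^ 2 := by
      have : (1 : ℝ) ≤ f := by exact_mod_cast hf1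
      nlinarith
    exact le_mul_of_one_le_left (Nat.cast_nonneg r) this
  have hpow : Real.exp (-T) ≤ (2 : ℝ) ^ (-(1 * (i : ℝ))) := by
    rw [Real.rpow_def_of_pos (by norm_num)]
    apply Real.exp_le_exp.2
    have := mul_le_of_le_one_left hi0 (show Real.log 2 ≤ 1 by linarith [Real.log_two_lt_d9])
    linarith
  rcases le_or_gt s n with hsn | hsn
  · have hT1 : Real.exp (-T) ≤ 1 := Real.exp_le_one_iff.2 (by linarith)
    -- The pigeonhole condition holds as `48 s² < s (48 s + 1)`. The filter and truncation errors
    -- are at most `exp (-T) / 4` each, and normalizing doubles their sum.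
    obtain ⟨v, hv, hvΨ⟩ := exists_isSumOfProducts_approx (l := 48 * s ^ 2) (k := 48 * s) hs1 hsn hh
      hf hε hΨG hΨ (by nlinarith) ht hδ hδε hr.ge hη (by linarith)
    obtain ⟨c, hc1, hc2⟩ := exists_unit_overlap (v := v) hΨ (κ := Real.exp (-T) / 2)
      (by linarith) (by linarith)
    refine ⟨c • v, hc1, by linarith, ?_⟩
    exact le_trans (by exact_mod_cast (hv.smul c).schmidtRank_le) hr1
  -- The block does not fit, so `n + 1 ≤ s` and the trivial rank bound `d ^ (n + 1)` is already
  -- below `r`.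
  · refine ⟨Ψ, hΨ, ?_, le_trans ?_ hr1⟩
    · rw [inner_self_eq_norm_sq_to_K, hΨ]
      simp
    · have hd : 1 ≤ d := by
        rw [Nat.one_le_iff_ne_zero]
        rintro rfl
        exact hΨ0 (by ext σ; exact (σ 0).elim0)
      have h1 : schmidtRank (n + 1) Ψ ≤ r := by
        refine (schmidtRank_le_pow (n + 1) (by omega) Ψ).trans ?_
        calc d ^ (n + 1) ≤ d ^ s := Nat.pow_le_pow_right hd hsn
          _ = 1 * (1 * (d ^ s * (1 * 1) * 1)) := by ring
          _ ≤ r := by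
            rw [hr]
            gcongr
            · omega
            · exact Nat.one_le_pow _ _ (by positivity)
            · exact Nat.one_le_pow _ _ hd
      exact_mod_cast h1

end Main
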